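/- **Theorem 4.2 (Timoshenko–Fourier system with past history on $\mathbb R$).** Let $\rho_1,\rho_2,\rho_3,k,b,m,\delta,\tilde\beta$ be positive constants and let $g:(0,\infty)\to[0,\infty)$ be a differentiable function, not identically zero, for which there are constants $k_1,k_2>0$ with $-k_1g(s)\le g'(s)\le -k_2g(s)$ for all $s>0$. Put $b_0=\int_0^\infty g(s)\,ds$, assume $a:=b-b_0>0$, and let $$\chi_0=\rho_2-\frac{b\rho_1}{k}.$$ Consider, for $t>0$, $x\in\mathbb R$, $s>0$, the system $$\begin{cases} v_t-u_x+y=0,\\ \rho_1u_t-kv_x=0,\\ z_t-y_x=0,\\ \rho_2y_t-az_x-m\int_0^\infty g(s)\,\eta_{xx}(s)\,ds-kv+\delta\theta_x=0,\\ \rho_3\theta_t-\tilde\beta\theta_{xx}+\delta y_x=0,\\ \eta_t+\eta_s-y=0,\qquad \eta(t,0,x)=0, \end{cases}$$ for $V=(v,u,z,y,\theta,\eta)$, where $\eta=\eta(t,s,x)$, with initial value $V(0)=V_0$. A solution is a function $V$ that is continuous on $[0,\infty)$ with values in $[L^2(\mathbb R)]^5\times L^2_g(\mathbb R^+;H^1(\mathbb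 R))$ and satisfies $V(0)=V_0$ and, for $t>0$, the equations weakly, that is, after pairing with test functions $\varphi\in C_c^\infty(\mathbb R)$ in $x$, and, for the last equation together with its boundary condition, with products $\psi(s)\varphi(x)$, $\psi,\varphi\in C_c^\infty(\mathbb R)$, over $s>0$. Here $L^2_g(\mathbb R^+;X)$ is the space of $h:\mathbb R^+\to X$ with $\int_0^\infty g(s)\|h(s)\|_X^2\,ds<\infty$. For $p\in\{1,2\}$ write $$\|\partial_x^jV\|_p=\sum_{f\in\{v,u,z,y,\theta\}}\|\partial_x^jf\|_{L^p}+\Big(\int_0^\infty g(s)\,\|\partial_x^{j+1}\eta(s)\|_{L^p}^2\,ds\Big)^{1/2}.$$ Let $s\ge 0$ be an integer. There are constants $C_1,C_2>0$, depending only on $s$, on the coefficients and on $g$, such that for every $$V_0\in\Big([H^s(\mathbb R)]^5\times L^2_g(\mathbb R^+;H^{1+s}(\mathbb R))\Big)\cap\Big([L^1(\mathbb R)]^5\times L^2_g(\mathbb R^+;W^{1,1}(\mathbb R))\Big),$$ for the solution $V$ with $V(0)=V_0$, for all integers $j,l\ge0$ with $j+l\le s$ and for all $t\ge0$: (i) if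 $\chi_0=0$, then $$\|\partial_x^jV(t)\|_2\le C_1(1+t)^{-\frac18-\frac j4}\|V_0\|_1+C_2(1+t)^{-\frac l2}\|\partial_x^{j+l}V_0\|_2;$$ (ii) if $\chi_0\ne0$, then $$\|\partial_x^jV(t)\|_2\le C_1(1+t)^{-\frac18-\frac j4}\|V_0\|_1+C_2(1+t)^{-\frac l4}\|\partial_x^{j+l}V_0\|_2.$$ In particular, the weak derivatives on the left exist and are in the stated spaces. -/

import Mathlib

open MeasureTheory Set Filter Topology
open scoped ENNReal ContDiff

namespace Timoshenko

noncomputable section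

/-- Real test functions on the line: smooth with compact support. -/
def IsTest (φ : ℝ → ℝ) : Prop := ContDiff ℝ ∞ φ ∧ HasCompactSupport φ

/-- `h` is the weak derivative of order `j` of `f` on `ℝ`. -/
def IsWeakDeriv (j : ℕ) (f h : ℝ → ℝ) : Prop :=
  LocallyIntegrable f ∧ LocallyIntegrable h ∧
    ∀ φ : ℝ → ℝ, IsTest φ →
      ∫ x, f x * iteratedDeriv j φ x = (-1 : ℝ) ^ j * ∫ x, h x * φ x

/-- The Sobolev space `W^{n,p}(ℝ)`; it is `H^n(ℝ)` for `p = 2` and `L^p(ℝ)` for `n = 0`. -/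
def MemW (n : ℕ) (p : ℝ≥0∞) (f : ℝ → ℝ) : Prop :=
  ∀ j ≤ n, ∃ h, IsWeakDeriv j f h ∧ MemLp h p volume

/-- `‖∂_x^j f‖_{L^p}`; it is `∞` if there is no weak derivative of order `j`. The weak derivative
is unique up to null sets, so the infimum is over one value only. -/
def derivNorm (p : ℝ≥0∞) (j : ℕ) (f : ℝ → ℝ) : ℝ≥0∞ :=
  ⨅ (h : ℝ → ℝ) (_ : IsWeakDeriv j f h), eLpNorm h p volume

/-- Joint measurability of a function of the history variable `s > 0` and of `x ∈ ℝ`. -/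
def HistMeasurable (h : ℝ → ℝ → ℝ) : Prop :=
  AEStronglyMeasurable (fun q : ℝ × ℝ => h q.1 q.2)
    ((volume.restrict (Ioi (0 : ℝ))).prod volume)

/-- `h = ∂_x^j η` in the weak sense, for almost every `s > 0`. -/
def IsHistDeriv (j : ℕ) (η h : ℝ → ℝ → ℝ) : Prop :=
  HistMeasurable h ∧ ∀ᵐ s ∂(volume.restrict (Ioi (0 : ℝ))), IsWeakDeriv j (η s) (h s)

/-- The norm `(∫_0^∞ g(s) ‖h(s)‖_{L^p}² ds)^{1/2}` of `L²_g(ℝ⁺; L^p(ℝ))`. -/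
def histNorm (g : ℝ → ℝ) (p : ℝ≥0∞) (h : ℝ → ℝ → ℝ) : ℝ≥0∞ :=
  (∫⁻ s in Ioi (0 : ℝ), ENNReal.ofReal (g s) * eLpNorm (h s) p volume ^ 2) ^ (1 / 2 : ℝ)

/-- The weighted space `L²_g(ℝ⁺; W^{n,p}(ℝ))`. -/
def MemHist (g : ℝ → ℝ) (n : ℕ) (p : ℝ≥0∞) (η : ℝ → ℝ → ℝ) : Prop :=
  HistMeasurable η ∧ ∀ j ≤ n, ∃ h, IsHistDeriv j η h ∧ histNorm g p h < ⊤

/-- The norm of `∂_x^j η` in `L²_g(ℝ⁺; L^p(ℝ))`; it is `∞` if there is no weak derivative. -/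
def histDerivNorm (g : ℝ → ℝ) (p : ℝ≥0∞) (j : ℕ) (η : ℝ → ℝ → ℝ) : ℝ≥0∞ :=
  ⨅ (h : ℝ → ℝ → ℝ) (_ : IsHistDeriv j η h), histNorm g p h

/-- The coefficients of the system. `k` is the shear stiffness, `βt` the heat conductivity
`β̃ = 1 / β`, and `g` the memory kernel. -/
structure Coeffs where
  ρ₁ : ℝ
  ρ₂ : ℝ
  ρ₃ : ℝ
  k : ℝ
  b : ℝ
  m : ℝ
  δ : ℝ
  βt : ℝ
  g : ℝ → ℝ

/-- The total mass `b₀ = ∫_0^∞ g(s) ds` of the memory kernel. -/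
def Coeffs.b₀ (P : Coeffs) : ℝ := ∫ s in Ioi (0 : ℝ), P.g s

/-- `a = b - b₀`. -/
def Coeffs.a (P : Coeffs) : ℝ := P.b - P.b₀

/-- The stability number `χ₀ = ρ₂ - b ρ₁ / k`. -/
def Coeffs.χ₀ (P : Coeffs) : ℝ := P.ρ₂ - P.b * P.ρ₁ / P.k

/-- The standing assumptions on the coefficients and on the kernel. -/
structure Coeffs.Admissible (P : Coeffs) : Prop where
  ρ₁_pos : 0 < P.ρ₁
  ρ₂_pos : 0 < P.ρ₂
  ρ₃_pos : 0 < P.ρ₃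
  k_pos : 0 < P.k
  b_pos : 0 < P.b
  m_pos : 0 < P.m
  δ_pos : 0 < P.δ
  βt_pos : 0 < P.βt
  g_nonneg : ∀ s > 0, 0 ≤ P.g s
  g_differentiable : ∀ s > 0, DifferentiableAt ℝ P.g s
  g_decay : ∃ k₁ > 0, ∃ k₂ > 0, ∀ s > 0,
    -k₁ * P.g s ≤ deriv P.g s ∧ deriv P.g s ≤ -k₂ * P.g s
  /-- the kernel is not identically zero -/
  g_ne_zero : ∃ s > 0, P.g s ≠ 0
  a_pos : 0 < P.a

/-- The value `(v, u, z, y, θ, η)` of the unknown at one time; `η` is a function of `(s, x)`. -/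
structure State where
  v : ℝ → ℝ
  u : ℝ → ℝ
  z : ℝ → ℝ
  y : ℝ → ℝ
  θ : ℝ → ℝ
  η : ℝ → ℝ → ℝ

/-- `[H^n(ℝ)]^5 × L²_g(ℝ⁺; H^{1+n}(ℝ))`. -/
def MemH (g : ℝ → ℝ) (n : ℕ) (V : State) : Prop :=
  MemW n 2 V.v ∧ MemW n 2 V.u ∧ MemW n 2 V.z ∧ MemW n 2 V.y ∧ MemW n 2 V.θ ∧
    MemHist g (1 + n) 2 V.η

/-- `[L^1(ℝ)]^5 × L²_g(ℝ⁺; W^{1,1}(ℝ))`. -/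
def MemL1 (g : ℝ → ℝ) (V : State) : Prop :=
  MemW 0 1 V.v ∧ MemW 0 1 V.u ∧ MemW 0 1 V.z ∧ MemW 0 1 V.y ∧ MemW 0 1 V.θ ∧
    MemHist g 1 1 V.η

/-- `‖∂_x^j V‖_p`, where the history component is measured, one derivative higher, by
`(∫_0^∞ g(s) ‖∂_x^{j+1} η(s)‖_{L^p}² ds)^{1/2}`. -/
def State.norm (g : ℝ → ℝ) (p : ℝ≥0∞) (j : ℕ) (V : State) : ℝ≥0∞ :=
  derivNorm p j V.v + derivNorm p j V.u + derivNorm p j V.z + derivNorm p j V.y +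
    derivNorm p j V.θ + histDerivNorm g p (j + 1) V.η

/-- Componentwise difference. -/
def State.sub (V W : State) : State where
  v := fun x => V.v x - W.v x
  u := fun x => V.u x - W.u x
  z := fun x => V.z x - W.z x
  y := fun x => V.y x - W.y x
  θ := fun x => V.θ x - W.θ x
  η := fun s x => V.η s x - W.η s x

/-- The full norm of `[L²(ℝ)]^5 × L²_g(ℝ⁺; H^1(ℝ))`. -/
def State.fullNorm (g : ℝ → ℝ) (V : State) : ℝ≥0∞ :=
  V.norm g 2 0 + histDerivNorm g 2 0 V.η

/-- `V` is the (weak) solution with initial value `V₀` of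
```
v_t - u_x + y = 0,
ρ₁ u_t - k v_x = 0,
z_t - y_x = 0,
ρ₂ y_t - a z_x - m ∫_0^∞ g(s) η_xx(s) ds - k v + δ θ_x = 0,
ρ₃ θ_t - β̃ θ_xx + δ y_x = 0,
η_t + η_s - y = 0,   η(t, 0, x) = 0.
```
It is continuous in time with values in `[L²]^5 × L²_g(H^1)`, and each equation holds after
pairing with test functions `φ(x)`, for the last one `ψ(s) φ(x)`. As `ψ` need not vanish at `s = 0`,
the last identity contains the boundary condition at `s = 0`. -/
structure IsSolution (P : Coeffs) (V₀ : State) (V : ℝ → State) : Prop where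
  initial : V 0 = V₀
  mem : ∀ t ≥ 0, MemH P.g 0 (V t)
  continuous : ∀ t₀ ≥ 0,
    Tendsto (fun t => ((V t).sub (V t₀)).fullNorm P.g) (𝓝[Ici 0] t₀) (𝓝 0)
  eq_v : ∀ φ, IsTest φ → ∀ t > 0,
    HasDerivAt (fun t => ∫ x, (V t).v x * φ x)
      (-(∫ x, (V t).u x * deriv φ x) - ∫ x, (V t).y x * φ x) t
  eq_u : ∀ φ, IsTest φ → ∀ t > 0,
    HasDerivAt (fun t => P.ρ₁ * ∫ x, (V t).u x * φ x)
      (-P.k * ∫ x, (V t).v x * deriv φ x) t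
  eq_z : ∀ φ, IsTest φ → ∀ t > 0,
    HasDerivAt (fun t => ∫ x, (V t).z x * φ x) (-∫ x, (V t).y x * deriv φ x) t
  eq_y : ∀ φ, IsTest φ → ∀ t > 0,
    HasDerivAt (fun t => P.ρ₂ * ∫ x, (V t).y x * φ x)
      (-P.a * (∫ x, (V t).z x * deriv φ x)
        + P.m * (∫ s in Ioi (0 : ℝ), P.g s * ∫ x, (V t).η s x * iteratedDeriv 2 φ x)
        + P.k * (∫ x, (V t).v x * φ x) + P.δ * ∫ x, (V t).θ x * deriv φ x) t
  eq_θ : ∀ φ, IsTest φ → ∀ t > 0,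
    HasDerivAt (fun t => P.ρ₃ * ∫ x, (V t).θ x * φ x)
      (P.βt * (∫ x, (V t).θ x * iteratedDeriv 2 φ x)
        + P.δ * ∫ x, (V t).y x * deriv φ x) t
  eq_η : ∀ φ ψ, IsTest φ → IsTest ψ → ∀ t > 0,
    HasDerivAt (fun t => ∫ s in Ioi (0 : ℝ), ψ s * ∫ x, (V t).η s x * φ x)
      ((∫ s in Ioi (0 : ℝ), deriv ψ s * ∫ x, (V t).η s x * φ x)
        + (∫ s in Ioi (0 : ℝ), ψ s) * ∫ x, (V t).y x * φ x) t

end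

end Timoshenko

/-!
# Decay of the Timoshenko–Fourier system with past history on the line

After a Fourier transform in `x` the system decouples into one damped evolution for each frequency.
Only the temperature and the history are damped directly, through `θ_xx` and through the decay of the
memory kernel; the coupling passes the damping on to `y`, `z`, `v` and `u`. A Lyapunov functional, the
energy plus four small correction terms, turns this into exponential decay at the rate
`c ν⁴ / (1 + ν²)³` at frequencies of size `ν` (`BandEvolution.exists_decay`). The corrections for `z`
and `v` are weighted so that the rate holds whatever the value of `χ₀`. Hence the faster of the two
asserted decay rates, `(1 + t)^(-l/2)`, holds in both cases, and the estimate for `χ₀ ≠ 0` is weaker.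

A solution is merely a weak one, so the differential identities are not available pointwise in the
frequency. The Fourier transforms are instead cut off to frequency bands `ν ≤ |2πξ| < 2ν`, where `∂_x`
is a bounded skew-adjoint operator on `L²` and the weak equations become differential equations in a
Hilbert space (`Band.hasDerivAt_comp`, `HilbertSolution.bandEvolution`).

The history solves a transport equation in `s` and is only continuous in time as an element of
`L²(g(s) ds; L²(ℝ))`. Testing with functions that move along the characteristics yields the solution
formula (`MemoryFlow.ae_comp_add_eq`, `MemoryFlow.ae_eq_of_le`). It bounds the energy of the history
from above by a differentiable function that touches it at a given time and has the slope that the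
dissipation identity predicts (`MemoryFlow.exists_touch`), and such a one-sided bound suffices for a
Gronwall argument (`le_mul_exp_of_touching`). The mean `∫ g(s) ∂_x η(s) ds` is differentiable from the
right (`MemoryFlow.hasDerivWithinAt_histMean`), which is all that the correction for `y` needs.

Finally the bands are summed with the cutoff frequency `(1 + t)^(-1/4)` (`exists_bands_le`). The
Fourier transform of the initial value is bounded by its `L¹` norm, so a band of length `ν` contributes
at most a multiple of `ν ‖V₀‖₁²`; together with the decay `exp (-c ν⁴ t)` for `ν ≤ 1` this gives the
first term. For `ν ≥ 1` the rate is of order `ν⁻²`, and `exp (-c t / ν²)` is at most a multiple of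
`(ν² / (1 + t))^l`, at the price of `l` derivatives: this is the second term. Finiteness of the weighted
sum of the band norms also yields the weak derivatives of the solution (`derivNorm_sq_le`,
`histDerivNorm_sq_le`).
-/

namespace Timoshenko

/-! ### Decay from one-sided differential inequalities -/

/-- A continuous function that is touched from above, at each time, by a function of slope at most
`-κ` times its value decays exponentially. Only such a one-sided bound is available for the
memory energy. -/
lemma le_mul_exp_of_touching {L : ℝ → ℝ} {κ : ℝ} (hc : ContinuousOn L (Ici 0))
    (h : ∀ t > 0, ∃ (G : ℝ → ℝ) (g' : ℝ), (∀ r ≥ 0, L (t + r) ≤ G r) ∧ G 0 = L t ∧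
      HasDerivWithinAt G g' (Ici 0) 0 ∧ g' ≤ -κ * L t) :
    ∀ t ≥ 0, L t ≤ L 0 * Real.exp (-κ * t) := by
  have key : ∀ a > 0, ∀ t ≥ a, L t ≤ L a * Real.exp (-κ * (t - a)) := by
    intro a ha t hat
    have := le_gronwallBound_of_liminf_deriv_right_le (f := L) (f' := fun x => -κ * L x)
      (δ := L a) (K := -κ) (ε := 0) (a := a) (b := t)
      (hc.mono fun x hx => ha.le.trans hx.1) ?_ le_rfl (fun x _ => by simp) t ⟨hat, le_rfl⟩
    · rwa [gronwallBound_ε0] at this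
    · intro x hx r hr
      obtain ⟨G, g', hG, hG0, hd, hle⟩ := h x (ha.trans_le hx.1)
      have hslope := (hasDerivWithinAt_iff_tendsto_slope' (by simp)).1
        (hd.mono Ioi_subset_Ici_self)
      have hev : ∀ᶠ ε in 𝓝[>] (0 : ℝ), slope G 0 ε < r :=
        hslope.eventually (gt_mem_nhds (hle.trans_lt hr))
      have hmap : Tendsto (fun z => z - x) (𝓝[>] x) (𝓝[>] 0) := by
        refine tendsto_nhdsWithin_iff.2 ⟨?_, ?_⟩
        · have : Tendsto (fun z => z - x) (𝓝 x) (𝓝 (x - x)) := tendsto_id.sub_const x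
          rw [sub_self] at this
          exact this.mono_left nhdsWithin_le_nhds
        · filter_upwards [self_mem_nhdsWithin] with z hz
          exact sub_pos.2 (mem_Ioi.1 hz)
      refine Eventually.frequently ?_
      filter_upwards [hmap.eventually hev, self_mem_nhdsWithin] with z hz hzx
      refine lt_of_le_of_lt ?_ hz
      have hzx' : 0 < z - x := sub_pos.2 hzx
      rw [slope_def_field, sub_zero, inv_mul_eq_div, hG0]
      have := hG (z - x) hzx'.le
      rw [add_sub_cancel] at this
      gcongr
  intro t ht
  rcases ht.eq_or_lt with rfl | ht
  · simp
  have h1 : Tendsto L (𝓝[>] 0) (𝓝 (L 0)) :=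
    (hc 0 (by simp)).tendsto.mono_left (nhdsWithin_mono _ Ioi_subset_Ici_self)
  have h2 : Tendsto (fun a => L a * Real.exp (-κ * (t - a))) (𝓝[>] 0)
      (𝓝 (L 0 * Real.exp (-κ * (t - 0)))) := by
    refine h1.mul (Tendsto.mono_left ?_ nhdsWithin_le_nhds)
    exact Continuous.tendsto (by fun_prop) 0
  rw [sub_zero] at h2
  refine ge_of_tendsto h2 ?_
  filter_upwards [Ioo_mem_nhdsGT ht] with a ha
  exact key a ha.1 t ha.2.le

/-! ### The Lyapunov inequality in one frequency band -/

section Lyapunov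

/-- A cross term with at least one factor `d` to spare, where `S` bounds the weighted squares. -/
lemma pow_mul_mul_le {d S a b : ℝ} {k : ℕ} (hd : 0 < d) (hd1 : d ≤ 1) (hk : 1 ≤ k)
    (ha : a ^ 2 ≤ S) (hb : b ^ 2 ≤ S) : d ^ k * (a * b) ≤ d * S := by
  have h1 : d ^ k ≤ d := by
    calc d ^ k ≤ d ^ 1 := pow_le_pow_of_le_one hd.le hd1 hk
      _ = d := pow_one d
  have hS : 0 ≤ S := (sq_nonneg a).trans ha
  have hab : a * b ≤ S := by linarith [two_mul_le_add_sq a b]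
  calc d ^ k * (a * b) ≤ d ^ k * S := by gcongr
    _ ≤ d * S := by gcongr

/-- The cross terms of the Lyapunov functional are absorbed when the weights of its four corrections
are the powers `d¹⁰, d¹⁶, d¹⁸, d²⁰` of one small parameter. -/
lemma absorb_cross_terms {c C d n T Y Z V U : ℝ} (hC : 0 ≤ C) (hd : 0 < d) (hd1 : d ≤ 1)
    (hdC : 32 * C * d ≤ c) :
    -c * (n ^ 2 + T ^ 2) + d ^ 10 * (-c * Y ^ 2 + C * (n * Y + n * Z + n ^ 2 + n * V + n * T))
      + d ^ 16 * (-c * Z ^ 2 + C * (n * Z + T * Z + Y ^ 2 + U * Y))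
      + d ^ 18 * (-c * V ^ 2 + C * (Z * V + n * V + T * V + Y ^ 2 + U * Y))
      + d ^ 20 * (-c * U ^ 2 + C * (V ^ 2 + U * Y))
    ≤ -(c / 2) * (n ^ 2 + T ^ 2 + d ^ 10 * Y ^ 2 + d ^ 16 * Z ^ 2 + d ^ 18 * V ^ 2
        + d ^ 20 * U ^ 2) := by
  obtain ⟨S, hS⟩ : ∃ S, S = n ^ 2 + T ^ 2 + (d ^ 5 * Y) ^ 2 + (d ^ 8 * Z) ^ 2 + (d ^ 9 * V) ^ 2
      + (d ^ 10 * U) ^ 2 := ⟨_, rfl⟩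
  have p1 := sq_nonneg n
  have p2 := sq_nonneg T
  have p3 := sq_nonneg (d ^ 5 * Y)
  have p4 := sq_nonneg (d ^ 8 * Z)
  have p5 := sq_nonneg (d ^ 9 * V)
  have p6 := sq_nonneg (d ^ 10 * U)
  have hn : n ^ 2 ≤ S := by linarith only [hS, p1, p2, p3, p4, p5, p6]
  have hT : T ^ 2 ≤ S := by linarith only [hS, p1, p2, p3, p4, p5, p6]
  have hy : (d ^ 5 * Y) ^ 2 ≤ S := by linarith only [hS, p1, p2, p3, p4, p5, p6]
  have hz : (d ^ 8 * Z) ^ 2 ≤ S := by linarith only [hS, p1, p2, p3, p4, p5, p6]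
  have hv : (d ^ 9 * V) ^ 2 ≤ S := by linarith only [hS, p1, p2, p3, p4, p5, p6]
  have hu : (d ^ 10 * U) ^ 2 ≤ S := by linarith only [hS, p1, p2, p3, p4, p5, p6]
  have key : ∀ (k : ℕ) {a b : ℝ}, 1 ≤ k → a ^ 2 ≤ S → b ^ 2 ≤ S → d ^ k * (a * b) ≤ d * S :=
    fun k _ _ hk ha hb => pow_mul_mul_le hd hd1 hk ha hb
  have a1 := key 5 (by norm_num) hn hy
  have a2 := key 2 (by norm_num) hn hz
  have a3 := key 10 (by norm_num) hn hn
  have a4 := key 1 (by norm_num) hn hv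
  have a5 := key 10 (by norm_num) hn hT
  have b1 := key 8 (by norm_num) hn hz
  have b2 := key 8 (by norm_num) hT hz
  have b3 := key 6 (by norm_num) hy hy
  have b4 := key 1 (by norm_num) hu hy
  have c1 := key 1 (by norm_num) hz hv
  have c2 := key 9 (by norm_num) hn hv
  have c3 := key 9 (by norm_num) hT hv
  have c4 := key 8 (by norm_num) hy hy
  have c5 := key 3 (by norm_num) hu hy
  have e1 := key 2 (by norm_num) hv hv
  have e2 := key 5 (by norm_num) hu hy
  have hsum := add_le_add a1 <| add_le_add a2 <| add_le_add a3 <| add_le_add a4 <|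
    add_le_add a5 <| add_le_add b1 <| add_le_add b2 <| add_le_add b3 <| add_le_add b4 <|
    add_le_add c1 <| add_le_add c2 <| add_le_add c3 <| add_le_add c4 <| add_le_add c5 <|
    add_le_add e1 e2
  have hsum' := mul_le_mul_of_nonneg_left hsum hC
  have hS0 : 0 ≤ S := p1.trans hn
  have hfin : 32 * C * d * S ≤ c * S := mul_le_mul_of_nonneg_right hdC hS0
  have hSe : n ^ 2 + T ^ 2 + d ^ 10 * Y ^ 2 + d ^ 16 * Z ^ 2 + d ^ 18 * V ^ 2
      + d ^ 20 * U ^ 2 = S := by rw [hS]; ring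
  have hL := congrArg (fun x => c * x) hSe
  rw [hSe]
  ring_nf at hL hsum' hfin ⊢
  linarith only [hL, hsum', hfin]

/-- The weighted version of `absorb_cross_terms`: `r ^ 2 = 1 / (1 + ν ^ 2)`, and the decay rate is
`ν ^ 4 * r ^ 6 = ν ^ 4 / (1 + ν ^ 2) ^ 3`. -/
lemma weighted_absorb {c C d n θ y z v u ν r : ℝ} (hc : 0 ≤ c) (hC : 0 ≤ C) (hd : 0 < d)
    (hd1 : d ≤ 1) (hdC : 32 * C * d ≤ c) (hn : 0 ≤ n) (hθ : 0 ≤ θ) (hy : 0 ≤ y) (hz : 0 ≤ z)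
    (hv : 0 ≤ v) (hu : 0 ≤ u) (hν : 0 < ν) (hr : 0 < r) (hrν : r ^ 2 * (1 + ν ^ 2) = 1) :
    -c * (n ^ 2 + ν ^ 2 * θ ^ 2)
      + d ^ 10 * r ^ 2 * (-c * (ν ^ 2 * y ^ 2) + C * (ν * n * y + ν ^ 2 * n * z + ν ^ 2 * n ^ 2
          + ν * n * v + ν ^ 2 * n * θ))
      + d ^ 16 * (ν ^ 2 * r ^ 4) * (-c * (ν ^ 2 * z ^ 2) + C * (ν ^ 2 * n * z + ν ^ 2 * θ * z
          + ν ^ 2 * y ^ 2 + ν * u * y))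
      + d ^ 18 * (ν ^ 2 * r ^ 4) * (-c * v ^ 2 + C * (ν * z * v + ν * n * v + ν * θ * v + y ^ 2
          + ν * u * y))
      + d ^ 20 * (ν ^ 2 * r ^ 6) * (-c * (ν ^ 2 * u ^ 2) + C * (ν ^ 2 * v ^ 2 + ν * u * y))
    ≤ -(c / 2) * d ^ 20 * (ν ^ 4 * r ^ 6) *
        (n ^ 2 + θ ^ 2 + y ^ 2 + z ^ 2 + v ^ 2 + u ^ 2) := by
  have hr1 : r ^ 2 ≤ 1 := by nlinarith [sq_nonneg (r * ν)]
  have hq1 : ν ^ 2 * r ^ 2 ≤ 1 := by nlinarith [sq_nonneg r]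
  have hr1' : r ≤ 1 := by nlinarith
  have hq1' : ν * r ≤ 1 := by nlinarith [mul_pos hν hr]
  have hqr : ν * r ^ 2 ≤ 1 := by nlinarith [mul_pos hν hr]
  have h := absorb_cross_terms (n := n) (T := ν * θ) (Y := ν * r * y) (Z := ν ^ 2 * r ^ 2 * z)
    (V := ν * r ^ 2 * v) (U := ν ^ 2 * r ^ 3 * u) hC hd hd1 hdC
  have mono : ∀ q x : ℝ, q ≤ 1 → 0 ≤ x → q * x ≤ x := fun q x hq hx =>
    mul_le_of_le_one_left hx hq
  have h0 : ∀ q x : ℝ, q ≤ 1 → 0 ≤ x → 0 ≤ x - q * x := fun q x hq hx =>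
    sub_nonneg.2 (mono q x hq hx)
  have A : r ^ 2 * (ν * n * y + ν ^ 2 * n * z + ν ^ 2 * n ^ 2 + ν * n * v + ν ^ 2 * n * θ)
      ≤ n * (ν * r * y) + n * (ν ^ 2 * r ^ 2 * z) + n ^ 2 + n * (ν * r ^ 2 * v) + n * (ν * θ) := by
    have h1 := h0 r (n * (ν * r * y)) hr1' (by positivity)
    have h2 := h0 (ν ^ 2 * r ^ 2) (n ^ 2) hq1 (by positivity)
    have h3 := h0 (ν * r ^ 2) (n * (ν * θ)) hqr (by positivity)
    refine sub_nonneg.1 ((add_nonneg (add_nonneg h1 h2) h3).trans_eq ?_)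
    ring
  have B : ν ^ 2 * r ^ 4 * (ν ^ 2 * n * z + ν ^ 2 * θ * z + ν ^ 2 * y ^ 2 + ν * u * y)
      ≤ n * (ν ^ 2 * r ^ 2 * z) + ν * θ * (ν ^ 2 * r ^ 2 * z) + (ν * r * y) ^ 2
        + ν ^ 2 * r ^ 3 * u * (ν * r * y) := by
    have h1 := h0 (ν ^ 2 * r ^ 2) (n * (ν ^ 2 * r ^ 2 * z)) hq1 (by positivity)
    have h2 := h0 (ν * r ^ 2) (ν * θ * (ν ^ 2 * r ^ 2 * z)) hqr (by positivity)
    have h3 := h0 (ν ^ 2 * r ^ 2) ((ν * r * y) ^ 2) hq1 (by positivity)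
    refine sub_nonneg.1 ((add_nonneg (add_nonneg h1 h2) h3).trans_eq ?_)
    ring
  have G : ν ^ 2 * r ^ 4 * (ν * z * v + ν * n * v + ν * θ * v + y ^ 2 + ν * u * y)
      ≤ ν ^ 2 * r ^ 2 * z * (ν * r ^ 2 * v) + n * (ν * r ^ 2 * v) + ν * θ * (ν * r ^ 2 * v)
        + (ν * r * y) ^ 2 + ν ^ 2 * r ^ 3 * u * (ν * r * y) := by
    have h1 := h0 (ν ^ 2 * r ^ 2) (n * (ν * r ^ 2 * v)) hq1 (by positivity)
    have h2 := h0 (ν * r ^ 2) (ν * θ * (ν * r ^ 2 * v)) hqr (by positivity)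
    have h3 := h0 (r ^ 2) ((ν * r * y) ^ 2) hr1 (by positivity)
    refine sub_nonneg.1 ((add_nonneg (add_nonneg h1 h2) h3).trans_eq ?_)
    ring
  have K : ν ^ 2 * r ^ 6 * (ν ^ 2 * v ^ 2 + ν * u * y)
      ≤ (ν * r ^ 2 * v) ^ 2 + ν ^ 2 * r ^ 3 * u * (ν * r * y) := by
    have h1 := h0 (ν ^ 2 * r ^ 2) ((ν * r ^ 2 * v) ^ 2) hq1 (by positivity)
    have h2 := h0 (r ^ 2) (ν ^ 2 * r ^ 3 * u * (ν * r * y)) hr1 (by positivity)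
    refine sub_nonneg.1 ((add_nonneg h1 h2).trans_eq ?_)
    ring
  have A' := mul_le_mul_of_nonneg_left A (show 0 ≤ d ^ 10 * C by positivity)
  have B' := mul_le_mul_of_nonneg_left B (show 0 ≤ d ^ 16 * C by positivity)
  have G' := mul_le_mul_of_nonneg_left G (show 0 ≤ d ^ 18 * C by positivity)
  have K' := mul_le_mul_of_nonneg_left K (show 0 ≤ d ^ 20 * C by positivity)
  have hdp : ∀ k ≤ 20, d ^ 20 ≤ d ^ k := fun k hk => pow_le_pow_of_le_one hd.le hd1 hk
  have hρ1 : ν ^ 4 * r ^ 6 ≤ 1 := by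
    have : ν ^ 4 * r ^ 6 = (ν ^ 2 * r ^ 2) * ((ν ^ 2 * r ^ 2) * r ^ 2) := by ring
    rw [this]
    exact mul_le_one₀ hq1 (by positivity) (mul_le_one₀ hq1 (by positivity) hr1)
  have low : d ^ 20 * (ν ^ 4 * r ^ 6) * (n ^ 2 + θ ^ 2 + y ^ 2 + z ^ 2 + v ^ 2 + u ^ 2) ≤
      n ^ 2 + (ν * θ) ^ 2 + d ^ 10 * (ν * r * y) ^ 2 + d ^ 16 * (ν ^ 2 * r ^ 2 * z) ^ 2
        + d ^ 18 * (ν * r ^ 2 * v) ^ 2 + d ^ 20 * (ν ^ 2 * r ^ 3 * u) ^ 2 := by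
    have l1 : d ^ 20 * (ν ^ 4 * r ^ 6) * n ^ 2 ≤ n ^ 2 :=
      mono _ _ (mul_le_one₀ (by simpa using hdp 0 (by norm_num)) (by positivity) hρ1) (by positivity)
    have l2 : d ^ 20 * (ν ^ 4 * r ^ 6) * θ ^ 2 ≤ (ν * θ) ^ 2 := by
      have := mono (d ^ 20 * (ν ^ 2 * r ^ 2 * r ^ 4)) ((ν * θ) ^ 2)
        (mul_le_one₀ (by simpa using hdp 0 (by norm_num)) (by positivity)
          (mul_le_one₀ hq1 (by positivity) (pow_le_one₀ hr.le hr1'))) (by positivity)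
      linarith only [this, show d ^ 20 * (ν ^ 4 * r ^ 6) * θ ^ 2 =
        d ^ 20 * (ν ^ 2 * r ^ 2 * r ^ 4) * (ν * θ) ^ 2 by ring]
    have l3 : d ^ 20 * (ν ^ 4 * r ^ 6) * y ^ 2 ≤ d ^ 10 * (ν * r * y) ^ 2 := by
      have := mono (d ^ 10 * (ν ^ 2 * r ^ 2 * r ^ 2)) (d ^ 10 * (ν * r * y) ^ 2)
        (mul_le_one₀ (pow_le_one₀ hd.le hd1) (by positivity)
          (mul_le_one₀ hq1 (by positivity) hr1)) (by positivity)
      linarith only [this, show d ^ 20 * (ν ^ 4 * r ^ 6) * y ^ 2 =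
        d ^ 10 * (ν ^ 2 * r ^ 2 * r ^ 2) * (d ^ 10 * (ν * r * y) ^ 2) by ring]
    have l4 : d ^ 20 * (ν ^ 4 * r ^ 6) * z ^ 2 ≤ d ^ 16 * (ν ^ 2 * r ^ 2 * z) ^ 2 := by
      have := mono (d ^ 4 * r ^ 2) (d ^ 16 * (ν ^ 2 * r ^ 2 * z) ^ 2)
        (mul_le_one₀ (pow_le_one₀ hd.le hd1) (by positivity) hr1) (by positivity)
      linarith only [this, show d ^ 20 * (ν ^ 4 * r ^ 6) * z ^ 2 =
        d ^ 4 * r ^ 2 * (d ^ 16 * (ν ^ 2 * r ^ 2 * z) ^ 2) by ring]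
    have l5 : d ^ 20 * (ν ^ 4 * r ^ 6) * v ^ 2 ≤ d ^ 18 * (ν * r ^ 2 * v) ^ 2 := by
      have := mono (d ^ 2 * (ν ^ 2 * r ^ 2)) (d ^ 18 * (ν * r ^ 2 * v) ^ 2)
        (mul_le_one₀ (pow_le_one₀ hd.le hd1) (by positivity) hq1) (by positivity)
      linarith only [this, show d ^ 20 * (ν ^ 4 * r ^ 6) * v ^ 2 =
        d ^ 2 * (ν ^ 2 * r ^ 2) * (d ^ 18 * (ν * r ^ 2 * v) ^ 2) by ring]
    have l6 : d ^ 20 * (ν ^ 4 * r ^ 6) * u ^ 2 = d ^ 20 * (ν ^ 2 * r ^ 3 * u) ^ 2 := by ring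
    linarith
  have low' := mul_le_mul_of_nonneg_left low (show 0 ≤ c / 2 by positivity)
  refine le_trans (sub_nonneg.1 ((add_nonneg (add_nonneg (sub_nonneg.2 A') (sub_nonneg.2 B'))
    (add_nonneg (sub_nonneg.2 G') (sub_nonneg.2 K'))).trans_eq ?_))
    (h.trans (le_trans (le_of_eq ?_) ((neg_le_neg low').trans_eq ?_)))
  · ring
  · ring
  · ring

end Lyapunov

/-! ### The corrections of the energy -/

section Corrections

open scoped RealInnerProductSpace

variable {H : Type*} [NormedAddCommGroup H] [InnerProductSpace ℝ H]

lemma inner_le_of_norm_le {x y : H} {a b : ℝ} (hx : ‖x‖ ≤ a) (hy : ‖y‖ ≤ b) : ⟪x, y⟫ ≤ a * b :=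
  (real_inner_le_norm x y).trans
    (mul_le_mul hx hy (norm_nonneg _) ((norm_nonneg _).trans hx))

lemma neg_inner_le_of_norm_le {x y : H} {a b : ℝ} (hx : ‖x‖ ≤ a) (hy : ‖y‖ ≤ b) :
    -⟪x, y⟫ ≤ a * b := by
  rw [← inner_neg_left]
  exact inner_le_of_norm_le (by rwa [norm_neg]) hy

variable {D : H →L[ℝ] H} {ν M n a m k δ ρ₁ ρ₂ b₀ : ℝ} {v u z y θ W R : H}

/-- The correction `-⟪W, D y⟫` dissipates `y`. -/
lemma correction_memory_le (hD : ∀ x w : H, ⟪D x, w⟫ = -⟪x, D w⟫)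
    (hlow : ∀ x, ν * ‖x‖ ≤ ‖D x‖) (hup : ∀ x, ‖D x‖ ≤ 2 * ν * ‖x‖) (hν : 0 < ν) (hM : 1 ≤ M)
    (ha : 0 ≤ a) (hm : 0 ≤ m) (hk : 0 ≤ k) (hδ : 0 ≤ δ) (hρ₂ : 0 < ρ₂) (hb₀ : 0 ≤ b₀)
    (haM : a ≤ M) (hmM : m ≤ M) (hkM : k ≤ M) (hδM : δ ≤ M) (hρ₂M : ρ₂⁻¹ ≤ M)
    (hn : 0 ≤ n) (hW : ‖W‖ ≤ M * n) (hR : ‖R‖ ≤ M * n) :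
    -⟪R + b₀ • D y, D y⟫ - ⟪W, D (ρ₂⁻¹ • (a • D z + m • D W + k • v - δ • D θ))⟫ ≤
      -b₀ * (ν ^ 2 * ‖y‖ ^ 2) + 4 * M ^ 4 * (ν * n * ‖y‖ + ν ^ 2 * n * ‖z‖ + ν ^ 2 * n ^ 2
        + ν * n * ‖v‖ + ν ^ 2 * n * ‖θ‖) := by
  have hM0 : 0 ≤ M := zero_le_one.trans hM
  have hDW : ‖D W‖ ≤ 2 * ν * (M * n) := (hup W).trans (by gcongr)
  have e1 : -⟪W, D (ρ₂⁻¹ • (a • D z + m • D W + k • v - δ • D θ))⟫ =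
      ρ₂⁻¹ * (a * ⟪D W, D z⟫ + m * ⟪D W, D W⟫ + k * ⟪D W, v⟫ + δ * -⟪D W, D θ⟫) := by
    rw [← hD]
    simp only [inner_smul_right, inner_add_right, inner_sub_right]
    ring
  have t1 : -⟪R, D y⟫ ≤ (M * n) * (2 * ν * ‖y‖) := neg_inner_le_of_norm_le hR (hup y)
  have t2 : ⟪D W, D z⟫ ≤ 2 * ν * (M * n) * (2 * ν * ‖z‖) := inner_le_of_norm_le hDW (hup z)
  have t3 : ⟪D W, D W⟫ ≤ 2 * ν * (M * n) * (2 * ν * (M * n)) := inner_le_of_norm_le hDW hDW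
  have t4 : ⟪D W, v⟫ ≤ 2 * ν * (M * n) * ‖v‖ := inner_le_of_norm_le hDW le_rfl
  have t5 : -⟪D W, D θ⟫ ≤ 2 * ν * (M * n) * (2 * ν * ‖θ‖) := neg_inner_le_of_norm_le hDW (hup θ)
  have hyy : (ν * ‖y‖) ^ 2 ≤ ‖D y‖ ^ 2 := by gcongr; exact hlow y
  have hρ0 : 0 ≤ ρ₂⁻¹ := by positivity
  have hρ : ρ₂⁻¹ * (a * ⟪D W, D z⟫ + m * ⟪D W, D W⟫ + k * ⟪D W, v⟫ + δ * -⟪D W, D θ⟫)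
      ≤ M * (M * (2 * ν * (M * n) * (2 * ν * ‖z‖)) + M * (2 * ν * (M * n) * (2 * ν * (M * n)))
        + M * (2 * ν * (M * n) * ‖v‖) + M * (2 * ν * (M * n) * (2 * ν * ‖θ‖))) := by
    calc _ ≤ ρ₂⁻¹ * (a * (2 * ν * (M * n) * (2 * ν * ‖z‖)) + m * (2 * ν * (M * n) * (2 * ν * (M * n)))
        + k * (2 * ν * (M * n) * ‖v‖) + δ * (2 * ν * (M * n) * (2 * ν * ‖θ‖))) := by gcongr
      _ ≤ _ := by gcongr
  have hb : b₀ * (ν * ‖y‖) ^ 2 ≤ b₀ * ‖D y‖ ^ 2 := by gcongr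
  have hM3 : M ^ 3 ≤ M ^ 4 := pow_le_pow_right₀ hM (by norm_num)
  have hM1 : M ≤ M ^ 4 := le_self_pow₀ hM (by norm_num)
  have s1 : M * (n * (ν * ‖y‖)) ≤ M ^ 4 * (n * (ν * ‖y‖)) := by gcongr
  have s2 : M ^ 3 * (ν ^ 2 * n * ‖z‖) ≤ M ^ 4 * (ν ^ 2 * n * ‖z‖) := by gcongr
  have s3 : M ^ 3 * (ν * n * ‖v‖) ≤ M ^ 4 * (ν * n * ‖v‖) := by gcongr
  have s4 : M ^ 3 * (ν ^ 2 * n * ‖θ‖) ≤ M ^ 4 * (ν ^ 2 * n * ‖θ‖) := by gcongr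
  have p1 : 0 ≤ M ^ 4 * (n * (ν * ‖y‖)) := by positivity
  have p2 : 0 ≤ M ^ 4 * (ν * n * ‖v‖) := by positivity
  have p3 : 0 ≤ M ^ 3 * (ν * n * ‖v‖) := by positivity
  rw [sub_eq_add_neg, e1, inner_add_left, real_inner_smul_left, real_inner_self_eq_norm_sq]
  ring_nf at t1 hρ hb s1 s2 s3 s4 p1 p2 p3 ⊢
  linarith only [t1, hρ, hb, s1, s2, s3, s4, p1, p2, p3]

/-- The correction `-ρ₂ ⟪y, D z⟫ - ρ₁ ⟪u, z⟫` dissipates `z`; its second term cancels the coupling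
of `z` with `v`. -/
lemma correction_strain_le (hD : ∀ x w : H, ⟪D x, w⟫ = -⟪x, D w⟫)
    (hlow : ∀ x, ν * ‖x‖ ≤ ‖D x‖) (hup : ∀ x, ‖D x‖ ≤ 2 * ν * ‖x‖) (hν : 0 < ν) (hM : 1 ≤ M)
    (ha : 0 ≤ a) (hm : 0 ≤ m) (hδ : 0 ≤ δ) (hρ₁ : 0 < ρ₁) (hρ₂ : 0 < ρ₂)
    (hmM : m ≤ M) (hδM : δ ≤ M) (hρ₁M : ρ₁ ≤ M) (hρ₂M : ρ₂ ≤ M)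
    (hn : 0 ≤ n) (hW : ‖W‖ ≤ M * n) :
    -ρ₂ * (⟪ρ₂⁻¹ • (a • D z + m • D W + k • v - δ • D θ), D z⟫ + ⟪y, D (D y)⟫)
      - ρ₁ * (⟪(k / ρ₁) • D v, z⟫ + ⟪u, D y⟫) ≤
      -a * (ν ^ 2 * ‖z‖ ^ 2) + 4 * M ^ 4 * (ν ^ 2 * n * ‖z‖ + ν ^ 2 * ‖θ‖ * ‖z‖
        + ν ^ 2 * ‖y‖ ^ 2 + ν * ‖u‖ * ‖y‖) := by
  have hM0 : 0 ≤ M := zero_le_one.trans hM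
  have hDW : ‖D W‖ ≤ 2 * ν * (M * n) := (hup W).trans (by gcongr)
  have e1 : -ρ₂ * (⟪ρ₂⁻¹ • (a • D z + m • D W + k • v - δ • D θ), D z⟫ + ⟪y, D (D y)⟫)
      - ρ₁ * (⟪(k / ρ₁) • D v, z⟫ + ⟪u, D y⟫) =
      -a * ‖D z‖ ^ 2 + m * -⟪D W, D z⟫ + δ * ⟪D θ, D z⟫ + ρ₂ * ‖D y‖ ^ 2 + ρ₁ * -⟪u, D y⟫ := by
    have h1 : ⟪y, D (D y)⟫ = -‖D y‖ ^ 2 := by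
      rw [← real_inner_self_eq_norm_sq, hD, neg_neg]
    rw [h1]
    simp only [real_inner_smul_left, inner_add_left, inner_sub_left, hD v z,
      ← real_inner_self_eq_norm_sq]
    field_simp
    ring
  have t1 : -⟪D W, D z⟫ ≤ 2 * ν * (M * n) * (2 * ν * ‖z‖) := neg_inner_le_of_norm_le hDW (hup z)
  have t2 : ⟪D θ, D z⟫ ≤ 2 * ν * ‖θ‖ * (2 * ν * ‖z‖) := inner_le_of_norm_le (hup θ) (hup z)
  have t3 : -⟪u, D y⟫ ≤ ‖u‖ * (2 * ν * ‖y‖) := neg_inner_le_of_norm_le le_rfl (hup y)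
  have t4 : ‖D y‖ ^ 2 ≤ (2 * ν * ‖y‖) ^ 2 := by gcongr; exact hup y
  have hz : a * (ν * ‖z‖) ^ 2 ≤ a * ‖D z‖ ^ 2 := by gcongr; exact hlow z
  have u1 : m * -⟪D W, D z⟫ ≤ M * (2 * ν * (M * n) * (2 * ν * ‖z‖)) :=
    (mul_le_mul_of_nonneg_left t1 hm).trans (by gcongr)
  have u2 : δ * ⟪D θ, D z⟫ ≤ M * (2 * ν * ‖θ‖ * (2 * ν * ‖z‖)) :=
    (mul_le_mul_of_nonneg_left t2 hδ).trans (by gcongr)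
  have u3 : ρ₁ * -⟪u, D y⟫ ≤ M * (‖u‖ * (2 * ν * ‖y‖)) :=
    (mul_le_mul_of_nonneg_left t3 hρ₁.le).trans (by gcongr)
  have u4 : ρ₂ * ‖D y‖ ^ 2 ≤ M * (2 * ν * ‖y‖) ^ 2 := by gcongr
  have hM2 : M ^ 2 ≤ M ^ 4 := pow_le_pow_right₀ hM (by norm_num)
  have hM1 : M ≤ M ^ 4 := le_self_pow₀ hM (by norm_num)
  have s1 : M ^ 2 * (ν ^ 2 * n * ‖z‖) ≤ M ^ 4 * (ν ^ 2 * n * ‖z‖) := by gcongr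
  have s2 : M * (ν ^ 2 * ‖θ‖ * ‖z‖) ≤ M ^ 4 * (ν ^ 2 * ‖θ‖ * ‖z‖) := by gcongr
  have s3 : M * (ν ^ 2 * ‖y‖ ^ 2) ≤ M ^ 4 * (ν ^ 2 * ‖y‖ ^ 2) := by gcongr
  have s4 : M * (ν * ‖u‖ * ‖y‖) ≤ M ^ 4 * (ν * ‖u‖ * ‖y‖) := by gcongr
  have p1 : 0 ≤ M * (ν * ‖u‖ * ‖y‖) := by positivity
  rw [e1]
  ring_nf at u1 u2 u3 u4 hz s1 s2 s3 s4 p1 ⊢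
  linarith only [u1, u2, u3, u4, hz, s1, s2, s3, s4, p1]

/-- The correction `-ρ₂ ⟪y, v⟫` dissipates `v`. -/
lemma correction_shear_le (hD : ∀ x w : H, ⟪D x, w⟫ = -⟪x, D w⟫)
    (hup : ∀ x, ‖D x‖ ≤ 2 * ν * ‖x‖) (hν : 0 < ν) (hM : 1 ≤ M)
    (ha : 0 ≤ a) (hm : 0 ≤ m) (hδ : 0 ≤ δ) (hρ₂ : 0 < ρ₂)
    (haM : a ≤ M) (hmM : m ≤ M) (hδM : δ ≤ M) (hρ₂M : ρ₂ ≤ M)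
    (hn : 0 ≤ n) (hW : ‖W‖ ≤ M * n) :
    -ρ₂ * (⟪ρ₂⁻¹ • (a • D z + m • D W + k • v - δ • D θ), v⟫ + ⟪y, D u - y⟫) ≤
      -k * ‖v‖ ^ 2 + 4 * M ^ 4 * (ν * ‖z‖ * ‖v‖ + ν * n * ‖v‖ + ν * ‖θ‖ * ‖v‖ + ‖y‖ ^ 2
          + ν * ‖u‖ * ‖y‖) := by
  have hM0 : 0 ≤ M := zero_le_one.trans hM
  have hDW : ‖D W‖ ≤ 2 * ν * (M * n) := (hup W).trans (by gcongr)
  have e1 : -ρ₂ * (⟪ρ₂⁻¹ • (a • D z + m • D W + k • v - δ • D θ), v⟫ + ⟪y, D u - y⟫) =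
      -k * ‖v‖ ^ 2 + a * -⟪D z, v⟫ + m * -⟪D W, v⟫ + δ * ⟪D θ, v⟫ + ρ₂ * ⟪D y, u⟫
        + ρ₂ * ‖y‖ ^ 2 := by
    simp only [real_inner_smul_left, inner_add_left, inner_sub_left, inner_sub_right, hD y u,
      ← real_inner_self_eq_norm_sq]
    field_simp
    ring
  have u1 : a * -⟪D z, v⟫ ≤ M * (2 * ν * ‖z‖ * ‖v‖) :=
    (mul_le_mul_of_nonneg_left (neg_inner_le_of_norm_le (hup z) le_rfl) ha).trans (by gcongr)
  have u2 : m * -⟪D W, v⟫ ≤ M * (2 * ν * (M * n) * ‖v‖) :=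
    (mul_le_mul_of_nonneg_left (neg_inner_le_of_norm_le hDW le_rfl) hm).trans (by gcongr)
  have u3 : δ * ⟪D θ, v⟫ ≤ M * (2 * ν * ‖θ‖ * ‖v‖) :=
    (mul_le_mul_of_nonneg_left (inner_le_of_norm_le (hup θ) le_rfl) hδ).trans (by gcongr)
  have u4 : ρ₂ * ⟪D y, u⟫ ≤ M * (2 * ν * ‖y‖ * ‖u‖) :=
    (mul_le_mul_of_nonneg_left (inner_le_of_norm_le (hup y) le_rfl) hρ₂.le).trans (by gcongr)
  have u5 : ρ₂ * ‖y‖ ^ 2 ≤ M * ‖y‖ ^ 2 := by gcongr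
  have hM2 : M ^ 2 ≤ M ^ 4 := pow_le_pow_right₀ hM (by norm_num)
  have hM1 : M ≤ M ^ 4 := le_self_pow₀ hM (by norm_num)
  have s1 : M * (ν * ‖z‖ * ‖v‖) ≤ M ^ 4 * (ν * ‖z‖ * ‖v‖) := by gcongr
  have s2 : M ^ 2 * (ν * n * ‖v‖) ≤ M ^ 4 * (ν * n * ‖v‖) := by gcongr
  have s3 : M * (ν * ‖θ‖ * ‖v‖) ≤ M ^ 4 * (ν * ‖θ‖ * ‖v‖) := by gcongr
  have s4 : M * ‖y‖ ^ 2 ≤ M ^ 4 * ‖y‖ ^ 2 := by gcongr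
  have s5 : M * (ν * ‖u‖ * ‖y‖) ≤ M ^ 4 * (ν * ‖u‖ * ‖y‖) := by gcongr
  have p1 : 0 ≤ M * (ν * ‖z‖ * ‖v‖) := by positivity
  have p2 : 0 ≤ M ^ 2 * (ν * n * ‖v‖) := by positivity
  have p3 : 0 ≤ M * (ν * ‖θ‖ * ‖v‖) := by positivity
  have p4 : 0 ≤ M * ‖y‖ ^ 2 := by positivity
  have p5 : 0 ≤ M * (ν * ‖u‖ * ‖y‖) := by positivity
  rw [e1]
  ring_nf at u1 u2 u3 u4 u5 s1 s2 s3 s4 s5 p1 p2 p3 p4 p5 ⊢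
  linarith only [u1, u2, u3, u4, u5, s1, s2, s3, s4, s5, p1, p2, p3, p4, p5]

/-- The correction `-ρ₁ ⟪v, D u⟫` dissipates `u`. -/
lemma correction_velocity_le (hD : ∀ x w : H, ⟪D x, w⟫ = -⟪x, D w⟫)
    (hlow : ∀ x, ν * ‖x‖ ≤ ‖D x‖) (hup : ∀ x, ‖D x‖ ≤ 2 * ν * ‖x‖) (hν : 0 < ν) (hM : 1 ≤ M)
    (hρ₁ : 0 < ρ₁) (hkM : k ≤ M) (hρ₁M : ρ₁ ≤ M) :
    -ρ₁ * (⟪D u - y, D u⟫ + ⟪v, D ((k / ρ₁) • D v)⟫) ≤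
      -ρ₁ * (ν ^ 2 * ‖u‖ ^ 2) + 4 * M ^ 4 * (ν ^ 2 * ‖v‖ ^ 2 + ν * ‖u‖ * ‖y‖) := by
  have hM0 : 0 ≤ M := zero_le_one.trans hM
  have e1 : -ρ₁ * (⟪D u - y, D u⟫ + ⟪v, D ((k / ρ₁) • D v)⟫) =
      -ρ₁ * ‖D u‖ ^ 2 + ρ₁ * ⟪y, D u⟫ + k * ‖D v‖ ^ 2 := by
    have h1 : ⟪v, D (D v)⟫ = -‖D v‖ ^ 2 := by
      rw [← real_inner_self_eq_norm_sq, hD, neg_neg]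
    simp only [map_smul, real_inner_smul_right, inner_sub_left, h1, real_inner_self_eq_norm_sq]
    field_simp
    ring
  have u1 : ρ₁ * ⟪y, D u⟫ ≤ M * (‖y‖ * (2 * ν * ‖u‖)) :=
    (mul_le_mul_of_nonneg_left (inner_le_of_norm_le le_rfl (hup u)) hρ₁.le).trans (by gcongr)
  have u2 : k * ‖D v‖ ^ 2 ≤ M * (2 * ν * ‖v‖) ^ 2 := by gcongr; exact hup v
  have hu : ρ₁ * (ν * ‖u‖) ^ 2 ≤ ρ₁ * ‖D u‖ ^ 2 := by gcongr; exact hlow u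
  have hM1 : M ≤ M ^ 4 := le_self_pow₀ hM (by norm_num)
  have s1 : M * (ν ^ 2 * ‖v‖ ^ 2) ≤ M ^ 4 * (ν ^ 2 * ‖v‖ ^ 2) := by gcongr
  have s2 : M * (ν * ‖u‖ * ‖y‖) ≤ M ^ 4 * (ν * ‖u‖ * ‖y‖) := by gcongr
  have p1 : 0 ≤ M * (ν * ‖u‖ * ‖y‖) := by positivity
  rw [e1]
  ring_nf at u1 u2 hu s1 s2 p1 ⊢
  linarith only [u1, u2, hu, s1, s2, p1]

end Corrections

/-! ### Decay of the evolution in one band -/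

section Evolution

open scoped RealInnerProductSpace

variable {H : Type*} [NormedAddCommGroup H] [InnerProductSpace ℝ H]

/-- The system in one frequency band, as an evolution in a Hilbert space with a bounded skew-adjoint
operator `D` in place of `∂_x`. The history enters through three quantities only: its squared norm
`N`, its mean `W = ∫ g ∂_x η`, and the part `R = ∫ g' ∂_x η` of the derivative of `W`. The energy
identity of `N` is replaced by a touching function from above, with derivative at most
`-k₂ N + 2 ⟪W, D y⟫`. -/
structure BandEvolution (P : Coeffs) (k₂ K : ℝ) (D : H →L[ℝ] H) (v u z y θ W R : ℝ → H)
    (N : ℝ → ℝ) : Prop where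
  skew : ∀ x w : H, ⟪D x, w⟫ = -⟪x, D w⟫
  cont_v : ContinuousOn v (Ici 0)
  cont_u : ContinuousOn u (Ici 0)
  cont_z : ContinuousOn z (Ici 0)
  cont_y : ContinuousOn y (Ici 0)
  cont_θ : ContinuousOn θ (Ici 0)
  cont_W : ContinuousOn W (Ici 0)
  cont_N : ContinuousOn N (Ici 0)
  deriv_v : ∀ t > 0, HasDerivAt v (D (u t) - y t) t
  deriv_u : ∀ t > 0, HasDerivAt u ((P.k / P.ρ₁) • D (v t)) t
  deriv_z : ∀ t > 0, HasDerivAt z (D (y t)) t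
  deriv_y : ∀ t > 0, HasDerivAt y
    (P.ρ₂⁻¹ • (P.a • D (z t) + P.m • D (W t) + P.k • v t - P.δ • D (θ t))) t
  deriv_θ : ∀ t > 0, HasDerivAt θ (P.ρ₃⁻¹ • (P.βt • D (D (θ t)) - P.δ • D (y t))) t
  deriv_W : ∀ t > 0, HasDerivWithinAt (fun r => W (t + r)) (R t + P.b₀ • D (y t)) (Ici 0) 0
  N_nonneg : ∀ t ≥ 0, 0 ≤ N t
  norm_W : ∀ t ≥ 0, ‖W t‖ ^ 2 ≤ K ^ 2 * N t
  norm_R : ∀ t ≥ 0, ‖R t‖ ^ 2 ≤ K ^ 2 * N t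
  touch_N : ∀ t > 0, ∃ F : ℝ → ℝ, (∀ r ≥ 0, N (t + r) ≤ F r) ∧ F 0 = N t ∧
    HasDerivWithinAt F (-k₂ * N t + 2 * ⟪W t, D (y t)⟫) (Ici 0) 0

/-- The physical energy of the band. -/
noncomputable def bandEnergy {H : Type*} [NormedAddCommGroup H] (P : Coeffs) (v u z y θ : H)
    (N : ℝ) : ℝ :=
  P.k * ‖v‖ ^ 2 + P.ρ₁ * ‖u‖ ^ 2 + P.a * ‖z‖ ^ 2 + P.ρ₂ * ‖y‖ ^ 2 + P.ρ₃ * ‖θ‖ ^ 2 + P.m * N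

variable {P : Coeffs} {k₂ K : ℝ} {D : H →L[ℝ] H} {v u z y θ W R : ℝ → H} {N : ℝ → ℝ}

lemma hasDerivWithinAt_shift {E : Type*} [NormedAddCommGroup E] [NormedSpace ℝ E] {f : ℝ → E}
    {f' : E} {t : ℝ} (h : HasDerivAt f f' t) :
    HasDerivWithinAt (fun r => f (t + r)) f' (Ici 0) 0 := by
  have h' : HasDerivAt f f' (t + 0) := by rwa [add_zero]
  exact (h'.comp_const_add t 0).hasDerivWithinAt

/-- The energy is dissipated by the heat flux and by the history only. -/
lemma BandEvolution.energy_touch (h : BandEvolution P k₂ K D v u z y θ W R N) (hP : P.Admissible)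
    {t : ℝ} (ht : 0 < t) : ∃ (G : ℝ → ℝ),
      (∀ r ≥ 0, bandEnergy P (v (t + r)) (u (t + r)) (z (t + r)) (y (t + r)) (θ (t + r)) (N (t + r))
        ≤ G r) ∧
      G 0 = bandEnergy P (v t) (u t) (z t) (y t) (θ t) (N t) ∧
      HasDerivWithinAt G (-(2 * P.βt) * ‖D (θ t)‖ ^ 2 - P.m * k₂ * N t) (Ici 0) 0 := by
  obtain ⟨F, hF, hF0, hFd⟩ := h.touch_N t ht
  refine ⟨fun r => bandEnergy P (v (t + r)) (u (t + r)) (z (t + r)) (y (t + r)) (θ (t + r)) (F r),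
    fun r hr => ?_, by simp [hF0], ?_⟩
  · have := hP.m_pos
    simp only [bandEnergy]
    gcongr
    exact hF r hr
  · have dv := (hasDerivWithinAt_shift (h.deriv_v t ht)).norm_sq
    have du := (hasDerivWithinAt_shift (h.deriv_u t ht)).norm_sq
    have dz := (hasDerivWithinAt_shift (h.deriv_z t ht)).norm_sq
    have dy := (hasDerivWithinAt_shift (h.deriv_y t ht)).norm_sq
    have dθ := (hasDerivWithinAt_shift (h.deriv_θ t ht)).norm_sq
    have := (((((dv.const_mul P.k).add (du.const_mul P.ρ₁)).add (dz.const_mul P.a)).add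
      (dy.const_mul P.ρ₂)).add (dθ.const_mul P.ρ₃)).add (hFd.const_mul P.m)
    refine this.congr_deriv ?_
    have hρ₁ := hP.ρ₁_pos.ne'
    have hρ₂ := hP.ρ₂_pos.ne'
    have hρ₃ := hP.ρ₃_pos.ne'
    have s1 : ⟪u t, D (v t)⟫ = -⟪v t, D (u t)⟫ := by rw [real_inner_comm, h.skew]
    have s2 : ⟪y t, D (z t)⟫ = -⟪z t, D (y t)⟫ := by rw [real_inner_comm, h.skew]
    have s3 : ⟪y t, D (W t)⟫ = -⟪W t, D (y t)⟫ := by rw [real_inner_comm, h.skew]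
    have s4 : ⟪y t, D (θ t)⟫ = -⟪θ t, D (y t)⟫ := by rw [real_inner_comm, h.skew]
    have s5 : ⟪θ t, D (D (θ t))⟫ = -‖D (θ t)‖ ^ 2 := by
      rw [← real_inner_self_eq_norm_sq, h.skew, neg_neg]
    simp only [add_zero, inner_sub_right, inner_add_right, real_inner_smul_right, s1, s2, s3, s4, s5,
      real_inner_comm (v t) (y t)]
    field_simp
    ring

lemma BandEvolution.continuousOn_energy (h : BandEvolution P k₂ K D v u z y θ W R N) :
    ContinuousOn (fun t => bandEnergy P (v t) (u t) (z t) (y t) (θ t) (N t)) (Ici 0) := by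
  have h1 := h.cont_v
  have h2 := h.cont_u
  have h3 := h.cont_z
  have h4 := h.cont_y
  have h5 := h.cont_θ
  have h6 := h.cont_N
  unfold bandEnergy
  fun_prop

lemma exists_bandEnergy_bounds (H : Type*) [NormedAddCommGroup H] (hP : P.Admissible) :
    ∃ c > (0 : ℝ), ∃ C > (0 : ℝ),
    ∀ (v u z y θ : H) (N : ℝ), 0 ≤ N →
      c * (‖v‖ ^ 2 + ‖u‖ ^ 2 + ‖z‖ ^ 2 + ‖y‖ ^ 2 + ‖θ‖ ^ 2 + N) ≤ bandEnergy P v u z y θ N ∧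
      bandEnergy P v u z y θ N ≤
        C * (‖v‖ ^ 2 + ‖u‖ ^ 2 + ‖z‖ ^ 2 + ‖y‖ ^ 2 + ‖θ‖ ^ 2 + N) := by
  have h1 := hP.k_pos
  have h2 := hP.ρ₁_pos
  have h3 := hP.a_pos
  have h4 := hP.ρ₂_pos
  have h5 := hP.ρ₃_pos
  have h6 := hP.m_pos
  have hC : 0 < P.k + P.ρ₁ + P.a + P.ρ₂ + P.ρ₃ + P.m := by positivity
  refine ⟨min P.k (min P.ρ₁ (min P.a (min P.ρ₂ (min P.ρ₃ P.m)))), by positivity,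
    P.k + P.ρ₁ + P.a + P.ρ₂ + P.ρ₃ + P.m, hC, fun v u z y θ N hN => ?_⟩
  generalize hc : min P.k (min P.ρ₁ (min P.a (min P.ρ₂ (min P.ρ₃ P.m)))) = c
  have hcs : c ≤ P.k ∧ c ≤ P.ρ₁ ∧ c ≤ P.a ∧ c ≤ P.ρ₂ ∧ c ≤ P.ρ₃ ∧ c ≤ P.m := by
    have := hc.symm.le
    simpa only [le_min_iff] using this
  obtain ⟨c1, c2, c3, c4, c5, c6⟩ := hcs
  unfold bandEnergy
  constructor
  · rw [mul_add, mul_add, mul_add, mul_add, mul_add]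
    gcongr
  · rw [mul_add, mul_add, mul_add, mul_add, mul_add]
    gcongr <;> linarith

/-- Without any restriction on the frequency the energy does not increase. -/
theorem BandEvolution.exists_bounded (hP : P.Admissible) (hk₂ : 0 ≤ k₂) (K : ℝ) :
    ∃ C > (0 : ℝ), ∀ {D : H →L[ℝ] H} {v u z y θ W R : ℝ → H} {N : ℝ → ℝ},
      BandEvolution P k₂ K D v u z y θ W R N → ∀ t ≥ 0,
      ‖v t‖ ^ 2 + ‖u t‖ ^ 2 + ‖z t‖ ^ 2 + ‖y t‖ ^ 2 + ‖θ t‖ ^ 2 + N t ≤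
        C * (‖v 0‖ ^ 2 + ‖u 0‖ ^ 2 + ‖z 0‖ ^ 2 + ‖y 0‖ ^ 2 + ‖θ 0‖ ^ 2 + N 0) := by
  obtain ⟨c, hc, C, hC, hb⟩ := exists_bandEnergy_bounds H hP
  refine ⟨C / c, by positivity, fun {D v u z y θ W R N} h t ht => ?_⟩
  have hmono := le_mul_exp_of_touching (κ := 0) h.continuousOn_energy (fun t ht => by
    obtain ⟨G, h1, h2, h3⟩ := h.energy_touch hP ht
    refine ⟨G, _, h1, h2, h3, ?_⟩
    have h4 := hP.βt_pos
    have h5 := hP.m_pos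
    have h6 := h.N_nonneg t ht.le
    have : 0 ≤ 2 * P.βt * ‖D (θ t)‖ ^ 2 := by positivity
    have : 0 ≤ P.m * k₂ * N t := by positivity
    linarith) t ht
  simp only [neg_zero, zero_mul, Real.exp_zero, mul_one] at hmono
  have h1 := (hb (v t) (u t) (z t) (y t) (θ t) (N t) (h.N_nonneg t ht)).1
  have h2 := (hb (v 0) (u 0) (z 0) (y 0) (θ 0) (N 0) (h.N_nonneg 0 le_rfl)).2
  rw [div_mul_eq_mul_div, le_div_iff₀ hc, mul_comm]
  linarith

/-- The energy with the four corrections that dissipate `y`, `z`, `v` and `u`; here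
`r ^ 2 = 1 / (1 + ν ^ 2)` and `d` is a small parameter. -/
noncomputable def lyapunov (P : Coeffs) (D : H →L[ℝ] H) (ν r d : ℝ) (v u z y θ W : H) (N : ℝ) : ℝ :=
  bandEnergy P v u z y θ N + d ^ 10 * r ^ 2 * -⟪W, D y⟫
    + d ^ 16 * (ν ^ 2 * r ^ 4) * (-P.ρ₂ * ⟪y, D z⟫ - P.ρ₁ * ⟪u, z⟫)
    + d ^ 18 * (ν ^ 2 * r ^ 4) * (-P.ρ₂ * ⟪y, v⟫)
    + d ^ 20 * (ν ^ 2 * r ^ 6) * (-P.ρ₁ * ⟪v, D u⟫)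

/-- The functional inherits a touching function from `N`; its slope is the sum of the dissipation of
the energy and of the formal time derivatives of the corrections. -/
lemma BandEvolution.lyapunov_touch (h : BandEvolution P k₂ K D v u z y θ W R N)
    (hP : P.Admissible) (ν r d : ℝ) {t : ℝ} (ht : 0 < t) : ∃ (G : ℝ → ℝ),
      (∀ s ≥ 0, lyapunov P D ν r d (v (t + s)) (u (t + s)) (z (t + s)) (y (t + s)) (θ (t + s))
        (W (t + s)) (N (t + s)) ≤ G s) ∧
      G 0 = lyapunov P D ν r d (v t) (u t) (z t) (y t) (θ t) (W t) (N t) ∧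
      HasDerivWithinAt G (-(2 * P.βt) * ‖D (θ t)‖ ^ 2 - P.m * k₂ * N t
        + d ^ 10 * r ^ 2 * (-⟪R t + P.b₀ • D (y t), D (y t)⟫ -
            ⟪W t, D (P.ρ₂⁻¹ • (P.a • D (z t) + P.m • D (W t) + P.k • v t - P.δ • D (θ t)))⟫)
        + d ^ 16 * (ν ^ 2 * r ^ 4) *
            (-P.ρ₂ * (⟪P.ρ₂⁻¹ • (P.a • D (z t) + P.m • D (W t) + P.k • v t - P.δ • D (θ t)), D (z t)⟫
              + ⟪y t, D (D (y t))⟫) - P.ρ₁ * (⟪(P.k / P.ρ₁) • D (v t), z t⟫ + ⟪u t, D (y t)⟫))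
        + d ^ 18 * (ν ^ 2 * r ^ 4) *
            (-P.ρ₂ * (⟪P.ρ₂⁻¹ • (P.a • D (z t) + P.m • D (W t) + P.k • v t - P.δ • D (θ t)), v t⟫
              + ⟪y t, D (u t) - y t⟫))
        + d ^ 20 * (ν ^ 2 * r ^ 6) *
            (-P.ρ₁ * (⟪D (u t) - y t, D (u t)⟫ + ⟪v t, D ((P.k / P.ρ₁) • D (v t))⟫))) (Ici 0) 0 := by
  obtain ⟨G, h1, h2, h3⟩ := h.energy_touch hP ht
  refine ⟨fun s => G s + d ^ 10 * r ^ 2 * -⟪W (t + s), D (y (t + s))⟫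
    + d ^ 16 * (ν ^ 2 * r ^ 4) *
      (-P.ρ₂ * ⟪y (t + s), D (z (t + s))⟫ - P.ρ₁ * ⟪u (t + s), z (t + s)⟫)
    + d ^ 18 * (ν ^ 2 * r ^ 4) * (-P.ρ₂ * ⟪y (t + s), v (t + s)⟫)
    + d ^ 20 * (ν ^ 2 * r ^ 6) * (-P.ρ₁ * ⟪v (t + s), D (u (t + s))⟫), fun s hs => ?_, ?_, ?_⟩
  · simp only [lyapunov]
    gcongr
    exact h1 s hs
  · simp [lyapunov, h2]
  · have dv := hasDerivWithinAt_shift (h.deriv_v t ht)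
    have du := hasDerivWithinAt_shift (h.deriv_u t ht)
    have dz := hasDerivWithinAt_shift (h.deriv_z t ht)
    have dy := hasDerivWithinAt_shift (h.deriv_y t ht)
    have dW := h.deriv_W t ht
    have comp : ∀ {f : ℝ → H} {f' : H}, HasDerivWithinAt f f' (Ici 0) 0 →
        HasDerivWithinAt (fun s => D (f s)) (D f') (Ici 0) 0 := fun hf =>
      D.hasFDerivAt.comp_hasDerivWithinAt 0 hf
    have e0 := (dW.inner ℝ (comp dy)).neg
    have e1 := ((dy.inner ℝ (comp dz)).const_mul (-P.ρ₂)).sub ((du.inner ℝ dz).const_mul P.ρ₁)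
    have e2 := (dy.inner ℝ dv).const_mul (-P.ρ₂)
    have e3 := (dv.inner ℝ (comp du)).const_mul (-P.ρ₁)
    have := (((h3.add (e0.const_mul (d ^ 10 * r ^ 2))).add
      (e1.const_mul (d ^ 16 * (ν ^ 2 * r ^ 4)))).add (e2.const_mul (d ^ 18 * (ν ^ 2 * r ^ 4)))).add
      (e3.const_mul (d ^ 20 * (ν ^ 2 * r ^ 6)))
    refine this.congr_deriv ?_
    simp only [add_zero]
    ring

/-- The corrections are dominated by the energy, uniformly in the frequency: each weight contains the
power of `r` that compensates the factors `ν` of `D`. -/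
lemma abs_corrections_le {D : H →L[ℝ] H} {ν r d M n ρ₁ ρ₂ : ℝ} {v u z y W : H} {S : ℝ}
    (hup : ∀ x, ‖D x‖ ≤ 2 * ν * ‖x‖)
    (hν : 0 < ν) (hr : 0 < r) (hrν : r ^ 2 * (1 + ν ^ 2) = 1) (hd : 0 < d) (hd1 : d ≤ 1)
    (hM : 1 ≤ M) (hρ₁ : 0 < ρ₁) (hρ₂ : 0 < ρ₂) (hρ₁M : ρ₁ ≤ M) (hρ₂M : ρ₂ ≤ M) (hn : 0 ≤ n)
    (hW : ‖W‖ ≤ M * n) (hSn : n ^ 2 ≤ S) (hSv : ‖v‖ ^ 2 ≤ S) (hSu : ‖u‖ ^ 2 ≤ S)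
    (hSz : ‖z‖ ^ 2 ≤ S) (hSy : ‖y‖ ^ 2 ≤ S) :
    |d ^ 10 * r ^ 2 * -⟪W, D y⟫
      + d ^ 16 * (ν ^ 2 * r ^ 4) * (-ρ₂ * ⟪y, D z⟫ - ρ₁ * ⟪u, z⟫)
      + d ^ 18 * (ν ^ 2 * r ^ 4) * (-ρ₂ * ⟪y, v⟫)
      + d ^ 20 * (ν ^ 2 * r ^ 6) * (-ρ₁ * ⟪v, D u⟫)| ≤ 8 * M * d * S := by
  have hM0 : 0 ≤ M := zero_le_one.trans hM
  have hS0 : 0 ≤ S := (sq_nonneg n).trans hSn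
  have hr1 : r ^ 2 ≤ 1 := by nlinarith [sq_nonneg (r * ν)]
  have hq1 : ν ^ 2 * r ^ 2 ≤ 1 := by nlinarith [sq_nonneg r]
  have hr1' : r ≤ 1 := by nlinarith
  have hq1' : ν * r ≤ 1 := by nlinarith [mul_pos hν hr]
  have hqr : ν * r ^ 2 ≤ 1 := by nlinarith [mul_pos hν hr]
  have hdp : ∀ k : ℕ, 1 ≤ k → d ^ k ≤ d := fun k hk => by
    calc d ^ k ≤ d ^ 1 := pow_le_pow_of_le_one hd.le hd1 hk
      _ = d := pow_one d
  have prod : ∀ {a b : ℝ}, a ^ 2 ≤ S → b ^ 2 ≤ S → a * b ≤ S := fun {a b} ha hb => by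
    linarith [two_mul_le_add_sq a b, ha, hb]
  have one_mul_le : ∀ {q X : ℝ}, q ≤ 1 → 0 ≤ X → q * X ≤ X := fun hq hX =>
    mul_le_of_le_one_left hX hq
  have b0 : |r ^ 2 * -⟪W, D y⟫| ≤ 2 * M * S := by
    rw [abs_mul, abs_neg, abs_of_nonneg (by positivity : 0 ≤ r ^ 2)]
    calc r ^ 2 * |⟪W, D y⟫| ≤ r ^ 2 * ((M * n) * (2 * ν * ‖y‖)) := by
          gcongr
          exact (abs_real_inner_le_norm _ _).trans
            (mul_le_mul hW (hup y) (norm_nonneg _) (by positivity))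
      _ = (ν * r ^ 2) * (2 * M * (n * ‖y‖)) := by ring
      _ ≤ 2 * M * (n * ‖y‖) := one_mul_le hqr (by positivity)
      _ ≤ 2 * M * S := by gcongr; exact prod hSn hSy
  have b1 : |(ν ^ 2 * r ^ 4) * (-ρ₂ * ⟪y, D z⟫)| ≤ 2 * M * S := by
    rw [abs_mul (ν ^ 2 * r ^ 4), abs_mul (-ρ₂), abs_neg, abs_of_pos hρ₂,
      abs_of_nonneg (by positivity : 0 ≤ ν ^ 2 * r ^ 4)]
    calc ν ^ 2 * r ^ 4 * (ρ₂ * |⟪y, D z⟫|) ≤ ν ^ 2 * r ^ 4 * (M * (‖y‖ * (2 * ν * ‖z‖))) := by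
          gcongr
          exact (abs_real_inner_le_norm _ _).trans (by gcongr; exact hup z)
      _ = (ν ^ 2 * r ^ 2) * ((ν * r ^ 2) * (2 * M * (‖y‖ * ‖z‖))) := by ring
      _ ≤ (ν * r ^ 2) * (2 * M * (‖y‖ * ‖z‖)) := one_mul_le hq1 (by positivity)
      _ ≤ 2 * M * (‖y‖ * ‖z‖) := one_mul_le hqr (by positivity)
      _ ≤ 2 * M * S := by gcongr; exact prod hSy hSz
  have hν4 : ν ^ 2 * r ^ 4 ≤ 1 := by
    rw [show ν ^ 2 * r ^ 4 = (ν ^ 2 * r ^ 2) * r ^ 2 by ring]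
    exact mul_le_one₀ hq1 (by positivity) hr1
  have zero_order : ∀ {c : ℝ} (x w : H), 0 < c → c ≤ M → ‖x‖ ^ 2 ≤ S → ‖w‖ ^ 2 ≤ S →
      |(ν ^ 2 * r ^ 4) * (c * ⟪x, w⟫)| ≤ M * S := by
    intro c x w hc hcM hx hw
    rw [abs_mul (ν ^ 2 * r ^ 4), abs_mul c, abs_of_pos hc,
      abs_of_nonneg (by positivity : 0 ≤ ν ^ 2 * r ^ 4)]
    calc ν ^ 2 * r ^ 4 * (c * |⟪x, w⟫|) ≤ ν ^ 2 * r ^ 4 * (M * (‖x‖ * ‖w‖)) := by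
          gcongr
          exact abs_real_inner_le_norm _ _
      _ ≤ M * (‖x‖ * ‖w‖) := one_mul_le hν4 (by positivity)
      _ ≤ M * S := by gcongr; exact prod hx hw
  have b2 := zero_order u z hρ₁ hρ₁M hSu hSz
  have b3 := zero_order y v hρ₂ hρ₂M hSy hSv
  have b4 : |(ν ^ 2 * r ^ 6) * (-ρ₁ * ⟪v, D u⟫)| ≤ 2 * M * S := by
    rw [abs_mul (ν ^ 2 * r ^ 6), abs_mul (-ρ₁), abs_neg, abs_of_pos hρ₁,
      abs_of_nonneg (by positivity : 0 ≤ ν ^ 2 * r ^ 6)]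
    calc ν ^ 2 * r ^ 6 * (ρ₁ * |⟪v, D u⟫|) ≤ ν ^ 2 * r ^ 6 * (M * (‖v‖ * (2 * ν * ‖u‖))) := by
          gcongr
          exact (abs_real_inner_le_norm _ _).trans (by gcongr; exact hup u)
      _ = (ν ^ 2 * r ^ 4) * ((ν * r ^ 2) * (2 * M * (‖v‖ * ‖u‖))) := by ring
      _ ≤ (ν * r ^ 2) * (2 * M * (‖v‖ * ‖u‖)) := one_mul_le hν4 (by positivity)
      _ ≤ 2 * M * (‖v‖ * ‖u‖) := one_mul_le hqr (by positivity)
      _ ≤ 2 * M * S := by gcongr; exact prod hSv hSu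
  have scale : ∀ (k : ℕ) {x X : ℝ}, 1 ≤ k → |x| ≤ X → |d ^ k * x| ≤ d * X := by
    intro k x X hk hx
    rw [abs_mul, abs_of_nonneg (by positivity : 0 ≤ d ^ k)]
    exact mul_le_mul (hdp k hk) hx (abs_nonneg _) hd.le
  have c0 := abs_le.1 (scale 10 (by norm_num) b0)
  have c1 := abs_le.1 (scale 16 (by norm_num) b1)
  have c2 := abs_le.1 (scale 16 (by norm_num) b2)
  have c3 := abs_le.1 (scale 18 (by norm_num) b3)
  have c4 := abs_le.1 (scale 20 (by norm_num) b4)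
  have hp : 0 ≤ d * (M * S) := by positivity
  rw [abs_le]
  constructor
  · linarith only [c0.1, c1.1, c2.2, c3.2, c4.1, hp]
  · linarith only [c0.2, c1.2, c2.1, c3.1, c4.2, hp]

/-- Exponential decay in a frequency band around `ν`, at the rate `ν ^ 4 / (1 + ν ^ 2) ^ 3`. -/
theorem BandEvolution.exists_decay (hP : P.Admissible) (hb₀ : 0 < P.b₀) (hk₂ : 0 < k₂)
    (hK : 0 ≤ K) :
    ∃ C > (0 : ℝ), ∃ c > (0 : ℝ), ∀ {D : H →L[ℝ] H} {v u z y θ W R : ℝ → H} {N : ℝ → ℝ} {ν : ℝ},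
      BandEvolution P k₂ K D v u z y θ W R N → 0 < ν → (∀ x, ν * ‖x‖ ≤ ‖D x‖) →
      (∀ x, ‖D x‖ ≤ 2 * ν * ‖x‖) → ∀ t ≥ 0,
      ‖v t‖ ^ 2 + ‖u t‖ ^ 2 + ‖z t‖ ^ 2 + ‖y t‖ ^ 2 + ‖θ t‖ ^ 2 + N t ≤
        C * Real.exp (-(c * (ν ^ 4 / (1 + ν ^ 2) ^ 3)) * t) *
          (‖v 0‖ ^ 2 + ‖u 0‖ ^ 2 + ‖z 0‖ ^ 2 + ‖y 0‖ ^ 2 + ‖θ 0‖ ^ 2 + N 0) := by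
  obtain ⟨c₁, hc₁, C₁, hC₁, hb⟩ := exists_bandEnergy_bounds H hP
  have h1 := hP.k_pos
  have h2 := hP.ρ₁_pos
  have h3 := hP.a_pos
  have h4 := hP.ρ₂_pos
  have h5 := hP.δ_pos
  have h6 := hP.m_pos
  have h7 := hP.βt_pos
  have h8 : 0 < P.ρ₂⁻¹ := by positivity
  -- `M` bounds all coefficients, `c₀` is the smallest dissipation constant, and `d` is small enough
  -- for the cross terms to be absorbed and for the functional to be equivalent to the energy
  obtain ⟨M, hM⟩ : ∃ M, M = 1 + P.k + P.ρ₁ + P.a + P.ρ₂ + P.δ + P.m + P.ρ₂⁻¹ + K := ⟨_, rfl⟩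
  have hM1 : 1 ≤ M := by linarith
  obtain ⟨c₀, hc₀, g1, g2, g3, g4, g5, g6⟩ : ∃ c₀ > 0, c₀ ≤ P.b₀ ∧ c₀ ≤ P.a ∧ c₀ ≤ P.k ∧
      c₀ ≤ P.ρ₁ ∧ c₀ ≤ 2 * P.βt ∧ c₀ ≤ P.m * k₂ := by
    refine ⟨min P.b₀ (min P.a (min P.k (min P.ρ₁ (min (2 * P.βt) (P.m * k₂))))), by positivity, ?_⟩
    simpa only [le_min_iff] using le_refl (min P.b₀ (min P.a (min P.k (min P.ρ₁
      (min (2 * P.βt) (P.m * k₂))))))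
  obtain ⟨d, hd, hd1, hd2, hd3⟩ : ∃ d > 0, d ≤ 1 ∧ d ≤ c₀ / (32 * (4 * M ^ 4)) ∧
      d ≤ c₁ / (16 * M) := by
    refine ⟨min 1 (min (c₀ / (32 * (4 * M ^ 4))) (c₁ / (16 * M))), by positivity, ?_⟩
    simpa only [le_min_iff] using le_refl (min 1 (min (c₀ / (32 * (4 * M ^ 4))) (c₁ / (16 * M))))
  rw [le_div_iff₀ (by positivity)] at hd2 hd3
  refine ⟨(C₁ + c₁) * 2 / c₁, by positivity, c₀ / 2 * d ^ 20 / (C₁ + c₁), by positivity,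
    fun {D v u z y θ W R N ν} h hν hlow hup t ht => ?_⟩
  obtain ⟨r, hr, hrν⟩ : ∃ r : ℝ, 0 < r ∧ r ^ 2 * (1 + ν ^ 2) = 1 := by
    refine ⟨(√(1 + ν ^ 2))⁻¹, by positivity, ?_⟩
    rw [inv_pow, Real.sq_sqrt (by positivity)]
    field_simp
  have hρ : ν ^ 4 / (1 + ν ^ 2) ^ 3 = ν ^ 4 * r ^ 6 := by
    rw [div_eq_iff (by positivity)]
    calc ν ^ 4 = ν ^ 4 * (r ^ 2 * (1 + ν ^ 2)) ^ 3 := by rw [hrν]; ring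
      _ = _ := by ring
  rw [hρ]
  let S : ℝ → ℝ := fun t => ‖v t‖ ^ 2 + ‖u t‖ ^ 2 + ‖z t‖ ^ 2 + ‖y t‖ ^ 2 + ‖θ t‖ ^ 2 + N t
  let L : ℝ → ℝ := fun t => lyapunov P D ν r d (v t) (u t) (z t) (y t) (θ t) (W t) (N t)
  have hMn : ∀ {x : H} {N : ℝ}, ‖x‖ ^ 2 ≤ K ^ 2 * N → 0 ≤ N → ‖x‖ ≤ M * √N := by
    intro x N hx hN
    refine le_trans (b := K * √N) ?_ (by gcongr; linarith)
    refine abs_le_of_sq_le_sq' ?_ (by positivity) |>.2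
    rwa [mul_pow, Real.sq_sqrt hN]
  have hLS : ∀ t ≥ 0, c₁ / 2 * S t ≤ L t ∧ L t ≤ (C₁ + c₁) * S t := by
    intro t ht
    have hN := h.N_nonneg t ht
    obtain ⟨hb1, hb2⟩ := hb (v t) (u t) (z t) (y t) (θ t) (N t) hN
    have p1 := sq_nonneg ‖v t‖
    have p2 := sq_nonneg ‖u t‖
    have p3 := sq_nonneg ‖z t‖
    have p4 := sq_nonneg ‖y t‖
    have p5 := sq_nonneg ‖θ t‖
    have hab := abs_le.1 (abs_corrections_le (S := S t) (v := v t) (u := u t) (z := z t)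
      (y := y t) (ρ₁ := P.ρ₁) (ρ₂ := P.ρ₂) hup hν hr hrν hd hd1 hM1 h2 h4
      (by linarith) (by linarith) (Real.sqrt_nonneg (N t)) (hMn (h.norm_W t ht) hN)
      (by rw [Real.sq_sqrt hN]; simp only [S]; linarith) (by simp only [S]; linarith)
      (by simp only [S]; linarith) (by simp only [S]; linarith) (by simp only [S]; linarith))
    have hS0 : 0 ≤ S t := by simp only [S]; linarith
    have hsm : 8 * M * d * S t ≤ c₁ / 2 * S t := by
      gcongr
      linarith
    have hpos : 0 ≤ c₁ * S t := by positivity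
    simp only [L, lyapunov]
    simp only [S] at hab hsm hpos ⊢
    constructor
    · linarith [hab.1]
    · linarith [hab.2]
  have hLc : ContinuousOn L (Ici 0) := by
    have h0 := h.continuousOn_energy
    have h1 := h.cont_v
    have h2 := h.cont_u
    have h3 := h.cont_z
    have h4 := h.cont_y
    have h7 := h.cont_W
    have comp : ∀ {f : ℝ → H}, ContinuousOn f (Ici 0) → ContinuousOn (fun t => D (f t)) (Ici 0) :=
      fun hf => D.continuous.comp_continuousOn hf
    have := comp h2
    have := comp h3
    have := comp h4
    exact (((h0.add ((h7.inner (comp h4)).neg.const_mul (d ^ 10 * r ^ 2))).add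
      ((((h4.inner (comp h3)).const_mul (-P.ρ₂)).sub ((h2.inner h3).const_mul P.ρ₁)).const_mul
        (d ^ 16 * (ν ^ 2 * r ^ 4)))).add (((h4.inner h1).const_mul (-P.ρ₂)).const_mul
        (d ^ 18 * (ν ^ 2 * r ^ 4)))).add (((h1.inner (comp h2)).const_mul (-P.ρ₁)).const_mul
        (d ^ 20 * (ν ^ 2 * r ^ 6)))
  have hdecay := le_mul_exp_of_touching
    (κ := c₀ / 2 * d ^ 20 / (C₁ + c₁) * (ν ^ 4 * r ^ 6)) hLc (fun t ht => by
    obtain ⟨G, G1, G2, G3⟩ := h.lyapunov_touch hP ν r d ht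
    refine ⟨G, _, G1, G2, G3, ?_⟩
    have hN := h.N_nonneg t ht.le
    have hW := hMn (h.norm_W t ht.le) hN
    have hR := hMn (h.norm_R t ht.le) hN
    have q0 := correction_memory_le (v := v t) (z := z t) (y := y t) (θ := θ t) (W := W t)
      (R := R t) h.skew hlow hup hν hM1 h3.le h6.le h1.le h5.le h4 hb₀.le
      (by linarith) (by linarith) (by linarith) (by linarith) (by linarith) (Real.sqrt_nonneg (N t))
      hW hR
    have q1 := correction_strain_le (k := P.k) (v := v t) (u := u t) (z := z t) (y := y t)
      (θ := θ t) (W := W t) h.skew hlow hup hν hM1 h3.le h6.le h5.le h2 h4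
      (by linarith) (by linarith) (by linarith) (by linarith) (Real.sqrt_nonneg (N t)) hW
    have q2 := correction_shear_le (k := P.k) (v := v t) (u := u t) (z := z t) (y := y t)
      (θ := θ t) (W := W t) h.skew hup hν hM1 h3.le h6.le h5.le h4
      (by linarith) (by linarith) (by linarith) (by linarith) (Real.sqrt_nonneg (N t)) hW
    have q3 := correction_velocity_le (v := v t) (u := u t) (y := y t) h.skew hlow hup hν hM1
      h2 (show P.k ≤ M by linarith) (by linarith)
    have q4 : -(2 * P.βt) * ‖D (θ t)‖ ^ 2 - P.m * k₂ * N t ≤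
        -c₀ * (√(N t) ^ 2 + ν ^ 2 * ‖θ t‖ ^ 2) := by
      rw [Real.sq_sqrt hN]
      have s1 : c₀ * N t ≤ P.m * k₂ * N t := by gcongr
      have s2 : c₀ * (ν * ‖θ t‖) ^ 2 ≤ 2 * P.βt * ‖D (θ t)‖ ^ 2 := by
        gcongr
        exact hlow _
      rw [mul_pow] at s2
      linarith
    have low : ∀ {c x : ℝ}, c₀ ≤ c → 0 ≤ x → -c * x ≤ -c₀ * x := fun hc hx => by
      have := mul_le_mul_of_nonneg_right hc hx
      linarith
    have q0' := q0.trans (add_le_add_left (low g1 (by positivity)) _)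
    have q1' := q1.trans (add_le_add_left (low g2 (by positivity)) _)
    have q2' := q2.trans (add_le_add_left (low g3 (by positivity)) _)
    have q3' := q3.trans (add_le_add_left (low g4 (by positivity)) _)
    have m0 := mul_le_mul_of_nonneg_left q0' (show 0 ≤ d ^ 10 * r ^ 2 by positivity)
    have m1 := mul_le_mul_of_nonneg_left q1' (show 0 ≤ d ^ 16 * (ν ^ 2 * r ^ 4) by positivity)
    have m2 := mul_le_mul_of_nonneg_left q2' (show 0 ≤ d ^ 18 * (ν ^ 2 * r ^ 4) by positivity)
    have m3 := mul_le_mul_of_nonneg_left q3' (show 0 ≤ d ^ 20 * (ν ^ 2 * r ^ 6) by positivity)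
    have hw := weighted_absorb (c := c₀) (C := 4 * M ^ 4) (d := d) (n := √(N t)) (θ := ‖θ t‖)
      (y := ‖y t‖) (z := ‖z t‖) (v := ‖v t‖) (u := ‖u t‖) (ν := ν) (r := r) hc₀.le (by positivity)
      hd hd1 (by linarith) (Real.sqrt_nonneg _) (norm_nonneg _) (norm_nonneg _) (norm_nonneg _)
      (norm_nonneg _) (norm_nonneg _) hν hr hrν
    refine (add_le_add (add_le_add (add_le_add (add_le_add q4 m0) m1) m2) m3).trans (hw.trans ?_)
    have hS := (hLS t ht.le).2
    have hκ : 0 ≤ c₀ / 2 * d ^ 20 / (C₁ + c₁) * (ν ^ 4 * r ^ 6) := by positivity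
    have := mul_le_mul_of_nonneg_left hS hκ
    have e : c₀ / 2 * d ^ 20 / (C₁ + c₁) * (ν ^ 4 * r ^ 6) * ((C₁ + c₁) * S t) =
      c₀ / 2 * d ^ 20 * (ν ^ 4 * r ^ 6) * S t := by
      field_simp
    rw [e] at this
    rw [Real.sq_sqrt hN]
    refine le_trans (le_of_eq ?_) ((neg_le_neg this).trans_eq ?_)
    · simp only [S]; ring
    · simp only [L]; ring) t ht
  have hS1 := (hLS t ht).1
  have hS2 := (hLS 0 le_rfl).2
  change S t ≤ _ * S 0
  have e : (C₁ + c₁) * 2 / c₁ * Real.exp (-(c₀ / 2 * d ^ 20 / (C₁ + c₁) * (ν ^ 4 * r ^ 6)) * t) * S 0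
      = 2 / c₁ * (((C₁ + c₁) * S 0) *
        Real.exp (-(c₀ / 2 * d ^ 20 / (C₁ + c₁) * (ν ^ 4 * r ^ 6)) * t)) := by ring
  rw [e]
  calc S t = 2 / c₁ * (c₁ / 2 * S t) := by field_simp
    _ ≤ 2 / c₁ * (((C₁ + c₁) * S 0) *
        Real.exp (-(c₀ / 2 * d ^ 20 / (C₁ + c₁) * (ν ^ 4 * r ^ 6)) * t)) := by
      refine mul_le_mul_of_nonneg_left (hS1.trans (hdecay.trans ?_)) (by positivity)
      exact mul_le_mul_of_nonneg_right hS2 (Real.exp_nonneg _)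

end Evolution

/-! ### Weak derivatives and the Fourier transform -/

section Fourier

open scoped FourierTransform SchwartzMap

/-- The symbol `2πiξ` of `∂_x`. -/
noncomputable def symbol (ξ : ℝ) : ℂ := 2 * Real.pi * Complex.I * ξ

lemma norm_symbol (ξ : ℝ) : ‖symbol ξ‖ = 2 * Real.pi * |ξ| := by
  simp [symbol, abs_of_pos Real.pi_pos]

lemma continuous_symbol : Continuous symbol := by
  unfold symbol
  fun_prop

lemma fourier_pairing (f : Lp ℂ 2 (volume : Measure ℝ)) (e : 𝓢(ℝ, ℂ)) :
    ∫ x, e x * (𝓕 f : Lp ℂ 2 (volume : Measure ℝ)) x = ∫ x, (𝓕 e : 𝓢(ℝ, ℂ)) x * f x := by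
  have h := DFunLike.congr_fun (Lp.fourier_toTemperedDistribution_eq f) e
  rw [TemperedDistribution.fourier_apply, Lp.toTemperedDistribution_apply,
    Lp.toTemperedDistribution_apply] at h
  simpa only [smul_eq_mul] using h.symm

/-- Multiplication of a Schwartz function by `(-2πix)^j`. -/
noncomputable def mulSymbol (j : ℕ) (e : 𝓢(ℝ, ℂ)) : 𝓢(ℝ, ℂ) :=
  SchwartzMap.smulLeftCLM ℂ (fun x => (-symbol x) ^ j) e

lemma mulSymbol_apply (j : ℕ) (e : 𝓢(ℝ, ℂ)) (x : ℝ) :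
    mulSymbol j e x = (-symbol x) ^ j * e x := by
  have h : (fun x => (-symbol x) ^ j).HasTemperateGrowth := by
    unfold symbol
    fun_prop
  rw [mulSymbol, SchwartzMap.smulLeftCLM_apply_apply h, smul_eq_mul]

/-- Derivatives on the Fourier side are multiplications by powers of `-2πix`. -/
lemma iteratedDeriv_fourier_schwartz (j : ℕ) (e : 𝓢(ℝ, ℂ)) :
    iteratedDeriv j (𝓕 e : 𝓢(ℝ, ℂ)) = (𝓕 (mulSymbol j e) : 𝓢(ℝ, ℂ)) := by
  rw [SchwartzMap.fourier_coe, SchwartzMap.fourier_coe,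
    Real.iteratedDeriv_fourier (N := ⊤) (n := j) (fun n _ => ?_) le_top]
  · congr 1
    ext x
    rw [mulSymbol_apply, symbol, smul_eq_mul]
    ring
  · have h : (fun x : ℝ => x ^ n).HasTemperateGrowth := by fun_prop
    have := (SchwartzMap.smulLeftCLM ℂ (fun x : ℝ => x ^ n) e).integrable (μ := volume)
    rwa [SchwartzMap.smulLeftCLM_apply h] at this

lemma memLp_fourier_schwartz (j : ℕ) (e : 𝓢(ℝ, ℂ)) :
    MemLp (iteratedDeriv j (𝓕 e : 𝓢(ℝ, ℂ))) 2 volume := by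
  rw [iteratedDeriv_fourier_schwartz]
  exact SchwartzMap.memLp _ 2 volume

lemma exists_cutoff : ∃ χ : ℝ → ℝ, ContDiff ℝ ∞ χ ∧ HasCompactSupport χ ∧ χ 0 = 1 := by
  let b : ContDiffBump (0 : ℝ) := ⟨1, 2, by norm_num, by norm_num⟩
  exact ⟨b, b.contDiff, b.hasCompactSupport, b.one_of_mem_closedBall (by simp [b])⟩

lemma exists_bound_of_hasCompactSupport {χ : ℝ → ℝ} (h : Continuous χ) (hc : HasCompactSupport χ) :
    ∃ M, 0 ≤ M ∧ ∀ x, |χ x| ≤ M := by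
  obtain ⟨M, hM⟩ := h.bounded_above_of_compact_support hc
  exact ⟨M, (norm_nonneg _).trans (hM 0), hM⟩

/-- Cutting off turns an identity for test functions into one for smooth functions that are
square integrable with two derivatives. -/
lemma pairing_eq_zero_of_test {A B C : ℝ → ℂ} (hA : MemLp A 2 volume) (hB : MemLp B 2 volume)
    (hC : MemLp C 2 volume)
    (h : ∀ φ, IsTest φ → ∫ x, ((φ x : ℂ) * A x + ((deriv φ x : ℝ) : ℂ) * B x
      + ((iteratedDeriv 2 φ x : ℝ) : ℂ) * C x) = 0)
    {ψ : ℝ → ℝ} (hψ : ContDiff ℝ ∞ ψ) (h0 : MemLp ψ 2 volume) (h1 : MemLp (deriv ψ) 2 volume)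
    (h2 : MemLp (iteratedDeriv 2 ψ) 2 volume) :
    ∫ x, ((ψ x : ℂ) * A x + ((deriv ψ x : ℝ) : ℂ) * B x + ((iteratedDeriv 2 ψ x : ℝ) : ℂ) * C x) = 0 := by
  obtain ⟨χ, hχ, hχc, hχ0⟩ := exists_cutoff
  have hχ' : ContDiff ℝ ∞ (deriv χ) := (contDiff_infty_iff_deriv.1 hχ).2
  have hχ'' : ContDiff ℝ ∞ (deriv (deriv χ)) := (contDiff_infty_iff_deriv.1 hχ').2
  have hψ' : ContDiff ℝ ∞ (deriv ψ) := (contDiff_infty_iff_deriv.1 hψ).2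
  obtain ⟨M₀, hM₀, hb0⟩ := exists_bound_of_hasCompactSupport hχ.continuous hχc
  obtain ⟨M₁, hM₁, hb1⟩ := exists_bound_of_hasCompactSupport hχ'.continuous hχc.deriv
  obtain ⟨M₂, hM₂, hb2⟩ := exists_bound_of_hasCompactSupport hχ''.continuous hχc.deriv.deriv
  have hdχ : ∀ q x : ℝ, HasDerivAt (fun x => χ (q * x)) (q * deriv χ (q * x)) x := by
    intro q x
    have := ((hχ.differentiable (by simp)) (q * x)).hasDerivAt.comp x ((hasDerivAt_id x).const_mul q)
    exact this.congr_deriv (by simp [mul_comm])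
  have hdχ' : ∀ q x : ℝ, HasDerivAt (fun x => deriv χ (q * x)) (q * deriv (deriv χ) (q * x)) x := by
    intro q x
    have := ((hχ'.differentiable (by simp)) (q * x)).hasDerivAt.comp x ((hasDerivAt_id x).const_mul q)
    exact this.congr_deriv (by simp [mul_comm])
  have hdψ : ∀ x, HasDerivAt ψ (deriv ψ x) x := fun x =>
    (hψ.differentiable (by simp) x).hasDerivAt
  have hdψ' : ∀ x, HasDerivAt (deriv ψ) (deriv (deriv ψ) x) x := fun x =>
    (hψ'.differentiable (by simp) x).hasDerivAt
  have two : ∀ f : ℝ → ℝ, iteratedDeriv 2 f = deriv (deriv f) := fun f => by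
    rw [iteratedDeriv_succ, iteratedDeriv_one]
  have d1 : ∀ q : ℝ, deriv (fun x => χ (q * x) * ψ x) =
      fun x => q * deriv χ (q * x) * ψ x + χ (q * x) * deriv ψ x := fun q => by
    ext x
    exact ((hdχ q x).mul (hdψ x)).deriv
  have d2 : ∀ q : ℝ, iteratedDeriv 2 (fun x => χ (q * x) * ψ x) =
      fun x => q * (q * deriv (deriv χ) (q * x)) * ψ x + q * deriv χ (q * x) * deriv ψ x +
        (q * deriv χ (q * x) * deriv ψ x + χ (q * x) * deriv (deriv ψ) x) := fun q => by
    rw [two, d1]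
    ext x
    exact ((((hdχ' q x).const_mul q).mul (hdψ x)).add ((hdχ q x).mul (hdψ' x))).deriv
  rw [two] at h2 ⊢
  let q : ℕ → ℝ := fun n => 1 / ((n : ℝ) + 1)
  have hq0 : ∀ n, 0 < q n := fun n => by positivity
  have hq1 : ∀ n, q n ≤ 1 := fun n => by
    rw [div_le_one (by positivity)]
    linarith [(Nat.cast_nonneg n : (0 : ℝ) ≤ n)]
  have hqt : Tendsto q atTop (𝓝 0) := tendsto_one_div_add_atTop_nhds_zero_nat
  let F : ℕ → ℝ → ℂ := fun n x => ((χ (q n * x) * ψ x : ℝ) : ℂ) * A x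
    + ((q n * deriv χ (q n * x) * ψ x + χ (q n * x) * deriv ψ x : ℝ) : ℂ) * B x
    + ((q n * (q n * deriv (deriv χ) (q n * x)) * ψ x + q n * deriv χ (q n * x) * deriv ψ x +
        (q n * deriv χ (q n * x) * deriv ψ x + χ (q n * x) * deriv (deriv ψ) x) : ℝ) : ℂ) * C x
  have hF : ∀ n, ∫ x, F n x = 0 := by
    intro n
    have ht : IsTest (fun x => χ (q n * x) * ψ x) := by
      refine ⟨(hχ.comp (contDiff_const.mul contDiff_id)).mul hψ, ?_⟩
      refine HasCompactSupport.mul_right ?_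
      exact hχc.comp_homeomorph (Homeomorph.mulLeft₀ (q n) (hq0 n).ne')
    have := h _ ht
    rw [d1, d2] at this
    exact this
  let G : ℝ → ℝ := fun x => M₀ * (‖ψ x‖ * ‖A x‖) + (M₁ * (‖ψ x‖ * ‖B x‖) + M₀ * (‖deriv ψ x‖ * ‖B x‖))
    + (M₂ * (‖ψ x‖ * ‖C x‖) + 2 * M₁ * (‖deriv ψ x‖ * ‖C x‖) + M₀ * (‖deriv (deriv ψ) x‖ * ‖C x‖))
  have hG : Integrable G := by
    have key : ∀ {f : ℝ → ℝ} {g : ℝ → ℂ}, MemLp f 2 volume → MemLp g 2 volume →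
        Integrable (fun x => ‖f x‖ * ‖g x‖) := fun hf hg => hf.norm.integrable_mul hg.norm
    exact (((key h0 hA).const_mul _).add (((key h0 hB).const_mul _).add ((key h1 hB).const_mul _))).add
      ((((key h0 hC).const_mul _).add ((key h1 hC).const_mul _)).add ((key h2 hC).const_mul _))
  have hχq : ∀ {f : ℝ → ℝ}, Continuous f → ∀ x, Tendsto (fun n => f (q n * x)) atTop (𝓝 (f 0)) := by
    intro f hf x
    have : Tendsto (fun n => q n * x) atTop (𝓝 (0 * x)) := hqt.mul_const x
    rw [zero_mul] at this
    exact (hf.tendsto 0).comp this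
  have hlim := tendsto_integral_of_dominated_convergence (F := F)
    (f := fun x => (ψ x : ℂ) * A x + ((deriv ψ x : ℝ) : ℂ) * B x + ((deriv (deriv ψ) x : ℝ) : ℂ) * C x) G
    (fun n => ?_) hG (fun n => ?_) ?_
  · simp only [hF] at hlim
    exact (tendsto_nhds_unique hlim tendsto_const_nhds)
  · have c0 := hχ.continuous
    have c1 := hχ'.continuous
    have c2 := hχ''.continuous
    have c3 := hψ.continuous
    have c4 := hψ'.continuous
    have c5 := (contDiff_infty_iff_deriv.1 hψ').2.continuous
    have real : ∀ {f : ℝ → ℝ}, Continuous f →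
        AEStronglyMeasurable (fun x => (f x : ℂ)) (volume : Measure ℝ) := fun hf =>
      (Complex.continuous_ofReal.comp hf).aestronglyMeasurable
    refine (((real ?_).mul hA.1).add ((real ?_).mul hB.1)).add ((real ?_).mul hC.1) <;> fun_prop
  · refine Eventually.of_forall fun x => ?_
    have e0 := hb0 (q n * x)
    have e1 : |q n * deriv χ (q n * x)| ≤ M₁ := by
      rw [abs_mul, abs_of_pos (hq0 n)]
      exact (mul_le_of_le_one_left (abs_nonneg _) (hq1 n)).trans (hb1 _)
    have e2 : |q n * (q n * deriv (deriv χ) (q n * x))| ≤ M₂ := by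
      rw [abs_mul, abs_mul, abs_of_pos (hq0 n)]
      exact (mul_le_of_le_one_left (by positivity) (hq1 n)).trans
        ((mul_le_of_le_one_left (abs_nonneg _) (hq1 n)).trans (hb2 _))
    have a1 : |χ (q n * x) * ψ x| ≤ M₀ * ‖ψ x‖ := by
      rw [abs_mul]; gcongr; rfl
    have a2 : |q n * deriv χ (q n * x) * ψ x + χ (q n * x) * deriv ψ x| ≤
        M₁ * ‖ψ x‖ + M₀ * ‖deriv ψ x‖ := by
      refine (abs_add_le _ _).trans (add_le_add ?_ ?_)
      · rw [abs_mul]; gcongr; rfl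
      · rw [abs_mul]; gcongr; rfl
    have a3 : |q n * (q n * deriv (deriv χ) (q n * x)) * ψ x + q n * deriv χ (q n * x) * deriv ψ x +
        (q n * deriv χ (q n * x) * deriv ψ x + χ (q n * x) * deriv (deriv ψ) x)| ≤
        M₂ * ‖ψ x‖ + M₁ * ‖deriv ψ x‖ + (M₁ * ‖deriv ψ x‖ + M₀ * ‖deriv (deriv ψ) x‖) := by
      refine (abs_add_le _ _).trans (add_le_add ((abs_add_le _ _).trans (add_le_add ?_ ?_))
        ((abs_add_le _ _).trans (add_le_add ?_ ?_)))
      all_goals rw [abs_mul]; gcongr; rfl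
    calc ‖F n x‖ ≤ |χ (q n * x) * ψ x| * ‖A x‖
        + |q n * deriv χ (q n * x) * ψ x + χ (q n * x) * deriv ψ x| * ‖B x‖
        + |q n * (q n * deriv (deriv χ) (q n * x)) * ψ x + q n * deriv χ (q n * x) * deriv ψ x +
          (q n * deriv χ (q n * x) * deriv ψ x + χ (q n * x) * deriv (deriv ψ) x)| * ‖C x‖ := by
          refine (norm_add_le _ _).trans (add_le_add ((norm_add_le _ _).trans (add_le_add ?_ ?_)) ?_)
          all_goals rw [norm_mul, Complex.norm_real, Real.norm_eq_abs]
      _ ≤ (M₀ * ‖ψ x‖) * ‖A x‖ + (M₁ * ‖ψ x‖ + M₀ * ‖deriv ψ x‖) * ‖B x‖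
        + (M₂ * ‖ψ x‖ + M₁ * ‖deriv ψ x‖ + (M₁ * ‖deriv ψ x‖ + M₀ * ‖deriv (deriv ψ) x‖)) * ‖C x‖ := by
          gcongr
      _ = G x := by simp only [G]; ring
  · refine Eventually.of_forall fun x => ?_
    have l0 := hχq hχ.continuous x
    have l1 := hχq hχ'.continuous x
    have l2 := hχq hχ''.continuous x
    rw [hχ0] at l0
    have m1 := hqt.mul l1
    have m2 := hqt.mul (hqt.mul l2)
    simp only [zero_mul] at m1 m2
    have r1 := l0.mul_const (ψ x)
    have r2 := (m1.mul_const (ψ x)).add (l0.mul_const (deriv ψ x))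
    have r3 := ((m2.mul_const (ψ x)).add (m1.mul_const (deriv ψ x))).add
      ((m1.mul_const (deriv ψ x)).add (l0.mul_const (deriv (deriv ψ) x)))
    have toC : ∀ {f : ℕ → ℝ} {a : ℝ}, Tendsto f atTop (𝓝 a) →
        Tendsto (fun n => (f n : ℂ)) atTop (𝓝 (a : ℂ)) := fun hf =>
      (Complex.continuous_ofReal.tendsto _).comp hf
    have := (((toC r1).mul_const (A x)).add ((toC r2).mul_const (B x))).add
      ((toC r3).mul_const (C x))
    simpa only [one_mul, zero_mul, zero_add] using this

/-- The complex form of `pairing_eq_zero_of_test`, for the Fourier transform of a Schwartz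
function. -/
lemma pairing_fourier_schwartz_eq_zero {A B C : ℝ → ℂ} (hA : MemLp A 2 volume)
    (hB : MemLp B 2 volume) (hC : MemLp C 2 volume)
    (h : ∀ φ, IsTest φ → ∫ x, ((φ x : ℂ) * A x + ((deriv φ x : ℝ) : ℂ) * B x
      + ((iteratedDeriv 2 φ x : ℝ) : ℂ) * C x) = 0) (e : 𝓢(ℝ, ℂ)) :
    ∫ x, ((𝓕 e : 𝓢(ℝ, ℂ)) x * A x + (𝓕 (mulSymbol 1 e) : 𝓢(ℝ, ℂ)) x * B x
      + (𝓕 (mulSymbol 2 e) : 𝓢(ℝ, ℂ)) x * C x) = 0 := by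
  set Ψ : ℝ → ℂ := ⇑(𝓕 e : 𝓢(ℝ, ℂ)) with hΨ
  have hΨs : ContDiff ℝ ∞ Ψ := SchwartzMap.smooth _ ⊤
  have hΨ1 : ContDiff ℝ ∞ (deriv Ψ) := (contDiff_infty_iff_deriv.1 hΨs).2
  have two : ∀ {F : Type} [NormedAddCommGroup F] [NormedSpace ℝ F] (f : ℝ → F),
      iteratedDeriv 2 f = deriv (deriv f) := fun f => by
    rw [iteratedDeriv_succ, iteratedDeriv_one]
  have m0 : MemLp Ψ 2 volume := SchwartzMap.memLp _ 2 volume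
  have m1 : MemLp (deriv Ψ) 2 volume := by
    have := memLp_fourier_schwartz 1 e
    rwa [iteratedDeriv_one] at this
  have m2 : MemLp (deriv (deriv Ψ)) 2 volume := by
    have := memLp_fourier_schwartz 2 e
    rwa [two] at this
  have e1 : deriv Ψ = (𝓕 (mulSymbol 1 e) : 𝓢(ℝ, ℂ)) := by
    rw [← iteratedDeriv_fourier_schwartz, iteratedDeriv_one]
  have e2 : deriv (deriv Ψ) = (𝓕 (mulSymbol 2 e) : 𝓢(ℝ, ℂ)) := by
    rw [← iteratedDeriv_fourier_schwartz, two]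
  rw [← e1, ← e2]
  have part : ∀ ℓ : ℂ →L[ℝ] ℝ, ∫ x, ((ℓ (Ψ x) : ℂ) * A x + (ℓ (deriv Ψ x) : ℂ) * B x
      + (ℓ (deriv (deriv Ψ) x) : ℂ) * C x) = 0 := by
    intro ℓ
    have d1 : deriv (fun x => ℓ (Ψ x)) = fun x => ℓ (deriv Ψ x) := by
      ext x
      exact (ℓ.hasFDerivAt.comp_hasDerivAt x (hΨs.differentiable (by simp) x).hasDerivAt).deriv
    have d2 : iteratedDeriv 2 (fun x => ℓ (Ψ x)) = fun x => ℓ (deriv (deriv Ψ) x) := by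
      rw [two, d1]
      ext x
      exact (ℓ.hasFDerivAt.comp_hasDerivAt x (hΨ1.differentiable (by simp) x).hasDerivAt).deriv
    have := pairing_eq_zero_of_test hA hB hC h (ψ := fun x => ℓ (Ψ x)) (ℓ.contDiff.comp hΨs)
      (ℓ.comp_memLp' m0) (by rw [d1]; exact ℓ.comp_memLp' m1) (by rw [d2]; exact ℓ.comp_memLp' m2)
    rwa [d1, d2] at this
  have prod : ∀ (ℓ : ℂ →L[ℝ] ℝ) {f g : ℝ → ℂ}, MemLp f 2 volume → MemLp g 2 volume →
      Integrable (fun x => (ℓ (f x) : ℂ) * g x) := fun ℓ f g hf hg =>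
    (ℓ.comp_memLp' hf).ofReal.integrable_mul hg
  have int : ∀ ℓ : ℂ →L[ℝ] ℝ, Integrable (fun x => (ℓ (Ψ x) : ℂ) * A x
      + (ℓ (deriv Ψ x) : ℂ) * B x + (ℓ (deriv (deriv Ψ) x) : ℂ) * C x) := fun ℓ =>
    ((prod ℓ m0 hA).add (prod ℓ m1 hB)).add (prod ℓ m2 hC)
  have hr := part Complex.reCLM
  have hi := part Complex.imCLM
  have : ∫ x, ((((Complex.reCLM (Ψ x) : ℝ) : ℂ) * A x + (Complex.reCLM (deriv Ψ x) : ℂ) * B x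
      + (Complex.reCLM (deriv (deriv Ψ) x) : ℂ) * C x) + Complex.I *
      (((Complex.imCLM (Ψ x) : ℝ) : ℂ) * A x + (Complex.imCLM (deriv Ψ x) : ℂ) * B x
      + (Complex.imCLM (deriv (deriv Ψ) x) : ℂ) * C x)) = 0 := by
    rw [integral_add (int Complex.reCLM) ((int Complex.imCLM).const_mul _), hr,
      integral_const_mul, hi]
    simp
  rw [← this]
  congr 1
  ext x
  simp only [Complex.reCLM_apply, Complex.imCLM_apply]
  conv_lhs => rw [← Complex.re_add_im (Ψ x), ← Complex.re_add_im (deriv Ψ x),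
    ← Complex.re_add_im (deriv (deriv Ψ) x)]
  ring

lemma locallyIntegrable_continuous_mul {m f : ℝ → ℂ} (hm : Continuous m)
    (hf : MemLp f 2 volume) : LocallyIntegrable (fun x => m x * f x) := by
  have h := (hf.locallyIntegrable (by norm_num)).locallyIntegrableOn univ
  exact locallyIntegrableOn_univ.1 (h.continuousOn_mul hm.continuousOn isOpen_univ.isLocallyClosed)

/-- A weak identity `A = ∂_x B - ∂_x² C` on the line, read off on the Fourier side. -/
theorem fourier_eq_of_weak (A B C : Lp ℂ 2 (volume : Measure ℝ))
    (h : ∀ φ, IsTest φ → ∫ x, ((φ x : ℂ) * A x + ((deriv φ x : ℝ) : ℂ) * B x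
      + ((iteratedDeriv 2 φ x : ℝ) : ℂ) * C x) = 0) :
    ∀ᵐ ξ, (𝓕 A : Lp ℂ 2 (volume : Measure ℝ)) ξ
      - symbol ξ * (𝓕 B : Lp ℂ 2 (volume : Measure ℝ)) ξ
      + symbol ξ ^ 2 * (𝓕 C : Lp ℂ 2 (volume : Measure ℝ)) ξ = 0 := by
  have mA := Lp.memLp (𝓕 A : Lp ℂ 2 (volume : Measure ℝ))
  have mB := Lp.memLp (𝓕 B : Lp ℂ 2 (volume : Measure ℝ))
  have mC := Lp.memLp (𝓕 C : Lp ℂ 2 (volume : Measure ℝ))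
  refine ae_eq_zero_of_integral_contDiff_smul_eq_zero ?_ ?_
  · exact ((mA.locallyIntegrable (by norm_num)).sub
      (locallyIntegrable_continuous_mul continuous_symbol mB)).add
      (locallyIntegrable_continuous_mul (continuous_symbol.pow 2) mC)
  · intro g hg hgc
    have hg₁ : HasCompactSupport (Complex.ofRealCLM ∘ g) := hgc.comp_left rfl
    have hg₂ : ContDiff ℝ ∞ (Complex.ofRealCLM ∘ g) := by fun_prop
    obtain ⟨e, he⟩ : ∃ e : 𝓢(ℝ, ℂ), ∀ x, e x = g x := ⟨hg₁.toSchwartzMap hg₂, fun x => rfl⟩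
    have h0 := pairing_fourier_schwartz_eq_zero (Lp.memLp A) (Lp.memLp B) (Lp.memLp C) h e
    have int : ∀ (e : 𝓢(ℝ, ℂ)) {f : ℝ → ℂ}, MemLp f 2 volume → Integrable (fun x => e x * f x) :=
      fun e f hf => (SchwartzMap.memLp e 2 volume).integrable_mul hf
    have split : ∀ {f g h : ℝ → ℂ}, Integrable f → Integrable g → Integrable h →
        ∫ x, (f x + g x + h x) = (∫ x, f x) + (∫ x, g x) + ∫ x, h x := fun hf hg hh => by
      rw [← integral_add hf hg]
      exact integral_add (hf.add hg) hh
    rw [split (int _ (Lp.memLp A)) (int _ (Lp.memLp B)) (int _ (Lp.memLp C)), ← fourier_pairing,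
      ← fourier_pairing, ← fourier_pairing, ← split (int _ mA) (int _ mB) (int _ mC)] at h0
    rw [← h0]
    congr 1
    ext x
    rw [mulSymbol_apply, mulSymbol_apply, he, Complex.real_smul]
    ring

end Fourier

/-! ### Real functions in complex `L²(ℝ)` -/

section RealFunctions

open scoped FourierTransform SchwartzMap ComplexConjugate

/-- Complex-valued `L²(ℝ)`, in which both the state and its Fourier transform live. -/
abbrev LTwo : Type := Lp ℂ 2 (volume : Measure ℝ)

/-- The class of a real function in complex `L²(ℝ)`; `0` if it is not square integrable. -/
noncomputable def toL2 (f : ℝ → ℝ) : LTwo :=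
  open scoped Classical in
  if h : MemLp f 2 volume then (h.ofReal (K := ℂ)).toLp _ else 0

lemma toL2_coe {f : ℝ → ℝ} (h : MemLp f 2 volume) : toL2 f =ᵐ[volume] fun x => (f x : ℂ) := by
  rw [toL2, dif_pos h]
  exact MemLp.coeFn_toLp _

lemma toL2_congr {f g : ℝ → ℝ} (h : f =ᵐ[volume] g) : toL2 f = toL2 g := by
  by_cases hf : MemLp f 2 volume
  · have hg := hf.ae_eq h
    refine Lp.ext ?_
    filter_upwards [toL2_coe hf, toL2_coe hg, h] with x h1 h2 h3
    rw [h1, h2, h3]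
  · have hg : ¬ MemLp g 2 volume := fun hg => hf (hg.ae_eq h.symm)
    rw [toL2, toL2, dif_neg hf, dif_neg hg]

lemma toL2_sub {f g : ℝ → ℝ} (hf : MemLp f 2 volume) (hg : MemLp g 2 volume) :
    toL2 (fun x => f x - g x) = toL2 f - toL2 g := by
  refine Lp.ext ?_
  filter_upwards [toL2_coe hf, toL2_coe hg, toL2_coe (hf.sub hg), Lp.coeFn_sub (toL2 f) (toL2 g)]
    with x h1 h2 h3 h4
  rw [h4, Pi.sub_apply, h1, h2]
  refine Eq.trans h3 ?_
  simp

lemma enorm_toL2 {f : ℝ → ℝ} (hf : MemLp f 2 volume) : ‖toL2 f‖ₑ = eLpNorm f 2 volume := by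
  rw [Lp.enorm_def, eLpNorm_congr_ae (toL2_coe hf)]
  refine eLpNorm_congr_norm_ae (Eventually.of_forall fun x => ?_)
  simp

lemma inner_toL2 {φ : ℝ → ℝ} (hφ : MemLp φ 2 volume) (A : LTwo) :
    inner ℂ (toL2 φ) A = ∫ x, (φ x : ℂ) * A x := by
  rw [L2.inner_def]
  refine integral_congr_ae ?_
  filter_upwards [toL2_coe hφ] with x hx
  rw [hx, RCLike.inner_apply, Complex.conj_ofReal, mul_comm]

lemma inner_toL2_toL2 {φ f : ℝ → ℝ} (hφ : MemLp φ 2 volume) (hf : MemLp f 2 volume) :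
    inner ℂ (toL2 φ) (toL2 f) = ((∫ x, f x * φ x : ℝ) : ℂ) := by
  rw [inner_toL2 hφ, ← integral_complex_ofReal]
  refine integral_congr_ae ?_
  filter_upwards [toL2_coe hf] with x hx
  rw [hx, Complex.ofReal_mul, mul_comm]

lemma IsTest.deriv {φ : ℝ → ℝ} (h : IsTest φ) : IsTest (deriv φ) :=
  ⟨(contDiff_infty_iff_deriv.1 h.1).2, h.2.deriv⟩

lemma IsTest.iteratedDeriv {φ : ℝ → ℝ} (h : IsTest φ) (j : ℕ) : IsTest (iteratedDeriv j φ) := by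
  induction j with
  | zero => simpa using h
  | succ j ih => rw [iteratedDeriv_succ]; exact ih.deriv

lemma IsTest.memLp {φ : ℝ → ℝ} (h : IsTest φ) (p : ℝ≥0∞) : MemLp φ p volume :=
  h.1.continuous.memLp_of_hasCompactSupport h.2

/-- `fourier_eq_of_weak` in terms of inner products with test functions. -/
theorem fourier_eq_of_inner_test (A B C : LTwo)
    (h : ∀ φ, IsTest φ → inner ℂ (toL2 φ) A + inner ℂ (toL2 (deriv φ)) B
      + inner ℂ (toL2 (iteratedDeriv 2 φ)) C = 0) :
    ∀ᵐ ξ, (𝓕 A : LTwo) ξ - symbol ξ * (𝓕 B : LTwo) ξ + symbol ξ ^ 2 * (𝓕 C : LTwo) ξ = 0 := by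
  refine fourier_eq_of_weak A B C fun φ hφ => ?_
  have h1 := h φ hφ
  have int : ∀ {φ : ℝ → ℝ}, MemLp φ 2 volume → ∀ A : LTwo, Integrable (fun x => (φ x : ℂ) * A x) :=
    fun hφ A => (hφ.ofReal (K := ℂ)).integrable_mul (Lp.memLp A)
  have m0 := hφ.memLp 2
  have m1 := hφ.deriv.memLp 2
  have m2 := (hφ.iteratedDeriv 2).memLp 2
  rw [inner_toL2 m0, inner_toL2 m1, inner_toL2 m2, ← integral_add (int m0 A) (int m1 B)] at h1
  exact (integral_add ((int m0 A).add (int m1 B)) (int m2 C)).trans h1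

lemma iteratedDeriv_comp_add (i j : ℕ) (φ : ℝ → ℝ) :
    iteratedDeriv i (iteratedDeriv j φ) = iteratedDeriv (i + j) φ := by
  simp only [iteratedDeriv_eq_iterate, Function.iterate_add_apply]

lemma isWeakDeriv_unique {j : ℕ} {f h h' : ℝ → ℝ} (h1 : IsWeakDeriv j f h)
    (h2 : IsWeakDeriv j f h') : h =ᵐ[volume] h' := by
  refine ae_eq_of_integral_contDiff_smul_eq h1.2.1 h2.2.1 fun φ hφ hφc => ?_
  have e := (h1.2.2 φ ⟨hφ, hφc⟩).symm.trans (h2.2.2 φ ⟨hφ, hφc⟩)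
  have := mul_left_cancel₀ (pow_ne_zero j (by norm_num : (-1 : ℝ) ≠ 0)) e
  simpa only [smul_eq_mul, mul_comm] using this

lemma IsWeakDeriv.congr {j : ℕ} {f f' h h' : ℝ → ℝ} (H : IsWeakDeriv j f h)
    (hf : f =ᵐ[volume] f') (hh : h =ᵐ[volume] h') : IsWeakDeriv j f' h' := by
  refine ⟨H.1.congr hf, H.2.1.congr hh, fun φ hφ => ?_⟩
  rw [integral_congr_ae (g := fun x => f x * iteratedDeriv j φ x), H.2.2 φ hφ,
    integral_congr_ae (g := fun x => h' x * φ x)]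
  · filter_upwards [hh] with x hx; rw [hx]
  · filter_upwards [hf] with x hx; rw [hx]

lemma isWeakDeriv_zero {f : ℝ → ℝ} (hf : LocallyIntegrable f) : IsWeakDeriv 0 f f :=
  ⟨hf, hf, fun φ _ => by simp⟩

/-- If `h = ∂^i f` and `h' = ∂^(i+j) f` weakly, then `h' = ∂^j h`. -/
lemma IsWeakDeriv.of_add {i j : ℕ} {f h h' : ℝ → ℝ} (h1 : IsWeakDeriv i f h)
    (h2 : IsWeakDeriv (i + j) f h') : IsWeakDeriv j h h' := by
  refine ⟨h1.2.1, h2.2.1, fun φ hφ => ?_⟩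
  have e1 := h1.2.2 _ (hφ.iteratedDeriv j)
  have e2 := h2.2.2 φ hφ
  rw [iteratedDeriv_comp_add] at e1
  rw [e1, pow_add, mul_assoc] at e2
  exact mul_left_cancel₀ (pow_ne_zero i (by norm_num : (-1 : ℝ) ≠ 0)) e2

lemma IsWeakDeriv.add {i j : ℕ} {f h h' : ℝ → ℝ} (h1 : IsWeakDeriv i f h)
    (h2 : IsWeakDeriv j h h') : IsWeakDeriv (i + j) f h' := by
  refine ⟨h1.1, h2.2.1, fun φ hφ => ?_⟩
  rw [← iteratedDeriv_comp_add, h1.2.2 _ (hφ.iteratedDeriv j), h2.2.2 φ hφ, pow_add, mul_assoc]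

lemma fourier_weakDeriv_one {f h : ℝ → ℝ} (H : IsWeakDeriv 1 f h) (hf : MemLp f 2 volume)
    (hh : MemLp h 2 volume) :
    ∀ᵐ ξ, (𝓕 (toL2 h) : LTwo) ξ = symbol ξ * (𝓕 (toL2 f) : LTwo) ξ := by
  have := fourier_eq_of_inner_test (toL2 h) (toL2 f) 0 fun φ hφ => by
    have e := H.2.2 φ hφ
    rw [iteratedDeriv_one] at e
    rw [inner_toL2_toL2 (hφ.memLp 2) hh, inner_toL2_toL2 (hφ.deriv.memLp 2) hf, e]
    simp
  filter_upwards [this, Lp.coeFn_zero ℂ 2 (volume : Measure ℝ)] with ξ h1 h2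
  rw [show (𝓕 (0 : LTwo) : LTwo) = 0 from map_zero (Lp.fourierTransformₗᵢ ℝ ℂ), h2] at h1
  simp only [Pi.zero_apply, mul_zero, add_zero] at h1
  exact sub_eq_zero.1 h1

/-- The Fourier transform of a weak derivative; the intermediate derivatives are required to be
square integrable, too. -/
lemma fourier_weakDeriv {n : ℕ} {f : ℝ → ℝ} (hf : MemW n 2 f) : ∀ j ≤ n, ∀ h : ℝ → ℝ,
    IsWeakDeriv j f h → MemLp h 2 volume →
      ∀ᵐ ξ, (𝓕 (toL2 h) : LTwo) ξ = symbol ξ ^ j * (𝓕 (toL2 f) : LTwo) ξ := by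
  intro j
  induction j with
  | zero =>
    intro _ h H _
    have := isWeakDeriv_unique H (isWeakDeriv_zero H.1)
    rw [toL2_congr this]
    simp
  | succ j ih =>
    intro hj h H hh
    obtain ⟨h', H', hh'⟩ := hf j (by omega)
    filter_upwards [ih (by omega) h' H' hh', fourier_weakDeriv_one (H'.of_add H) hh' hh]
      with ξ h1 h2
    rw [h2, h1, pow_succ]
    ring

/-- A real function has a square integrable weak derivative as soon as its Fourier transform has
the corresponding decay; as the function is real, the real part of the inverse transform serves. -/
lemma isWeakDeriv_of_fourier {f : ℝ → ℝ} (hf : MemLp f 2 volume) (j : ℕ) (G : LTwo)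
    (hG : ∀ᵐ ξ, G ξ = symbol ξ ^ j * (𝓕 (toL2 f) : LTwo) ξ) :
    IsWeakDeriv j f (fun x => ((𝓕⁻ G : LTwo) x).re) := by
  have hm : MemLp (fun x => ((𝓕⁻ G : LTwo) x).re) 2 volume := (Lp.memLp (𝓕⁻ G : LTwo)).re
  refine ⟨hf.locallyIntegrable (by norm_num), hm.locallyIntegrable (by norm_num), fun φ hφ => ?_⟩
  have hg₁ : HasCompactSupport (Complex.ofRealCLM ∘ φ) := hφ.2.comp_left rfl
  have hg₂ : ContDiff ℝ ∞ (Complex.ofRealCLM ∘ φ) := by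
    have := hφ.1
    fun_prop
  let Φ : 𝓢(ℝ, ℂ) := hg₁.toSchwartzMap hg₂
  have hΦ : ⇑Φ = Complex.ofRealCLM ∘ φ := rfl
  let e : 𝓢(ℝ, ℂ) := 𝓕⁻ Φ
  have he : 𝓕 e = Φ := FourierTransform.fourier_fourierInv_eq Φ
  have d : ∀ x, iteratedDeriv j (⇑Φ) x = ((iteratedDeriv j φ x : ℝ) : ℂ) := by
    have : ∀ j, iteratedDeriv j (⇑Φ) = fun x => ((iteratedDeriv j φ x : ℝ) : ℂ) := by
      intro j
      induction j with
      | zero => ext x; simp [hΦ]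
      | succ j ih =>
        rw [iteratedDeriv_succ, ih]
        ext x
        rw [iteratedDeriv_succ]
        have := ((hφ.iteratedDeriv j).1.differentiable (by simp) x).hasDerivAt.ofReal_comp
        exact this.deriv
    intro x
    rw [this]
  have h1 : ∫ x, (𝓕 (mulSymbol j e) : 𝓢(ℝ, ℂ)) x * toL2 f x = ((∫ x, f x * iteratedDeriv j φ x : ℝ) : ℂ) := by
    rw [← iteratedDeriv_fourier_schwartz, he, ← integral_complex_ofReal]
    refine integral_congr_ae ?_
    filter_upwards [toL2_coe hf] with x hx
    rw [hx, d, Complex.ofReal_mul, mul_comm]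
  have h2 : ∫ x, (𝓕 (mulSymbol j e) : 𝓢(ℝ, ℂ)) x * toL2 f x =
      (-1) ^ j * ∫ x, (φ x : ℂ) * (𝓕⁻ G : LTwo) x := by
    rw [← fourier_pairing]
    have : ∫ x, (φ x : ℂ) * (𝓕⁻ G : LTwo) x = ∫ x, e x * G x := by
      have := fourier_pairing (𝓕⁻ G : LTwo) e
      rw [FourierTransform.fourier_fourierInv_eq, he] at this
      rw [this]
      rfl
    rw [this, ← integral_const_mul]
    refine integral_congr_ae ?_
    filter_upwards [hG] with ξ hξ
    rw [hξ, mulSymbol_apply, neg_pow]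
    ring
  have int : Integrable (fun x => (φ x : ℂ) * (𝓕⁻ G : LTwo) x) :=
    ((hφ.memLp 2).ofReal (K := ℂ)).integrable_mul (Lp.memLp _)
  have h3 := congrArg Complex.re (h1.symm.trans h2)
  rw [Complex.ofReal_re] at h3
  rw [h3, show ((-1 : ℂ) ^ j) = (((-1 : ℝ) ^ j : ℝ) : ℂ) by simp, Complex.re_ofReal_mul]
  congr 1
  have := integral_re int
  rw [← RCLike.re_eq_complex_re, ← this]
  congr 1
  ext x
  simp [mul_comm]

/-- The Fourier transform of an integrable function is bounded by its `L¹` norm. -/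
lemma norm_fourier_toL2_le {f : ℝ → ℝ} (hf : MemLp f 2 volume) (hf1 : Integrable f) :
    ∀ᵐ ξ, ‖(𝓕 (toL2 f) : LTwo) ξ‖ ≤ ∫ x, ‖f x‖ := by
  let F : ℝ → ℂ := fun x => (f x : ℂ)
  have hF : Integrable F := hf1.ofReal
  have hb : ∀ ξ, ‖𝓕 F ξ‖ ≤ ∫ x, ‖f x‖ := fun ξ => by
    refine (VectorFourier.norm_fourierIntegral_le_integral_norm _ _ _ _ _).trans_eq ?_
    simp [F]
  have hcont : Continuous (𝓕 F) :=
    VectorFourier.fourierIntegral_continuous Real.continuous_fourierChar (by fun_prop) hF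
  have : ∀ᵐ ξ, (𝓕 (toL2 f) : LTwo) ξ = 𝓕 F ξ := by
    refine ae_eq_of_integral_contDiff_smul_eq
      ((Lp.memLp _).locallyIntegrable (by norm_num)) hcont.locallyIntegrable fun g hg hgc => ?_
    have hg₁ : HasCompactSupport (Complex.ofRealCLM ∘ g) := hgc.comp_left rfl
    have hg₂ : ContDiff ℝ ∞ (Complex.ofRealCLM ∘ g) := by fun_prop
    let e : 𝓢(ℝ, ℂ) := hg₁.toSchwartzMap hg₂
    have h1 := fourier_pairing (toL2 f) e
    have h2 : ∫ ξ, (𝓕 (e : ℝ → ℂ)) ξ • F ξ = ∫ x, e x • 𝓕 F x := by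
      simpa using! (VectorFourier.integral_fourierIntegral_smul_eq_flip (L := innerₗ ℝ)
        Real.continuous_fourierChar continuous_inner (SchwartzMap.integrable e) hF)
    have h3 : ∫ x, (𝓕 e : 𝓢(ℝ, ℂ)) x * toL2 f x = ∫ ξ, (𝓕 (e : ℝ → ℂ)) ξ • F ξ := by
      refine integral_congr_ae ?_
      filter_upwards [toL2_coe hf] with x hx
      rw [hx, SchwartzMap.fourier_coe, smul_eq_mul]
    calc _ = ∫ x, e x * (𝓕 (toL2 f) : LTwo) x := rfl
      _ = ∫ x, e x • 𝓕 F x := by rw [h1, h3, h2]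
      _ = _ := rfl
  filter_upwards [this] with ξ hξ
  rw [hξ]
  exact hb ξ

end RealFunctions

/-! ### Frequency bands -/

section Bands

open scoped FourierTransform RealInnerProductSpace

/-- Multiplication by a bounded function on `L²(ℝ)`. -/
noncomputable def mulOp (m : ℝ → ℂ) (hm : MemLp m ∞ volume) : LTwo →L[ℝ] LTwo :=
  ((ContinuousLinearMap.mul ℂ ℂ).holderL volume ∞ 2 2 (hm.toLp m)).restrictScalars ℝ

lemma mulOp_coe {m : ℝ → ℂ} (hm : MemLp m ∞ volume) (f : LTwo) :
    mulOp m hm f =ᵐ[volume] fun ξ => m ξ * f ξ := by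
  have h1 : mulOp m hm f = (ContinuousLinearMap.mul ℂ ℂ).holder 2 (hm.toLp m) f := rfl
  rw [h1]
  filter_upwards [(ContinuousLinearMap.mul ℂ ℂ).coeFn_holder (r := 2) (hm.toLp m) f,
    MemLp.coeFn_toLp hm] with ξ h2 h3
  rw [h2, h3]
  rfl

lemma norm_mulOp_le {m : ℝ → ℂ} (hm : MemLp m ∞ volume) {C : ℝ} (hC : ∀ ξ, ‖m ξ‖ ≤ C)
    (f : LTwo) : ‖mulOp m hm f‖ ≤ C * ‖f‖ := by
  refine Lp.norm_le_mul_norm_of_ae_le_mul ?_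
  filter_upwards [mulOp_coe hm f] with ξ hξ
  rw [hξ, norm_mul]
  gcongr
  exact hC ξ

lemma le_norm_mulOp {m : ℝ → ℂ} (hm : MemLp m ∞ volume) {c : ℝ} (hc : 0 < c)
    (hC : ∀ ξ, c ≤ ‖m ξ‖) (f : LTwo) : c * ‖f‖ ≤ ‖mulOp m hm f‖ := by
  have : ‖f‖ ≤ c⁻¹ * ‖mulOp m hm f‖ := by
    refine Lp.norm_le_mul_norm_of_ae_le_mul ?_
    filter_upwards [mulOp_coe hm f] with ξ hξ
    rw [hξ, norm_mul, inv_mul_eq_div, le_div_iff₀ hc, mul_comm]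
    gcongr
    exact hC ξ
  rwa [inv_mul_eq_div, le_div_iff₀ hc, mul_comm] at this

/-- A set `S` of frequencies and a bounded imaginary function `d` that is the symbol of `∂_x`
on `S`. The values of `d` off `S` are free; they are chosen so as to give `d` bounds from above and
from below on the whole line. -/
structure Band where
  S : Set ℝ
  d : ℝ → ℂ
  measurableSet : MeasurableSet S
  memLp : MemLp d ∞ volume
  eq_symbol : ∀ ξ ∈ S, d ξ = symbol ξ
  re_eq_zero : ∀ ξ, (d ξ).re = 0

lemma memLp_indicator_one {S : Set ℝ} (hS : MeasurableSet S) :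
    MemLp (S.indicator (1 : ℝ → ℂ)) ∞ volume :=
  memLp_top_of_bound ((measurable_one.indicator hS).aestronglyMeasurable) 1
    (Eventually.of_forall fun ξ => by
      by_cases h : ξ ∈ S <;> simp [h])

/-- The orthogonal projection onto the functions supported in `S`. -/
noncomputable def freqProj (S : Set ℝ) (hS : MeasurableSet S) : LTwo →L[ℝ] LTwo :=
  mulOp (S.indicator 1) (memLp_indicator_one hS)

lemma freqProj_coe {S : Set ℝ} (hS : MeasurableSet S) (f : LTwo) :
    freqProj S hS f =ᵐ[volume] S.indicator f := by
  filter_upwards [mulOp_coe (memLp_indicator_one hS) f] with ξ hξ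
  rw [freqProj, hξ]
  by_cases h : ξ ∈ S <;> simp [h]

namespace Band

variable (B : Band)

/-- The derivative on the band, as a bounded operator. -/
noncomputable def D : LTwo →L[ℝ] LTwo := mulOp B.d B.memLp

/-- The part of the Fourier transform in the band. -/
noncomputable def comp : LTwo →L[ℝ] LTwo :=
  freqProj B.S B.measurableSet ∘L
    ((Lp.fourierTransformₗᵢ ℝ ℂ).toContinuousLinearEquiv : LTwo →L[ℂ] LTwo).restrictScalars ℝ

lemma comp_coe (f : LTwo) : B.comp f =ᵐ[volume] B.S.indicator (𝓕 f : LTwo) :=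
  freqProj_coe B.measurableSet _

lemma skew (f g : LTwo) : ⟪B.D f, g⟫ = -⟪f, B.D g⟫ := by
  rw [L2.inner_def, L2.inner_def, ← integral_neg]
  refine integral_congr_ae ?_
  filter_upwards [mulOp_coe B.memLp f, mulOp_coe B.memLp g] with ξ h1 h2
  rw [D, h1, h2, Complex.inner, Complex.inner, map_mul]
  have := B.re_eq_zero ξ
  simp only [Complex.mul_re, Complex.mul_im, Complex.conj_re, Complex.conj_im, this]
  ring

/-- A weak identity on the line becomes an algebraic one in the band. -/
lemma eq_zero_of_inner_test (X Y Z : LTwo)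
    (h : ∀ φ, IsTest φ → inner ℂ (toL2 φ) X + inner ℂ (toL2 (deriv φ)) Y
      + inner ℂ (toL2 (iteratedDeriv 2 φ)) Z = 0) :
    B.comp X - B.D (B.comp Y) + B.D (B.D (B.comp Z)) = 0 := by
  have hw := fourier_eq_of_inner_test X Y Z h
  refine Lp.ext ?_
  filter_upwards [hw, B.comp_coe X, B.comp_coe Y, B.comp_coe Z, mulOp_coe B.memLp (B.comp Y),
    mulOp_coe B.memLp (B.comp Z), mulOp_coe B.memLp (B.D (B.comp Z)),
    Lp.coeFn_add (B.comp X - B.D (B.comp Y)) (B.D (B.D (B.comp Z))),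
    Lp.coeFn_sub (B.comp X) (B.D (B.comp Y)), Lp.coeFn_zero ℂ 2 (volume : Measure ℝ)]
    with ξ h0 h1 h2 h3 h4 h5 h6 h7 h8 h9
  rw [h7, h9, Pi.add_apply, h8, Pi.sub_apply]
  rw [← D] at h4 h5 h6
  rw [h1, h4, h6, h5, h2, h3]
  by_cases hξ : ξ ∈ B.S
  · simp only [hξ, indicator_of_mem, B.eq_symbol ξ hξ, Pi.zero_apply]
    rw [← h0]
    ring
  · simp [hξ]

/-- A weak evolution equation on the line is a genuine differential equation in the band. -/
theorem hasDerivAt_comp {a b₀ b₁ b₂ : ℝ → LTwo} (h₀ : ContinuousOn b₀ (Ici 0))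
    (h₁ : ContinuousOn b₁ (Ici 0)) (h₂ : ContinuousOn b₂ (Ici 0))
    (h : ∀ φ, IsTest φ → ∀ t > 0, HasDerivAt (fun t => inner ℂ (toL2 φ) (a t))
      (inner ℂ (toL2 φ) (b₀ t) + inner ℂ (toL2 (deriv φ)) (b₁ t)
        + inner ℂ (toL2 (iteratedDeriv 2 φ)) (b₂ t)) t) {t : ℝ} (ht : 0 < t) :
    HasDerivAt (fun t => B.comp (a t))
      (B.comp (b₀ t) - B.D (B.comp (b₁ t)) + B.D (B.D (B.comp (b₂ t)))) t := by
  let T : LTwo →L[ℝ] LTwo := B.D ∘L B.comp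
  let T' : LTwo →L[ℝ] LTwo := B.D ∘L B.D ∘L B.comp
  let G : ℝ → LTwo := fun t => B.comp (b₀ t) - T (b₁ t) + T' (b₂ t)
  have hG : ContinuousOn G (Ici 0) :=
    ((B.comp.continuous.comp_continuousOn h₀).sub (T.continuous.comp_continuousOn h₁)).add
      (T'.continuous.comp_continuousOn h₂)
  have sub : ∀ r > 0, uIcc t r ⊆ Ici 0 := fun r hr x hx => by
    rw [mem_uIcc] at hx
    rcases hx with hx | hx
    · exact ht.le.trans hx.1
    · exact hr.le.trans hx.1
  have key : ∀ r > 0, B.comp (a r) = B.comp (a t) + ∫ τ in t..r, G τ := by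
    intro r hr
    have i0 := (h₀.mono (sub r hr)).intervalIntegrable (μ := volume)
    have i1 := (h₁.mono (sub r hr)).intervalIntegrable (μ := volume)
    have i2 := (h₂.mono (sub r hr)).intervalIntegrable (μ := volume)
    have inner_int : ∀ (φ : LTwo) {b : ℝ → LTwo}, IntervalIntegrable b volume t r →
        ∫ τ in t..r, inner ℂ φ (b τ) = inner ℂ φ (∫ τ in t..r, b τ) := fun φ b hb =>
      (innerSL ℂ φ).intervalIntegral_comp_comm hb
    have inner_ii : ∀ (φ : LTwo) {b : ℝ → LTwo}, IntervalIntegrable b volume t r →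
        IntervalIntegrable (fun τ => (inner ℂ φ (b τ) : ℂ)) volume t r := fun φ b hb =>
      ⟨(innerSL ℂ φ).integrable_comp hb.1, (innerSL ℂ φ).integrable_comp hb.2⟩
    have hz := B.eq_zero_of_inner_test (a r - a t - ∫ τ in t..r, b₀ τ) (-∫ τ in t..r, b₁ τ)
      (-∫ τ in t..r, b₂ τ) fun φ hφ => by
      have := intervalIntegral.integral_eq_sub_of_hasDerivAt (a := t) (b := r)
        (fun x hx => h φ hφ x (by
          rw [mem_uIcc] at hx
          rcases hx with hx | hx
          · exact ht.trans_le hx.1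
          · exact hr.trans_le hx.1))
        (((inner_ii _ i0).add (inner_ii _ i1)).add (inner_ii _ i2))
      rw [intervalIntegral.integral_add ((inner_ii _ i0).add (inner_ii _ i1)) (inner_ii _ i2),
        intervalIntegral.integral_add (inner_ii _ i0) (inner_ii _ i1), inner_int _ i0,
        inner_int _ i1, inner_int _ i2] at this
      rw [inner_sub_right, inner_sub_right, inner_neg_right, inner_neg_right, ← this]
      ring
    have hGi : ∫ τ in t..r, G τ = B.comp (∫ τ in t..r, b₀ τ) - T (∫ τ in t..r, b₁ τ)
        + T' (∫ τ in t..r, b₂ τ) := by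
      have ii : ∀ (T : LTwo →L[ℝ] LTwo) {b : ℝ → LTwo}, IntervalIntegrable b volume t r →
          IntervalIntegrable (fun τ => T (b τ)) volume t r := fun T b hb =>
        ⟨T.integrable_comp hb.1, T.integrable_comp hb.2⟩
      rw [← B.comp.intervalIntegral_comp_comm i0, ← T.intervalIntegral_comp_comm i1,
        ← T'.intervalIntegral_comp_comm i2, ← intervalIntegral.integral_sub (ii _ i0) (ii _ i1),
        ← intervalIntegral.integral_add ((ii _ i0).sub (ii _ i1)) (ii _ i2)]
    rw [hGi]
    simp only [map_sub, map_neg] at hz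
    change B.comp (a r) = _ + (_ - B.D (B.comp _) + B.D (B.D (B.comp _)))
    rw [← sub_eq_zero, ← hz]
    abel
  have hd : HasDerivAt (fun r => B.comp (a t) + ∫ τ in t..r, G τ) (G t) t := by
    refine HasDerivAt.const_add _ ?_
    have hat : ∀ᶠ x in 𝓝 t, ContinuousAt G x := by
      filter_upwards [Ioi_mem_nhds ht] with x hx
      exact hG.continuousAt (Ici_mem_nhds hx)
    exact intervalIntegral.integral_hasDerivAt_right (by simp)
      (hG.mono Ioi_subset_Ici_self |>.stronglyMeasurableAtFilter isOpen_Ioi t ht)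
      hat.self_of_nhds
  refine hd.congr_of_eventuallyEq ?_
  filter_upwards [Ioi_mem_nhds ht] with r hr
  exact key r hr

end Band

end Bands

/-! ### The memory kernel -/

section Kernel

/-- What the assumptions on the memory kernel give: it is positive and decays at rates between `k₂`
and `k₁`. -/
structure MemoryKernel (g : ℝ → ℝ) (k₁ k₂ : ℝ) : Prop where
  k₁_pos : 0 < k₁
  k₂_pos : 0 < k₂
  pos : ∀ s > 0, 0 < g s
  upper : ∀ s > 0, ∀ h ≥ 0, g (s + h) ≤ Real.exp (-k₂ * h) * g s
  lower : ∀ s > 0, ∀ h ≥ 0, Real.exp (-k₁ * h) * g s ≤ g (s + h)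
  differentiable : ∀ s > 0, DifferentiableAt ℝ g s
  abs_deriv_le : ∀ s > 0, |deriv g s| ≤ k₁ * g s
  integrableOn : IntegrableOn g (Ioi 0)

/-- One-sided Gronwall inequality on the open half line, where `g` need not extend to `0`. -/
lemma exp_mul_le_of_deriv {g : ℝ → ℝ} (hd : ∀ s > 0, DifferentiableAt ℝ g s) {k : ℝ}
    (h : ∀ s > 0, deriv g s ≤ -k * g s) : ∀ s > 0, ∀ r ≥ 0, g (s + r) ≤ Real.exp (-k * r) * g s := by
  have hder : ∀ s > 0, HasDerivAt (fun s => Real.exp (k * s) * g s)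
      (Real.exp (k * s) * (k * g s + deriv g s)) s := fun s hs => by
    have h1 : HasDerivAt (fun s => Real.exp (k * s)) (Real.exp (k * s) * (k * 1)) s :=
      ((hasDerivAt_id s).const_mul k).exp
    exact (h1.mul (hd s hs).hasDerivAt).congr_deriv (by ring)
  have hanti : AntitoneOn (fun s => Real.exp (k * s) * g s) (Ioi 0) := by
    refine antitoneOn_of_deriv_nonpos (convex_Ioi 0)
      (fun s hs => (hder s hs).continuousAt.continuousWithinAt)
      (fun s hs => (hder s (interior_subset hs)).differentiableAt.differentiableWithinAt) ?_
    intro s hs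
    have hs : 0 < s := interior_subset hs
    rw [(hder s hs).deriv]
    exact mul_nonpos_of_nonneg_of_nonpos (Real.exp_nonneg _) (by linarith [h s hs])
  intro s hs r hr
  have := hanti (mem_Ioi.2 hs) (mem_Ioi.2 (by linarith : 0 < s + r)) (by linarith)
  simp only at this
  have e : Real.exp (k * (s + r)) = Real.exp (k * s) * Real.exp (k * r) := by
    rw [← Real.exp_add]; ring_nf
  rw [e, mul_assoc] at this
  have h2 := le_of_mul_le_mul_left this (Real.exp_pos _)
  rw [neg_mul, Real.exp_neg, inv_mul_eq_div, le_div_iff₀ (Real.exp_pos _), mul_comm]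
  exact h2

/-- An admissible kernel that is positive at one point is positive everywhere, and it is integrable:
the lower bound on `g'` keeps it bounded near `0`, the upper bound makes it decay at infinity. -/
lemma Coeffs.Admissible.exists_memoryKernel {P : Coeffs} (hP : P.Admissible) :
    ∃ k₁ k₂, MemoryKernel P.g k₁ k₂ := by
  obtain ⟨k₁, hk₁, k₂, hk₂, hk⟩ := hP.g_decay
  have hd := hP.g_differentiable
  have upper := exp_mul_le_of_deriv hd (k := k₂) fun s hs => (hk s hs).2
  have lower : ∀ s > 0, ∀ r ≥ 0, Real.exp (-k₁ * r) * P.g s ≤ P.g (s + r) := by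
    have := exp_mul_le_of_deriv (g := fun s => -P.g s) (fun s hs => (hd s hs).neg) (k := k₁)
      fun s hs => by
        rw [deriv.fun_neg]
        linarith [(hk s hs).1]
    intro s hs r hr
    linarith [this s hs r hr]
  have pos : ∀ s > 0, 0 < P.g s := by
    obtain ⟨s₀, hs₀, hne⟩ := hP.g_ne_zero
    have h0 : 0 < P.g s₀ := lt_of_le_of_ne (hP.g_nonneg s₀ hs₀) hne.symm
    intro s hs
    rcases le_total s s₀ with h | h
    · have := upper s hs (s₀ - s) (by linarith)
      rw [add_sub_cancel] at this
      exact pos_of_mul_pos_right (h0.trans_le this) (Real.exp_nonneg _)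
    · have := lower s₀ hs₀ (s - s₀) (by linarith)
      rw [add_sub_cancel] at this
      exact lt_of_lt_of_le (by positivity) this
  refine ⟨k₁, k₂, hk₁, hk₂, pos, upper, lower, hd, fun s hs => ?_, ?_⟩
  · rw [abs_le]
    exact ⟨by linarith [(hk s hs).1], by nlinarith [(hk s hs).2, pos s hs]⟩
  · have hcont : ContinuousOn P.g (Ioi 0) := fun s hs => (hd s hs).continuousAt.continuousWithinAt
    have hb : ∀ s > 0, P.g s ≤ Real.exp k₁ * P.g 1 * Real.exp k₂ * Real.exp (-k₂ * s) := by
      intro s hs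
      have hg1 := pos 1 one_pos
      rcases le_total s 1 with h | h
      · have := lower s hs (1 - s) (by linarith)
        rw [add_sub_cancel] at this
        have e1 : Real.exp (-k₁) ≤ Real.exp (-k₁ * (1 - s)) := Real.exp_le_exp.2 (by nlinarith)
        have e2 : P.g s ≤ Real.exp k₁ * P.g 1 := by
          have := (mul_le_mul_of_nonneg_right e1 (pos s hs).le).trans this
          rwa [Real.exp_neg, inv_mul_eq_div, div_le_iff₀ (Real.exp_pos _), mul_comm] at this
        rw [mul_assoc, ← Real.exp_add]
        refine e2.trans (le_mul_of_one_le_right (by positivity) (Real.one_le_exp ?_))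
        nlinarith
      · have := upper 1 one_pos (s - 1) (by linarith)
        rw [add_sub_cancel] at this
        have e : Real.exp k₂ * Real.exp (-k₂ * s) = Real.exp (-k₂ * (s - 1)) := by
          rw [← Real.exp_add]; ring_nf
        calc P.g s ≤ Real.exp (-k₂ * (s - 1)) * P.g 1 := this
          _ ≤ Real.exp k₁ * (Real.exp (-k₂ * (s - 1)) * P.g 1) :=
            le_mul_of_one_le_left (by positivity) (Real.one_le_exp hk₁.le)
          _ = _ := by rw [← e]; ring
    have hi : IntegrableOn (fun s => Real.exp k₁ * P.g 1 * Real.exp k₂ * Real.exp (-k₂ * s)) (Ioi 0) :=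
      (exp_neg_integrableOn_Ioi 0 hk₂).const_mul _
    refine hi.mono' (hcont.aestronglyMeasurable measurableSet_Ioi) ?_
    filter_upwards [ae_restrict_mem measurableSet_Ioi] with s hs
    rw [Real.norm_eq_abs, abs_of_pos (pos s hs)]
    exact hb s hs

namespace MemoryKernel

variable {g : ℝ → ℝ} {k₁ k₂ : ℝ} (hg : MemoryKernel g k₁ k₂)
include hg

lemma continuousOn : ContinuousOn g (Ioi 0) := fun s hs =>
  (hg.differentiable s hs).continuousAt.continuousWithinAt

lemma aemeasurable : AEMeasurable g (volume.restrict (Ioi 0)) :=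
  (hg.continuousOn.aestronglyMeasurable measurableSet_Ioi).aemeasurable

lemma antitone {s r : ℝ} (hs : 0 < s) (hr : s ≤ r) : g r ≤ g s := by
  have := hg.upper s hs (r - s) (by linarith)
  rw [add_sub_cancel] at this
  refine this.trans (mul_le_of_le_one_left (hg.pos s hs).le (Real.exp_le_one_iff.2 ?_))
  nlinarith [hg.k₂_pos]

lemma exists_bound : ∃ G ≥ 0, ∀ s > 0, g s ≤ G := by
  have h1 := hg.pos 1 one_pos
  refine ⟨Real.exp k₁ * g 1, by positivity, fun s hs => ?_⟩
  rcases le_total s 1 with h | h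
  · have := hg.lower s hs (1 - s) (by linarith)
    rw [add_sub_cancel] at this
    have e1 : Real.exp (-k₁) ≤ Real.exp (-k₁ * (1 - s)) :=
      Real.exp_le_exp.2 (by nlinarith [hg.k₁_pos])
    have := (mul_le_mul_of_nonneg_right e1 (hg.pos s hs).le).trans this
    rwa [Real.exp_neg, inv_mul_eq_div, div_le_iff₀ (Real.exp_pos _), mul_comm] at this
  · exact (hg.antitone one_pos h).trans
      (le_mul_of_one_le_left h1.le (Real.one_le_exp hg.k₁_pos.le))

/-- The difference quotients of the kernel are dominated by the kernel. -/
lemma abs_sub_le {s r : ℝ} (hs : 0 < s) (hr : 0 ≤ r) : |g (s + r) - g s| ≤ k₁ * r * g s := by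
  have h1 := hg.antitone hs (by linarith : s ≤ s + r)
  have h2 := hg.lower s hs r hr
  have h3 := Real.add_one_le_exp (-k₁ * r)
  have := hg.pos s hs
  rw [abs_sub_comm, abs_of_nonneg (by linarith)]
  nlinarith

lemma integral_pos : 0 < ∫ s in Ioi (0 : ℝ), g s := by
  rw [setIntegral_pos_iff_support_of_nonneg_ae]
  · have : Function.support g ∩ Ioi 0 = Ioi 0 :=
      inter_eq_right.2 fun s hs => (hg.pos s hs).ne'
    rw [this]
    simp
  · filter_upwards [ae_restrict_mem measurableSet_Ioi] with s hs using (hg.pos s hs).le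
  · exact hg.integrableOn

end MemoryKernel

/-- The measure `g(s) ds` on the half line. -/
noncomputable def kernelMeasure (g : ℝ → ℝ) : Measure ℝ :=
  (volume.restrict (Ioi 0)).withDensity fun s => ENNReal.ofReal (g s)

lemma kernelMeasure_eq (g : ℝ → ℝ) : kernelMeasure g =
    (volume.restrict (Ioi 0)).withDensity fun s => ((g s).toNNReal : ℝ≥0∞) := rfl

namespace MemoryKernel

variable {g : ℝ → ℝ} {k₁ k₂ : ℝ} (hg : MemoryKernel g k₁ k₂)
include hg

/-- The kernel is positive, so `kernelMeasure g` and Lebesgue measure have the same null sets. -/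
lemma ae_iff {p : ℝ → Prop} :
    (∀ᵐ s ∂(kernelMeasure g), p s) ↔ ∀ᵐ s ∂(volume.restrict (Ioi (0 : ℝ))), p s := by
  rw [kernelMeasure, ae_withDensity_iff' hg.aemeasurable.ennreal_ofReal]
  refine eventually_congr ?_
  filter_upwards [ae_restrict_mem measurableSet_Ioi] with s hs
  have : ENNReal.ofReal (g s) ≠ 0 := by simpa using hg.pos s hs
  simp [this]

lemma absolutelyContinuous : volume.restrict (Ioi (0 : ℝ)) ≪ kernelMeasure g :=
  Measure.ae_le_iff_absolutelyContinuous.1 fun _ h => hg.ae_iff.1 h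

lemma integral_eq {E : Type*} [NormedAddCommGroup E] [NormedSpace ℝ E] (f : ℝ → E) :
    ∫ s, f s ∂(kernelMeasure g) = ∫ s in Ioi (0 : ℝ), g s • f s := by
  rw [kernelMeasure_eq, integral_withDensity_eq_integral_smul₀ hg.aemeasurable.real_toNNReal]
  refine integral_congr_ae ?_
  filter_upwards [ae_restrict_mem measurableSet_Ioi] with s hs
  rw [NNReal.smul_def, Real.coe_toNNReal _ (hg.pos s hs).le]

lemma integrable_iff {E : Type*} [NormedAddCommGroup E] [NormedSpace ℝ E] {f : ℝ → E} :
    Integrable f (kernelMeasure g) ↔ IntegrableOn (fun s => g s • f s) (Ioi 0) := by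
  rw [kernelMeasure_eq, integrable_withDensity_iff_integrable_smul₀ hg.aemeasurable.real_toNNReal]
  refine integrable_congr ?_
  filter_upwards [ae_restrict_mem measurableSet_Ioi] with s hs
  rw [NNReal.smul_def, Real.coe_toNNReal _ (hg.pos s hs).le]

lemma isFiniteMeasure : IsFiniteMeasure (kernelMeasure g) := by
  refine isFiniteMeasure_withDensity ?_
  have := hg.integrableOn.lintegral_lt_top
  exact this.ne

end MemoryKernel

end Kernel

/-! ### Transport of the history -/

section History

open scoped RealInnerProductSpace

variable {E : Type*} [NormedAddCommGroup E]

lemma integral_norm_le_sqrt_mul {μ : Measure ℝ} [IsFiniteMeasure μ] (G : Lp E 2 μ) :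
    ∫ s, ‖G s‖ ∂μ ≤ √(μ.real univ) * ‖G‖ := by
  have h1 := (Lp.memLp G).integrable one_le_two
  rw [integral_norm_eq_lintegral_enorm h1.1, ← eLpNorm_one_eq_lintegral_enorm]
  have h2 := eLpNorm_le_eLpNorm_mul_rpow_measure_univ (μ := μ) (p := 1) (q := 2) (f := G)
    one_le_two h1.1
  have h3 := ENNReal.toReal_mono (ENNReal.mul_ne_top (Lp.memLp G).2.ne
    (ENNReal.rpow_ne_top_of_nonneg (by norm_num) (measure_ne_top μ univ))) h2
  refine h3.trans (le_of_eq ?_)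
  rw [ENNReal.toReal_mul, Lp.norm_def, mul_comm, ← ENNReal.toReal_rpow, Real.sqrt_eq_rpow,
    Measure.real]
  norm_num

lemma integrable_coe {μ : Measure ℝ} [IsFiniteMeasure μ] (G : Lp E 2 μ) : Integrable G μ :=
  (Lp.memLp G).integrable one_le_two

lemma integrable_norm_sq {μ : Measure ℝ} (G : Lp E 2 μ) : Integrable (fun s => ‖G s‖ ^ 2) μ :=
  (memLp_two_iff_integrable_sq_norm (Lp.memLp G).1).1 (Lp.memLp G)

variable [InnerProductSpace ℝ E]

lemma norm_sq_eq_integral {μ : Measure ℝ} (G : Lp E 2 μ) : ‖G‖ ^ 2 = ∫ s, ‖G s‖ ^ 2 ∂μ := by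
  rw [← real_inner_self_eq_norm_sq, L2.inner_def]
  simp only [real_inner_self_eq_norm_sq]

lemma IsTest.exists_support_bound {ψ : ℝ → ℝ} (hψ : IsTest ψ) :
    ∃ M > 0, ∀ s, M < s → ψ s = 0 := by
  obtain ⟨M, hM⟩ := hψ.2.isCompact.bddAbove
  refine ⟨max M 1, by positivity, fun s hs => image_eq_zero_of_notMem_tsupport fun h => ?_⟩
  linarith [hM h, le_max_left M 1]

lemma IsTest.exists_bound {ψ : ℝ → ℝ} (hψ : IsTest ψ) : ∃ C ≥ 0, ∀ s, |ψ s| ≤ C := by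
  obtain ⟨C, hC⟩ := hψ.2.exists_bound_of_continuous hψ.1.continuous
  exact ⟨max C 0, le_max_right _ _, fun s => (hC s).trans (le_max_left _ _)⟩

lemma MemoryKernel.integrableOn_Ioc {g : ℝ → ℝ} {k₁ k₂ : ℝ} (hg : MemoryKernel g k₁ k₂)
    (G : Lp E 2 (kernelMeasure g)) (M : ℝ) : IntegrableOn G (Ioc 0 M) := by
  have := hg.isFiniteMeasure
  rcases le_or_gt M 0 with hM | hM
  · rw [Ioc_eq_empty (by linarith)]
    exact integrableOn_empty
  have h1 := (hg.integrable_iff.1 (integrable_coe G)).mono_set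
    (Ioc_subset_Ioi_self : Ioc 0 M ⊆ Ioi 0)
  have h2 : AEStronglyMeasurable G (volume.restrict (Ioc 0 M)) :=
    ((Lp.aestronglyMeasurable G).mono_ac hg.absolutelyContinuous).mono_measure
      (Measure.restrict_mono Ioc_subset_Ioi_self le_rfl)
  refine (h1.norm.const_mul (g M)⁻¹).mono' h2 ?_
  filter_upwards [ae_restrict_mem measurableSet_Ioc] with s hs
  have := hg.antitone hs.1 hs.2
  have hgM := hg.pos M hM
  rw [norm_smul, Real.norm_eq_abs, abs_of_pos (hg.pos s hs.1), ← mul_assoc]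
  refine le_mul_of_one_le_left (norm_nonneg _) ?_
  rw [inv_mul_eq_div, one_le_div hgM]
  exact this

/-- On bounded intervals the kernel is bounded below, so weighted square integrability controls the
plain integral. -/
lemma MemoryKernel.exists_setIntegral_Ioc_le {g : ℝ → ℝ} {k₁ k₂ : ℝ} (hg : MemoryKernel g k₁ k₂)
    (M : ℝ) : ∃ C ≥ 0, ∀ G : Lp E 2 (kernelMeasure g), ∫ s in Ioc 0 M, ‖G s‖ ≤ C * ‖G‖ := by
  have := hg.isFiniteMeasure
  rcases le_or_gt M 0 with hM | hM
  · exact ⟨0, le_rfl, fun G => by rw [Ioc_eq_empty (by linarith)]; simp⟩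
  have hgM := hg.pos M hM
  refine ⟨(g M)⁻¹ * √((kernelMeasure g).real univ), by positivity, fun G => ?_⟩
  rw [mul_assoc]
  refine le_trans ?_ (mul_le_mul_of_nonneg_left (integral_norm_le_sqrt_mul G) (by positivity))
  rw [hg.integral_eq, ← integral_const_mul]
  have h1 : IntegrableOn (fun s => g s • ‖G s‖) (Ioi 0) :=
    hg.integrable_iff.1 (integrable_coe G).norm
  have h2 : IntegrableOn (fun s => (g M)⁻¹ * g s • ‖G s‖) (Ioi 0) := Integrable.const_mul h1 _
  refine (setIntegral_mono_on (hg.integrableOn_Ioc G M).norm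
    (h2.mono_set Ioc_subset_Ioi_self) measurableSet_Ioc ?_).trans
    (setIntegral_mono_set h2 ?_ Ioc_subset_Ioi_self.eventuallyLE)
  · intro s hs
    have := hg.antitone hs.1 hs.2
    rw [smul_eq_mul, ← mul_assoc]
    refine le_mul_of_one_le_left (norm_nonneg _) ?_
    rw [inv_mul_eq_div, one_le_div hgM]
    exact this
  · filter_upwards [ae_restrict_mem measurableSet_Ioi] with s hs
    have := (hg.pos s hs).le
    simp only [Pi.zero_apply, smul_eq_mul]
    positivity

/-- A continuous curve `G` of histories in `L²(g(s) ds; E)` that solves `∂_t G + ∂_s G = c`,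
`G(t, 0) = 0` in the weak sense in `s`. -/
structure MemoryFlow (g : ℝ → ℝ) (G : ℝ → Lp E 2 (kernelMeasure g)) (c : ℝ → E) : Prop where
  cont : ContinuousOn G (Ici 0)
  cont_c : ContinuousOn c (Ici 0)
  transport : ∀ ψ, IsTest ψ → ∀ t > 0,
    HasDerivAt (fun τ => ∫ s in Ioi (0 : ℝ), ψ s • G τ s)
      ((∫ s in Ioi (0 : ℝ), deriv ψ s • G t s) + (∫ s in Ioi (0 : ℝ), ψ s) • c t) t

lemma IsTest.comp_add {ψ : ℝ → ℝ} (hψ : IsTest ψ) (σ : ℝ) : IsTest fun s => ψ (s + σ) :=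
  ⟨hψ.1.comp (contDiff_id.add contDiff_const),
    hψ.2.comp_homeomorph (Homeomorph.addRight σ)⟩

lemma IsTest.integrable {ψ : ℝ → ℝ} (hψ : IsTest ψ) : Integrable ψ :=
  hψ.1.continuous.integrable_of_hasCompactSupport hψ.2

variable {g : ℝ → ℝ} {k₁ k₂ : ℝ}

lemma setIntegral_test_smul_eq {ψ : ℝ → ℝ} {M : ℝ} (hM : 0 ≤ M) (hψM : ∀ s, M < s → ψ s = 0)
    (f : ℝ → E) : ∫ s in Ioi (0 : ℝ), ψ s • f s = ∫ s in Ioc 0 M, ψ s • f s := by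
  rw [← Ioc_union_Ioi_eq_Ioi hM]
  refine setIntegral_eq_of_subset_of_forall_sdiff_eq_zero
    (measurableSet_Ioc.union measurableSet_Ioi) subset_union_left ?_
  rintro s ⟨hs | hs, hs'⟩
  · exact absurd hs hs'
  · rw [hψM s hs, zero_smul]

lemma MemoryKernel.integrable_test_smul (hg : MemoryKernel g k₁ k₂) {ψ : ℝ → ℝ} (hψ : IsTest ψ)
    (G : Lp E 2 (kernelMeasure g)) : IntegrableOn (fun s => ψ s • G s) (Ioi 0) := by
  obtain ⟨M, hM0, hM⟩ := hψ.exists_support_bound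
  obtain ⟨C, hC0, hC⟩ := hψ.exists_bound
  have h1 : IntegrableOn (fun s => ψ s • G s) (Ioc 0 M) :=
    (hg.integrableOn_Ioc G M).bdd_smul C hψ.1.continuous.aestronglyMeasurable
      (Eventually.of_forall hC)
  refine h1.of_forall_sdiff_eq_zero measurableSet_Ioi ?_
  rintro s ⟨hs, hs'⟩
  rw [hM s (by by_contra h; exact hs' ⟨hs, not_lt.1 h⟩), zero_smul]

lemma IsTest.hasDerivAt_comp_sub {ψ : ℝ → ℝ} (hψ : IsTest ψ) (s T τ : ℝ) :
    HasDerivAt (fun τ => ψ (s + (T - τ))) (-_root_.deriv ψ (s + (T - τ))) τ := by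
  have h1 : HasDerivAt ψ (_root_.deriv ψ (s + (T - τ))) (s + (T - τ)) :=
    (hψ.1.differentiable (by simp)).differentiableAt.hasDerivAt
  have h2 : HasDerivAt (fun τ => s + (T - τ)) (-1) τ :=
    ((hasDerivAt_id τ).const_sub T).const_add s
  exact (h1.comp τ h2).congr_deriv (by ring)

/-- For a fixed history, a translation of the test function is differentiated under the integral. -/
lemma MemoryKernel.hasDerivAt_integral_comp_sub (hg : MemoryKernel g k₁ k₂) {ψ : ℝ → ℝ}
    (hψ : IsTest ψ) (G : Lp E 2 (kernelMeasure g)) (T τ : ℝ) :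
    HasDerivAt (fun τ => ∫ s in Ioi (0 : ℝ), ψ (s + (T - τ)) • G s)
      (-∫ s in Ioi (0 : ℝ), deriv ψ (s + (T - τ)) • G s) τ := by
  obtain ⟨M, hM0, hM⟩ := hψ.deriv.exists_support_bound
  obtain ⟨C, hC0, hC⟩ := hψ.deriv.exists_bound
  rw [← integral_neg]
  set M' := |M + 1 - (T - τ)| with hM'
  have hb : Integrable (fun s => (Ioc 0 M').indicator (fun s => C * ‖G s‖) s)
      (volume.restrict (Ioi 0)) :=
    ((integrable_indicator_iff measurableSet_Ioc).2
      ((hg.integrableOn_Ioc G M').norm.const_mul C)).restrict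
  refine (hasDerivAt_integral_of_dominated_loc_of_deriv_le (Metric.ball_mem_nhds τ one_pos)
    (F' := fun τ s => -(deriv ψ (s + (T - τ)) • G s)) ?_ ?_ ?_ ?_ hb ?_).2
  · exact Eventually.of_forall fun τ' => (hg.integrable_test_smul (hψ.comp_add _) G).1
  · exact hg.integrable_test_smul (hψ.comp_add _) G
  · exact (hg.integrable_test_smul (hψ.deriv.comp_add _) G).1.neg
  · filter_upwards [ae_restrict_mem measurableSet_Ioi] with s hs τ' hτ'
    rw [Metric.mem_ball, Real.dist_eq, abs_lt] at hτ'
    by_cases h : s ∈ Ioc 0 M'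
    · rw [indicator_of_mem h, norm_neg, norm_smul]
      gcongr
      exact hC _
    · rw [indicator_of_notMem h, hM, zero_smul, neg_zero, norm_zero]
      have h1 : M' < s := by
        by_contra hc
        exact h ⟨hs, not_lt.1 hc⟩
      have := le_abs_self (M + 1 - (T - τ))
      linarith
  · refine Eventually.of_forall fun s τ' _ => ?_
    have := (hψ.hasDerivAt_comp_sub s T τ').smul_const (G s)
    rwa [neg_smul] at this

namespace MemoryFlow

variable {G : ℝ → Lp E 2 (kernelMeasure g)} {c : ℝ → E}

/-- Along a characteristic the transport terms cancel: a test function that moves with the flow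
sees only the source. -/
lemma hasDerivAt_moving (hf : MemoryFlow g G c) (hg : MemoryKernel g k₁ k₂) {ψ : ℝ → ℝ}
    (hψ : IsTest ψ) (T : ℝ) {τ : ℝ} (hτ : 0 < τ) :
    HasDerivAt (fun τ => ∫ s in Ioi (0 : ℝ), ψ (s + (T - τ)) • G τ s)
      ((∫ s in Ioi (0 : ℝ), ψ (s + (T - τ))) • c τ) τ := by
  have h1 := hf.transport _ (hψ.comp_add (T - τ)) τ hτ
  have h2 := hg.hasDerivAt_integral_comp_sub hψ (G τ) T τ
  obtain ⟨C, hC0, hC⟩ := hψ.deriv.exists_bound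
  obtain ⟨M, hM0, hM⟩ := hψ.exists_support_bound
  set M' := |M + 1 - (T - τ)| with hM'
  obtain ⟨C', hC'0, hC'⟩ := hg.exists_setIntegral_Ioc_le (E := E) M'
  have hlip : ∀ a b, |ψ a - ψ b| ≤ C * |a - b| := fun a b =>
    convex_univ.norm_image_sub_le_of_norm_deriv_le (f := ψ)
      (fun x _ => (hψ.1.differentiable (by simp)).differentiableAt) (fun x _ => hC x)
      (mem_univ b) (mem_univ a)
  -- the mixed second difference is of higher order since `G` is continuous in norm
  have h3 : HasDerivAt (fun τ' => ∫ s in Ioi (0 : ℝ),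
      (ψ (s + (T - τ')) - ψ (s + (T - τ))) • (G τ' s - G τ s)) (0 : E) τ := by
    rw [hasDerivAt_iff_isLittleO]
    simp only [sub_self, smul_zero, integral_zero, sub_zero]
    have hcont : Tendsto (fun τ' => C * C' * ‖G τ' - G τ‖) (𝓝 τ) (𝓝 0) := by
      have : Tendsto (fun τ' => C * C' * ‖G τ' - G τ‖) (𝓝 τ) (𝓝 (C * C' * ‖G τ - G τ‖)) :=
        (((hf.cont.continuousAt (Ici_mem_nhds hτ)).sub continuousAt_const).norm).const_mul _
      simpa using this
    rw [Asymptotics.isLittleO_iff]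
    intro ε hε
    filter_upwards [Metric.ball_mem_nhds τ one_pos, hcont.eventually (gt_mem_nhds hε)]
      with τ' hτ' hsmall
    rw [Metric.mem_ball, Real.dist_eq, abs_lt] at hτ'
    have hz : ∀ s, M' < s → ψ (s + (T - τ')) - ψ (s + (T - τ)) = 0 := by
      intro s hs
      have := le_abs_self (M + 1 - (T - τ))
      rw [hM _ (by linarith), hM _ (by linarith), sub_zero]
    rw [setIntegral_test_smul_eq (abs_nonneg _) hz]
    have hae : ∀ᵐ s ∂(volume.restrict (Ioc 0 M')), (G τ' - G τ : Lp E 2 _) s = G τ' s - G τ s :=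
      ae_mono (Measure.restrict_mono Ioc_subset_Ioi_self le_rfl)
        (hg.ae_iff.1 (Lp.coeFn_sub (G τ') (G τ)))
    calc ‖∫ s in Ioc 0 M', (ψ (s + (T - τ')) - ψ (s + (T - τ))) • (G τ' s - G τ s)‖
        ≤ ∫ s in Ioc 0 M', (C * |τ' - τ|) * ‖(G τ' - G τ : Lp E 2 _) s‖ := by
          refine norm_integral_le_of_norm_le ((hg.integrableOn_Ioc _ M').norm.const_mul _) ?_
          filter_upwards [hae] with s hs
          rw [hs, norm_smul]
          refine mul_le_mul_of_nonneg_right ((hlip _ _).trans (le_of_eq ?_)) (norm_nonneg _)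
          rw [← abs_neg (τ' - τ)]
          congr 2
          ring
      _ ≤ (C * |τ' - τ|) * (C' * ‖G τ' - G τ‖) := by
          rw [integral_const_mul]
          exact mul_le_mul_of_nonneg_left (hC' _) (by positivity)
      _ = (C * C' * ‖G τ' - G τ‖) * ‖τ' - τ‖ := by rw [Real.norm_eq_abs]; ring
      _ ≤ ε * ‖τ' - τ‖ := by gcongr
  have h4 := (h1.add h2).add h3
  have hsum : ∀ τ', (∫ s in Ioi (0 : ℝ), ψ (s + (T - τ')) • G τ' s)
      = ((∫ s in Ioi (0 : ℝ), ψ (s + (T - τ)) • G τ' s)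
        + (∫ s in Ioi (0 : ℝ), ψ (s + (T - τ')) • G τ s)
        + (∫ s in Ioi (0 : ℝ), (ψ (s + (T - τ')) - ψ (s + (T - τ))) • (G τ' s - G τ s)))
        - ∫ s in Ioi (0 : ℝ), ψ (s + (T - τ)) • G τ s := by
    intro τ'
    have i1 := hg.integrable_test_smul (hψ.comp_add (T - τ')) (G τ')
    have i2 := hg.integrable_test_smul (hψ.comp_add (T - τ)) (G τ')
    have i3 := hg.integrable_test_smul (hψ.comp_add (T - τ')) (G τ)
    have i4 := hg.integrable_test_smul (hψ.comp_add (T - τ)) (G τ)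
    have e : (∫ s in Ioi (0 : ℝ), (ψ (s + (T - τ')) - ψ (s + (T - τ))) • (G τ' s - G τ s))
        = (∫ s in Ioi (0 : ℝ), ψ (s + (T - τ')) • G τ' s)
          - (∫ s in Ioi (0 : ℝ), ψ (s + (T - τ)) • G τ' s)
          - ((∫ s in Ioi (0 : ℝ), ψ (s + (T - τ')) • G τ s)
            - ∫ s in Ioi (0 : ℝ), ψ (s + (T - τ)) • G τ s) := by
      have i5 := i1.sub i2
      have i6 := i3.sub i4
      rw [← integral_sub i1 i2, ← integral_sub i3 i4]
      refine Eq.trans ?_ (integral_sub i5 i6)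
      refine integral_congr_ae (Eventually.of_forall fun s => ?_)
      simp only [sub_smul, smul_sub]
    rw [e]
    abel
  have h5 := h4.sub_const (∫ s in Ioi (0 : ℝ), ψ (s + (T - τ)) • G τ s)
  refine (h5.congr_of_eventuallyEq (Eventually.of_forall hsum)).congr_deriv ?_
  have hd : ∀ s, deriv (fun s => ψ (s + (T - τ))) s = deriv ψ (s + (T - τ)) := fun s =>
    deriv_comp_add_const _ _ _
  simp only [hd]
  abel

end MemoryFlow

end History

/-! ### The solution formula along characteristics -/

section Characteristics

open scoped RealInnerProductSpace

variable {E : Type*} [NormedAddCommGroup E]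

lemma preimage_add_Ioi (h : ℝ) : (fun s : ℝ => s + h) ⁻¹' Ioi h = Ioi 0 := by
  ext s; simp

lemma integrableOn_Ioi_comp_add {f : ℝ → E} {h : ℝ} (hf : IntegrableOn f (Ioi h)) :
    IntegrableOn (fun s => f (s + h)) (Ioi 0) := by
  have := ((measurePreserving_add_right volume h).integrableOn_comp_preimage
    (Homeomorph.addRight h).measurableEmbedding).2 hf
  rwa [preimage_add_Ioi] at this

lemma integrableOn_Ioc_comp_add {f : ℝ → E} {h M : ℝ} (hf : IntegrableOn f (Ioc h (M + h))) :
    IntegrableOn (fun s => f (s + h)) (Ioc 0 M) := by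
  have := ((measurePreserving_add_right volume h).integrableOn_comp_preimage
    (Homeomorph.addRight h).measurableEmbedding).2 hf
  have e : (fun s : ℝ => s + h) ⁻¹' Ioc h (M + h) = Ioc 0 M := by
    ext s; simp
  rwa [e] at this

lemma locallyIntegrableOn_Ioi_of_Ioc {f : ℝ → E} (hf : ∀ M, IntegrableOn f (Ioc 0 M)) :
    LocallyIntegrableOn f (Ioi 0) := by
  intro x hx
  refine ⟨Ioc 0 (x + 1), ?_, hf _⟩
  rw [← Ioi_inter_Iic]
  exact inter_mem self_mem_nhdsWithin (mem_nhdsWithin_of_mem_nhds (Iic_mem_nhds (by linarith)))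

variable [NormedSpace ℝ E]

lemma setIntegral_Ioi_comp_add (f : ℝ → E) (h : ℝ) :
    ∫ s in Ioi (0 : ℝ), f (s + h) = ∫ s in Ioi h, f s := by
  rw [← (measurePreserving_add_right volume h).setIntegral_preimage_emb
    (Homeomorph.addRight h).measurableEmbedding f (Ioi h), preimage_add_Ioi]

lemma setIntegral_Ioi_eq_add {f : ℝ → E} (hf : IntegrableOn f (Ioi 0)) {h : ℝ} (hh : 0 ≤ h) :
    ∫ s in Ioi (0 : ℝ), f s = (∫ s in Ioc 0 h, f s) + ∫ s in Ioi (0 : ℝ), f (s + h) := by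
  rw [setIntegral_Ioi_comp_add, ← setIntegral_union (Ioc_disjoint_Ioi le_rfl) measurableSet_Ioi
    (hf.mono_set Ioc_subset_Ioi_self) (hf.mono_set (Ioi_subset_Ioi hh)), Ioc_union_Ioi_eq_Ioi hh]

variable {g : ℝ → ℝ} {k₁ k₂ : ℝ}

lemma IsTest.hasDerivAt_integral_comp_sub {ψ : ℝ → ℝ} (hψ : IsTest ψ) (T τ : ℝ) :
    HasDerivAt (fun τ => ∫ s in Ioi (0 : ℝ), ψ (s + (T - τ))) (ψ (T - τ)) τ := by
  have e : (fun τ => ∫ s in Ioi (0 : ℝ), ψ (s + (T - τ)))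
      = fun τ => (∫ s in Ioi (0 : ℝ), ψ s) - ∫ s in (0 : ℝ)..(T - τ), ψ s := by
    ext τ
    rw [setIntegral_Ioi_comp_add, ← intervalIntegral.integral_interval_add_Ioi
      (hψ.integrable.integrableOn (s := Ioi 0)) (hψ.integrable.integrableOn (s := Ioi (T - τ)))]
    ring
  rw [e]
  have h1 : HasDerivAt (fun x => ∫ s in (0 : ℝ)..x, ψ s) (ψ (T - τ)) (T - τ) :=
    intervalIntegral.integral_hasDerivAt_right (hψ.1.continuous.intervalIntegrable _ _)
      (hψ.1.continuous.stronglyMeasurableAtFilter _ _) hψ.1.continuous.continuousAt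
  have h2 := h1.comp τ ((hasDerivAt_id τ).const_sub T)
  exact (h2.const_sub _).congr_deriv (by ring)

lemma hasDerivAt_integral_of_continuousOn [CompleteSpace E] {c : ℝ → E}
    (hc : ContinuousOn c (Ici 0)) {t τ : ℝ} (ht : 0 ≤ t) (hτ : 0 < τ) :
    HasDerivAt (fun τ => ∫ x in t..τ, c x) (c τ) τ := by
  refine intervalIntegral.integral_hasDerivAt_right ?_
    ((hc.mono Ioi_subset_Ici_self).stronglyMeasurableAtFilter isOpen_Ioi τ hτ)
    (hc.continuousAt (Ici_mem_nhds hτ))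
  refine (hc.mono fun x hx => ?_).intervalIntegrable
  rw [mem_uIcc] at hx
  rcases hx with hx | hx
  · exact ht.trans hx.1
  · exact hτ.le.trans hx.1

end Characteristics

section Flow

open scoped RealInnerProductSpace

variable {E : Type*} [NormedAddCommGroup E] [InnerProductSpace ℝ E] [CompleteSpace E]
variable {g : ℝ → ℝ} {k₁ k₂ : ℝ} {G : ℝ → Lp E 2 (kernelMeasure g)} {c : ℝ → E}

namespace MemoryFlow

lemma continuousOn_primitive (hf : MemoryFlow g G c) {t : ℝ} (ht : 0 < t) :
    ContinuousOn (fun τ => ∫ x in t..τ, c x) (Ioi 0) := fun _ hτ =>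
  (hasDerivAt_integral_of_continuousOn hf.cont_c ht.le hτ).continuousAt.continuousWithinAt

/-- The solution formula along characteristics, integrated against a test function. -/
lemma integral_characteristic (hf : MemoryFlow g G c) (hg : MemoryKernel g k₁ k₂) {ψ : ℝ → ℝ}
    (hψ : IsTest ψ) {t h : ℝ} (ht : 0 < t) (hh : 0 ≤ h) :
    (∫ s in Ioi (0 : ℝ), ψ s • G (t + h) s)
      = (∫ s in Ioi (0 : ℝ), ψ (s + h) • G t s)
        + (∫ s in Ioi (0 : ℝ), ψ s) • (∫ x in t..t + h, c x)
        - ∫ s in (0 : ℝ)..h, ψ s • ∫ x in t..t + h - s, c x := by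
  have key : ∀ τ ∈ uIcc t (t + h), HasDerivAt (fun τ => (∫ s in Ioi (0 : ℝ),
      ψ (s + (t + h - τ)) • G τ s) - (∫ s in Ioi (0 : ℝ), ψ (s + (t + h - τ))) • ∫ x in t..τ, c x)
      (-(ψ (t + h - τ) • ∫ x in t..τ, c x)) τ := by
    intro τ hτ
    rw [uIcc_of_le (by linarith)] at hτ
    have hτ0 : 0 < τ := ht.trans_le hτ.1
    have := (hf.hasDerivAt_moving hg hψ (t + h) hτ0).sub
      ((hψ.hasDerivAt_integral_comp_sub (t + h) τ).smul
        (hasDerivAt_integral_of_continuousOn hf.cont_c ht.le hτ0))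
    refine this.congr_deriv ?_
    abel
  have hcont : ContinuousOn (fun τ => -(ψ (t + h - τ) • ∫ x in t..τ, c x)) (uIcc t (t + h)) := by
    refine ((hψ.1.continuous.comp (continuous_const.sub continuous_id)).continuousOn.smul
      ((hf.continuousOn_primitive ht).mono fun τ hτ => ?_)).neg
    rw [uIcc_of_le (by linarith)] at hτ
    exact ht.trans_le hτ.1
  have := intervalIntegral.integral_eq_sub_of_hasDerivAt key hcont.intervalIntegrable
  simp only [sub_self, add_zero, add_sub_cancel_left, intervalIntegral.integral_same, smul_zero,
    sub_zero, intervalIntegral.integral_neg] at this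
  have e : ∫ s in (0 : ℝ)..h, ψ s • ∫ x in t..t + h - s, c x
      = ∫ τ in t..t + h, ψ (t + h - τ) • ∫ x in t..τ, c x := by
    have := intervalIntegral.integral_comp_sub_left (a := 0) (b := h)
      (fun τ => ψ (t + h - τ) • ∫ x in t..τ, c x) (t + h)
    simpa using this
  rw [← sub_eq_zero] at this
  rw [e, ← sub_eq_zero, ← neg_eq_zero, ← this]
  abel

/-- The part of the history that was already there has moved along the characteristics. -/
theorem ae_comp_add_eq (hf : MemoryFlow g G c) (hg : MemoryKernel g k₁ k₂) {t h : ℝ} (ht : 0 < t)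
    (hh : 0 ≤ h) : ∀ᵐ s ∂(volume.restrict (Ioi (0 : ℝ))),
      G (t + h) (s + h) = G t s + ∫ x in t..t + h, c x := by
  set A := ∫ x in t..t + h, c x
  have hi : ∀ M, IntegrableOn (fun s => G (t + h) (s + h) - G t s - A) (Ioc 0 M) := fun M =>
    ((integrableOn_Ioc_comp_add ((hg.integrableOn_Ioc _ _).mono_set
      (Ioc_subset_Ioc_left hh))).sub (hg.integrableOn_Ioc _ _)).sub
      (integrableOn_const (by simp))
  have hz := isOpen_Ioi.ae_eq_zero_of_integral_contDiff_smul_eq_zero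
    (locallyIntegrableOn_Ioi_of_Ioc hi) fun ψ hψ1 hψ2 hψ3 => by
    have hψ : IsTest ψ := ⟨hψ1, hψ2⟩
    have h0 : ∀ s ∉ Ioi (0 : ℝ), ψ s = 0 := fun s hs =>
      image_eq_zero_of_notMem_tsupport fun h => hs (hψ3 h)
    have hψ' : IsTest fun s => ψ (s + -h) := hψ.comp_add (-h)
    rw [← setIntegral_eq_integral_of_forall_compl_eq_zero (s := Ioi 0)
      (fun s hs => by rw [h0 s hs, zero_smul])]
    have h1 := hf.integral_characteristic hg hψ' ht hh
    have e1 : ∫ s in (0 : ℝ)..h, ψ (s + -h) • ∫ x in t..t + h - s, c x = 0 := by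
      refine intervalIntegral.integral_zero_ae (Eventually.of_forall fun s hs => ?_)
      rw [uIoc_of_le hh] at hs
      rw [h0, zero_smul]
      simpa using hs.2
    have e2 : ∫ s in Ioi (0 : ℝ), ψ (s + -h) • G (t + h) s
        = ∫ s in Ioi (0 : ℝ), ψ s • G (t + h) (s + h) := by
      rw [setIntegral_Ioi_eq_add (hg.integrable_test_smul hψ' _) hh,
        setIntegral_eq_zero_of_forall_eq_zero, zero_add]
      · simp
      · intro s hs
        rw [h0, zero_smul]
        simpa using hs.2
    have e3 : ∫ s in Ioi (0 : ℝ), ψ (s + -h) = ∫ s in Ioi (0 : ℝ), ψ s := by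
      rw [setIntegral_Ioi_eq_add hψ'.integrable.integrableOn hh,
        setIntegral_eq_zero_of_forall_eq_zero, zero_add]
      · simp
      · intro s hs
        rw [h0]
        simpa using hs.2
    rw [e1, e2, e3, sub_zero] at h1
    simp only [add_neg_cancel_right] at h1
    have i1 : IntegrableOn (fun s => ψ s • G (t + h) (s + h)) (Ioi 0) := by
      have := integrableOn_Ioi_comp_add ((hg.integrable_test_smul hψ' (G (t + h))).mono_set
        (Ioi_subset_Ioi hh))
      simpa using this
    have i2 := hg.integrable_test_smul hψ (G t)
    have i3 : IntegrableOn (fun s => ψ s • A) (Ioi 0) := hψ.integrable.integrableOn.smul_const A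
    have i4 : IntegrableOn (fun s => ψ s • G (t + h) (s + h) - ψ s • G t s) (Ioi 0) := i1.sub i2
    simp only [smul_sub]
    rw [integral_sub i4 i3, integral_sub i1 i2, h1, integral_smul_const]
    abel
  rw [ae_restrict_iff' measurableSet_Ioi]
  filter_upwards [hz] with s hs hs0
  rw [← sub_eq_zero, ← sub_sub]
  exact hs hs0

/-- The recent part of the history consists of the source alone. -/
theorem ae_eq_of_le (hf : MemoryFlow g G c) (hg : MemoryKernel g k₁ k₂) {t h : ℝ} (ht : 0 < t)
    (hh : 0 ≤ h) : ∀ᵐ s ∂(volume.restrict (Ioc (0 : ℝ) h)),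
      G (t + h) s = ∫ x in t + h - s..t + h, c x := by
  set A := ∫ x in t..t + h, c x
  have hcA : ContinuousOn (fun s => ∫ x in t..t + h - s, c x) (Icc 0 h) := by
    refine (hf.continuousOn_primitive ht).comp (by fun_prop) fun s hs => ?_
    simp only [mem_Ioi]
    linarith [hs.2]
  have hiA : IntegrableOn (fun s => ∫ x in t..t + h - s, c x) (Ioc 0 h) :=
    (hcA.integrableOn_Icc).mono_set Ioc_subset_Icc_self
  have hi : IntegrableOn (fun s => G (t + h) s - A + ∫ x in t..t + h - s, c x) (Ioc 0 h) :=
    ((hg.integrableOn_Ioc _ _).sub (integrableOn_const (by simp))).add hiA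
  have hz := isOpen_Ioo.ae_eq_zero_of_integral_contDiff_smul_eq_zero
    (hi.mono_set Ioo_subset_Ioc_self).locallyIntegrableOn fun ψ hψ1 hψ2 hψ3 => by
    have hψ : IsTest ψ := ⟨hψ1, hψ2⟩
    have h0 : ∀ s ∉ Ioo (0 : ℝ) h, ψ s = 0 := fun s hs =>
      image_eq_zero_of_notMem_tsupport fun h => hs (hψ3 h)
    have hM : ∀ s, h < s → ψ s = 0 := fun s hs => h0 s fun h' => by linarith [h'.2]
    rw [← setIntegral_eq_integral_of_forall_compl_eq_zero (s := Ioc 0 h)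
      (fun s hs => by rw [h0 s fun h' => hs (Ioo_subset_Ioc_self h'), zero_smul])]
    have h1 := hf.integral_characteristic hg hψ ht hh
    have e1 : ∫ s in Ioi (0 : ℝ), ψ (s + h) • G t s = 0 :=
      setIntegral_eq_zero_of_forall_eq_zero fun s hs => by
        rw [hM, zero_smul]
        simpa using hs
    have e2 : ∫ s in Ioi (0 : ℝ), ψ s = ∫ s in Ioc 0 h, ψ s := by
      have := setIntegral_test_smul_eq hh hM (fun _ => (1 : ℝ))
      simpa using this
    obtain ⟨C, hC0, hC⟩ := hψ.exists_bound
    have bdd : ∀ {f : ℝ → E}, IntegrableOn f (Ioc 0 h) →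
        IntegrableOn (fun s => ψ s • f s) (Ioc 0 h) := fun hf =>
      hf.bdd_smul C hψ.1.continuous.aestronglyMeasurable (Eventually.of_forall hC)
    rw [e1, e2, setIntegral_test_smul_eq hh hM, zero_add, intervalIntegral.integral_of_le hh] at h1
    have i1 := hg.integrableOn_Ioc (G (t + h)) h
    have i2 : IntegrableOn (fun _ : ℝ => A) (Ioc 0 h) := integrableOn_const (by simp)
    have i3 : IntegrableOn (fun s => ψ s • G (t + h) s - ψ s • A) (Ioc 0 h) :=
      (bdd i1).sub (bdd i2)
    simp only [smul_add, smul_sub]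
    rw [integral_add i3 (bdd hiA), integral_sub (bdd i1) (bdd i2), h1, integral_smul_const]
    abel
  rw [← Measure.restrict_congr_set Ioo_ae_eq_Ioc, ae_restrict_iff' measurableSet_Ioo]
  have hii : ∀ x > 0, IntervalIntegrable c volume t x := fun x hx => by
    refine (hf.cont_c.mono fun r hr => ?_).intervalIntegrable
    rw [mem_uIcc] at hr
    rcases hr with hr | hr
    · exact ht.le.trans hr.1
    · exact hx.le.trans hr.1
  filter_upwards [hz] with s hs hs0
  have h2 := hs hs0
  rw [← intervalIntegral.integral_interval_sub_left (hii (t + h) (by linarith))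
    (hii (t + h - s) (by linarith [hs0.2])), ← sub_eq_zero, ← h2]
  abel

end MemoryFlow

end Flow

/-! ### The energy of the history -/

section HistoryEnergy

open scoped RealInnerProductSpace

variable {E : Type*} [NormedAddCommGroup E] [InnerProductSpace ℝ E]
variable {g : ℝ → ℝ} {k₁ k₂ : ℝ} {G : ℝ → Lp E 2 (kernelMeasure g)} {c : ℝ → E}

/-- The mean of a history. -/
noncomputable def histMean (G : Lp E 2 (kernelMeasure g)) : E := ∫ s, G s ∂(kernelMeasure g)

/-- The mean of a history against the derivative of the kernel. -/
noncomputable def histDerivMean (G : Lp E 2 (kernelMeasure g)) : E :=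
  ∫ s in Ioi (0 : ℝ), deriv g s • G s

lemma MemoryKernel.norm_histMean_le (hg : MemoryKernel g k₁ k₂) (G : Lp E 2 (kernelMeasure g)) :
    ‖histMean G‖ ≤ √((kernelMeasure g).real univ) * ‖G‖ := by
  have := hg.isFiniteMeasure
  exact (norm_integral_le_integral_norm _).trans (integral_norm_le_sqrt_mul G)

lemma MemoryKernel.integrable_deriv_smul (hg : MemoryKernel g k₁ k₂)
    (G : Lp E 2 (kernelMeasure g)) : IntegrableOn (fun s => k₁ * ‖g s • G s‖) (Ioi 0) := by
  have := hg.isFiniteMeasure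
  exact (hg.integrable_iff.1 (integrable_coe G)).norm.const_mul k₁

lemma MemoryKernel.norm_histDerivMean_le (hg : MemoryKernel g k₁ k₂)
    (G : Lp E 2 (kernelMeasure g)) :
    ‖histDerivMean G‖ ≤ k₁ * (√((kernelMeasure g).real univ) * ‖G‖) := by
  have := hg.isFiniteMeasure
  refine (norm_integral_le_of_norm_le (hg.integrable_deriv_smul G) ?_).trans ?_
  · filter_upwards [ae_restrict_mem measurableSet_Ioi] with s hs
    rw [norm_smul, norm_smul, Real.norm_eq_abs, Real.norm_eq_abs, abs_of_pos (hg.pos s hs),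
      ← mul_assoc]
    exact mul_le_mul_of_nonneg_right (hg.abs_deriv_le s hs) (norm_nonneg _)
  · rw [integral_const_mul]
    refine mul_le_mul_of_nonneg_left (le_trans (le_of_eq ?_) (integral_norm_le_sqrt_mul G))
      hg.k₁_pos.le
    rw [hg.integral_eq]
    refine setIntegral_congr_fun measurableSet_Ioi fun s hs => ?_
    simp only [norm_smul, Real.norm_eq_abs, abs_of_pos (hg.pos s hs), smul_eq_mul]

lemma MemoryKernel.histMean_sub (hg : MemoryKernel g k₁ k₂) (G G' : Lp E 2 (kernelMeasure g)) :
    histMean (G - G') = histMean G - histMean G' := by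
  have := hg.isFiniteMeasure
  rw [histMean, histMean, histMean, ← integral_sub (integrable_coe G) (integrable_coe G')]
  exact integral_congr_ae (Lp.coeFn_sub G G')

lemma MemoryKernel.continuous_histMean (hg : MemoryKernel g k₁ k₂) :
    Continuous (histMean : Lp E 2 (kernelMeasure g) → E) := by
  refine (LipschitzWith.of_dist_le_mul (K := Real.toNNReal √((kernelMeasure g).real univ))
    fun G G' => ?_).continuous
  rw [dist_eq_norm, dist_eq_norm, ← hg.histMean_sub, Real.coe_toNNReal _ (Real.sqrt_nonneg _)]
  exact hg.norm_histMean_le _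

lemma MemoryFlow.norm_le_primitive_norm (hf : MemoryFlow g G c) {t h s : ℝ} (ht : 0 < t)
    (hs : s ∈ Icc 0 h) :
    ‖∫ x in t + h - s..t + h, c x‖ ≤ ∫ x in t..t + h, ‖c x‖ := by
  have hi : IntervalIntegrable (fun x => ‖c x‖) volume t (t + h) := by
    refine (hf.cont_c.norm.mono fun x hx => ?_).intervalIntegrable
    rw [uIcc_of_le (by linarith [hs.1, hs.2])] at hx
    exact ht.le.trans hx.1
  refine (intervalIntegral.norm_integral_le_integral_norm (by linarith [hs.1])).trans ?_
  exact intervalIntegral.integral_mono_interval (by linarith [hs.2]) (by linarith [hs.1]) le_rfl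
    (Eventually.of_forall fun _ => norm_nonneg _) hi

/-- One-sided derivative of the mean of a fixed history against the translated kernel. -/
lemma MemoryKernel.hasDerivWithinAt_integral_comp_add
    {F : Type*} [NormedAddCommGroup F] [NormedSpace ℝ F] (hg : MemoryKernel g k₁ k₂) {f : ℝ → F}
    (hf : AEStronglyMeasurable f (volume.restrict (Ioi 0)))
    (hi : IntegrableOn (fun s => g s • f s) (Ioi 0)) :
    HasDerivWithinAt (fun r => ∫ s in Ioi (0 : ℝ), g (s + r) • f s)
      (∫ s in Ioi (0 : ℝ), deriv g s • f s) (Ici 0) 0 := by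
  have meas : ∀ r ≥ 0, AEStronglyMeasurable (fun s => g (s + r) • f s)
      (volume.restrict (Ioi (0 : ℝ))) := fun r hr => by
    refine AEStronglyMeasurable.smul ?_ hf
    refine (hg.continuousOn.comp (by fun_prop) fun s hs => ?_).aestronglyMeasurable measurableSet_Ioi
    simp only [mem_Ioi] at hs ⊢
    linarith
  have hsub : ∀ r ≥ 0, ∀ s > 0, ‖g (s + r) • f s - g s • f s‖ ≤ r * (k₁ * ‖g s • f s‖) :=
    fun r hr s hs => by
      rw [← sub_smul, norm_smul, norm_smul, Real.norm_eq_abs, Real.norm_eq_abs,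
        abs_of_pos (hg.pos s hs)]
      refine (mul_le_mul_of_nonneg_right (hg.abs_sub_le hs hr) (norm_nonneg _)).trans (le_of_eq ?_)
      ring
  have hint : ∀ r ≥ 0, IntegrableOn (fun s => g (s + r) • f s) (Ioi 0) := fun r hr => by
    refine hi.norm.mono' (meas r hr) ?_
    filter_upwards [ae_restrict_mem measurableSet_Ioi] with s hs
    have hs : 0 < s := hs
    rw [norm_smul, norm_smul, Real.norm_eq_abs, Real.norm_eq_abs, abs_of_pos (hg.pos s hs),
      abs_of_pos (hg.pos _ (by linarith))]
    exact mul_le_mul_of_nonneg_right (hg.antitone hs (by linarith)) (norm_nonneg _)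
  rw [hasDerivWithinAt_iff_tendsto_slope]
  have hset : Ici (0 : ℝ) \ {0} = Ioi 0 := by
    ext x
    simp [lt_iff_le_and_ne, eq_comm]
  rw [hset]
  have hslope : ∀ r > 0, slope (fun r => ∫ s in Ioi (0 : ℝ), g (s + r) • f s) 0 r
      = ∫ s in Ioi (0 : ℝ), r⁻¹ • (g (s + r) • f s - g s • f s) := fun r hr => by
    have h0 : ∫ s in Ioi (0 : ℝ), g (s + 0) • f s = ∫ s in Ioi (0 : ℝ), g s • f s := by simp
    rw [slope_def_module, integral_smul, integral_sub (hint r hr.le) hi, h0, sub_zero]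
  refine Tendsto.congr' (eventually_nhdsWithin_of_forall fun r hr => (hslope r hr).symm) ?_
  refine tendsto_integral_filter_of_dominated_convergence (fun s => k₁ * ‖g s • f s‖) ?_ ?_
    (hi.norm.const_mul k₁) ?_
  · exact eventually_nhdsWithin_of_forall fun r hr =>
      ((meas r (le_of_lt hr)).sub hi.1).const_smul r⁻¹
  · refine eventually_nhdsWithin_of_forall fun r hr => ?_
    have hr : 0 < r := hr
    filter_upwards [ae_restrict_mem measurableSet_Ioi] with s hs
    rw [norm_smul, norm_inv, Real.norm_eq_abs, abs_of_pos hr, inv_mul_le_iff₀ hr]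
    exact hsub r hr.le s hs
  · filter_upwards [ae_restrict_mem measurableSet_Ioi] with s hs
    have h1 : HasDerivAt g (deriv g s) (s + 0) := by
      rw [add_zero]
      exact (hg.differentiable s hs).hasDerivAt
    have h2 := ((h1.comp_const_add s 0).smul_const (f s)).hasDerivWithinAt (s := Ioi 0)
    rw [hasDerivWithinAt_iff_tendsto_slope' (by simp)] at h2
    refine h2.congr fun r => ?_
    rw [slope_def_module]
    simp

variable [CompleteSpace E]

namespace MemoryFlow

/-- The exponential decay of the kernel damps the energy of the transported part; the recent part
is of third order in `h`. -/
lemma norm_sq_add_le (hf : MemoryFlow g G c) (hg : MemoryKernel g k₁ k₂) {G₀ : ℝ}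
    (hG₀ : ∀ s > 0, g s ≤ G₀) {t h : ℝ} (ht : 0 < t) (hh : 0 ≤ h) :
    ‖G (t + h)‖ ^ 2 ≤ Real.exp (-k₂ * h) * (‖G t‖ ^ 2
        + 2 * ⟪histMean (G t), ∫ x in t..t + h, c x⟫
        + (kernelMeasure g).real univ * ‖∫ x in t..t + h, c x‖ ^ 2)
      + G₀ * h * (∫ x in t..t + h, ‖c x‖) ^ 2 := by
  have := hg.isFiniteMeasure
  set A := ∫ x in t..t + h, c x with hA
  set α := ∫ x in t..t + h, ‖c x‖ with hα
  have hα0 : 0 ≤ α := intervalIntegral.integral_nonneg (by linarith) fun _ _ => norm_nonneg _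
  have hG0 : 0 ≤ G₀ := (hg.pos 1 one_pos).le.trans (hG₀ 1 one_pos)
  have i1 := hg.integrable_iff.1 (integrable_norm_sq (G (t + h)))
  rw [norm_sq_eq_integral, hg.integral_eq, setIntegral_Ioi_eq_add i1 hh, add_comm]
  refine add_le_add ?_ ?_
  · have m : MemLp (fun s => G t s + A) 2 (kernelMeasure g) :=
      (Lp.memLp (G t)).add (memLp_const A)
    have i2 : Integrable (fun s => ‖G t s + A‖ ^ 2) (kernelMeasure g) :=
      (memLp_two_iff_integrable_sq_norm m.1).1 m
    have e1 : ∫ s, ‖G t s + A‖ ^ 2 ∂(kernelMeasure g) = ‖G t‖ ^ 2 + 2 * ⟪histMean (G t), A⟫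
        + (kernelMeasure g).real univ * ‖A‖ ^ 2 := by
      have j1 := integrable_norm_sq (G t)
      have j2 : Integrable (fun s => 2 * ⟪G t s, A⟫) (kernelMeasure g) :=
        ((integrable_coe (G t)).inner_const A).const_mul 2
      simp only [norm_add_sq_real]
      have e2 : ∫ s, ⟪G t s, A⟫ ∂(kernelMeasure g) = ⟪histMean (G t), A⟫ := by
        rw [histMean, real_inner_comm, ← integral_inner (integrable_coe (G t))]
        simp only [real_inner_comm]
      have j3 : Integrable (fun s => ‖G t s‖ ^ 2 + 2 * ⟪G t s, A⟫) (kernelMeasure g) := j1.add j2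
      rw [integral_add j3 (integrable_const _), integral_add j1 j2, integral_const_mul,
        e2, ← norm_sq_eq_integral, integral_const, smul_eq_mul]
    rw [← e1, hg.integral_eq, ← integral_const_mul]
    refine integral_mono_ae (integrableOn_Ioi_comp_add (i1.mono_set (Ioi_subset_Ioi hh)))
      ((hg.integrable_iff.1 i2).const_mul _) ?_
    filter_upwards [hf.ae_comp_add_eq hg ht hh, ae_restrict_mem measurableSet_Ioi] with s hs hs0
    rw [hs, smul_eq_mul, smul_eq_mul, ← mul_assoc]
    exact mul_le_mul_of_nonneg_right (hg.upper s hs0 h hh) (sq_nonneg _)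
  · have e : G₀ * h * α ^ 2 = ∫ s in Ioc 0 h, G₀ * α ^ 2 := by
      rw [setIntegral_const]
      simp [Measure.real, hh]
      ring
    rw [e]
    refine integral_mono_ae (i1.mono_set Ioc_subset_Ioi_self) (integrableOn_const (by simp)) ?_
    filter_upwards [hf.ae_eq_of_le hg ht hh, ae_restrict_mem measurableSet_Ioc] with s hs hs0
    have := hf.norm_le_primitive_norm ht (Ioc_subset_Icc_self hs0)
    have hgs := (hg.pos s hs0.1).le
    rw [hs, smul_eq_mul]
    exact mul_le_mul (hG₀ s hs0.1) (pow_le_pow_left₀ (norm_nonneg _) this 2) (sq_nonneg _) hG0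

lemma hasDerivAt_primitive_shift {F : Type*} [NormedAddCommGroup F] [NormedSpace ℝ F]
    [CompleteSpace F] {c : ℝ → F} (hc : ContinuousOn c (Ici 0)) {t : ℝ} (ht : 0 < t) :
    HasDerivAt (fun r => ∫ x in t..t + r, c x) (c t) 0 := by
  have h := hasDerivAt_integral_of_continuousOn hc ht.le (τ := t + 0) (by simpa using ht)
  have := h.comp_const_add t 0
  simpa using this

/-- A function that touches the energy of the history from above, with the derivative that the
dissipation identity predicts. -/
theorem exists_touch (hf : MemoryFlow g G c) (hg : MemoryKernel g k₁ k₂) {t : ℝ} (ht : 0 < t) :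
    ∃ F : ℝ → ℝ, (∀ r ≥ 0, ‖G (t + r)‖ ^ 2 ≤ F r) ∧ F 0 = ‖G t‖ ^ 2 ∧
      HasDerivWithinAt F (-k₂ * ‖G t‖ ^ 2 + 2 * ⟪histMean (G t), c t⟫) (Ici 0) 0 := by
  obtain ⟨G₀, hG0, hG₀⟩ := hg.exists_bound
  refine ⟨_, fun r hr => hf.norm_sq_add_le hg hG₀ ht hr, by simp, HasDerivAt.hasDerivWithinAt ?_⟩
  have dA := hasDerivAt_primitive_shift hf.cont_c ht
  have dα := hasDerivAt_primitive_shift hf.cont_c.norm ht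
  have d1 : HasDerivAt (fun r : ℝ => Real.exp (-k₂ * r)) (Real.exp (-k₂ * 0) * (-k₂ * 1)) 0 :=
    ((hasDerivAt_id (0 : ℝ)).const_mul (-k₂)).exp
  have d2 := ((((hasDerivAt_const (0 : ℝ) (histMean (G t))).inner ℝ dA).const_mul 2).const_add
    (‖G t‖ ^ 2)).add (dA.norm_sq.const_mul ((kernelMeasure g).real univ))
  have d3 := ((hasDerivAt_id (0 : ℝ)).const_mul G₀).mul (dα.pow 2)
  refine ((d1.mul d2).add d3).congr_deriv ?_
  simp

/-- The equation of motion of the mean of the history. -/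
theorem hasDerivWithinAt_histMean (hf : MemoryFlow g G c) (hg : MemoryKernel g k₁ k₂) {t : ℝ}
    (ht : 0 < t) : HasDerivWithinAt (fun r => histMean (G (t + r)))
      (histDerivMean (G t) + (∫ s in Ioi (0 : ℝ), g s) • c t) (Ici 0) 0 := by
  have := hg.isFiniteMeasure
  obtain ⟨G₀, hG0, hG₀⟩ := hg.exists_bound
  have dA := (hasDerivAt_primitive_shift hf.cont_c ht).hasDerivWithinAt (s := Ici 0)
  have dα := hasDerivAt_primitive_shift hf.cont_c.norm ht
  have ig : ∀ t, IntegrableOn (fun s => g s • G t s) (Ioi 0) := fun t =>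
    hg.integrable_iff.1 (integrable_coe (G t))
  -- the recent part of the history is of second order
  have d1 : HasDerivWithinAt (fun r => ∫ s in Ioc 0 r, g s • G (t + r) s) (0 : E) (Ici 0) 0 := by
    have d := (((hasDerivAt_id (0 : ℝ)).const_mul G₀).mul dα).hasDerivWithinAt (s := Ici 0)
    rw [hasDerivWithinAt_iff_isLittleO] at d ⊢
    refine Asymptotics.IsBigO.trans_isLittleO ?_ d
    refine Asymptotics.IsBigO.of_bound 1 (eventually_nhdsWithin_of_forall fun r hr => ?_)
    have hr : 0 ≤ r := hr
    have hα0 : 0 ≤ ∫ x in t..t + r, ‖c x‖ :=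
      intervalIntegral.integral_nonneg (by linarith) fun _ _ => norm_nonneg _
    have hb : ‖∫ s in Ioc 0 r, g s • G (t + r) s‖ ≤ ∫ s in Ioc 0 r, G₀ * ∫ x in t..t + r, ‖c x‖ := by
      refine norm_integral_le_of_norm_le (integrableOn_const (by simp)) ?_
      filter_upwards [hf.ae_eq_of_le hg ht hr, ae_restrict_mem measurableSet_Ioc] with s hs hs0
      rw [hs, norm_smul, Real.norm_eq_abs, abs_of_pos (hg.pos s hs0.1)]
      exact mul_le_mul (hG₀ s hs0.1) (norm_le_primitive_norm hf ht (Ioc_subset_Icc_self hs0))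
        (norm_nonneg _) hG0
    rw [setIntegral_const] at hb
    simp only [Measure.real, Real.volume_Ioc, sub_zero, ENNReal.toReal_ofReal hr, smul_eq_mul] at hb
    simp only [Ioc_self, Measure.restrict_empty, integral_zero_measure, sub_zero, smul_zero,
      add_zero, intervalIntegral.integral_same, mul_zero, mul_one, zero_mul, Pi.mul_apply, id,
      one_mul]
    refine hb.trans ((le_abs_self _).trans (le_of_eq ?_))
    rw [Real.norm_eq_abs]
    congr 1
    ring
  have d2 := hg.hasDerivWithinAt_integral_comp_add
    ((Lp.aestronglyMeasurable (G t)).mono_ac hg.absolutelyContinuous) (ig t)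
  have d3 := hg.hasDerivWithinAt_integral_comp_add (f := fun _ => (1 : ℝ))
    aestronglyMeasurable_const (by simpa using hg.integrableOn)
  have d := (d1.add d2).add (d3.smul dA)
  refine (d.congr_of_mem (fun r hr => ?_) self_mem_Ici).congr_deriv ?_
  · have hr : 0 ≤ r := hr
    have i1 : IntegrableOn (fun s => g (s + r) • (G t s + ∫ x in t..t + r, c x)) (Ioi 0) := by
      refine (integrableOn_Ioi_comp_add ((ig (t + r)).mono_set (Ioi_subset_Ioi hr))).congr ?_
      filter_upwards [hf.ae_comp_add_eq hg ht hr] with s hs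
      rw [hs]
    have i2 : IntegrableOn (fun s => g (s + r) • ∫ x in t..t + r, c x) (Ioi 0) :=
      (integrableOn_Ioi_comp_add (hg.integrableOn.mono_set (Ioi_subset_Ioi hr))).smul_const _
    have i3 : IntegrableOn (fun s => g (s + r) • G t s) (Ioi 0) := by
      refine (i1.sub i2).congr (Eventually.of_forall fun s => ?_)
      simp [smul_add]
    rw [histMean, hg.integral_eq, setIntegral_Ioi_eq_add (ig (t + r)) hr]
    simp only [Pi.add_apply, Pi.smul_apply', smul_eq_mul, mul_one]
    rw [add_assoc]
    congr 1
    rw [← integral_smul_const, ← integral_add i3 i2]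
    refine integral_congr_ae ?_
    filter_upwards [hf.ae_comp_add_eq hg ht hr] with s hs
    rw [hs, smul_add]
  · simp [histDerivMean]

end MemoryFlow

end HistoryEnergy

/-! ### Histories as square integrable curves in `L²(ℝ)` -/

section HistoryCurves

/-- In a separable metric space a map is measurable as soon as its distances to all points are. -/
lemma measurable_of_edist {α X : Type*} [MeasurableSpace α] [PseudoEMetricSpace X]
    [SecondCountableTopology X] [MeasurableSpace X] [BorelSpace X] {f : α → X}
    (h : ∀ x, Measurable fun a => edist (f a) x) : Measurable f := by
  refine measurable_of_isOpen fun U hU => ?_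
  obtain ⟨D, hDc, hD⟩ := TopologicalSpace.exists_countable_dense X
  have hU' : U = ⋃ x ∈ D, ⋃ n : ℕ, ⋃ (_ : Metric.eball x ((n : ℝ≥0∞)⁻¹) ⊆ U),
      Metric.eball x ((n : ℝ≥0∞)⁻¹) := by
    refine Subset.antisymm (fun y hy => ?_) ?_
    · obtain ⟨ε, hε, hεU⟩ := EMetric.isOpen_iff.1 hU y hy
      obtain ⟨n, hn⟩ := ENNReal.exists_inv_nat_lt (ENNReal.half_pos hε.ne').ne'
      have hn0 : (0 : ℝ≥0∞) < (n : ℝ≥0∞)⁻¹ := ENNReal.inv_pos.2 (ENNReal.natCast_ne_top n)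
      obtain ⟨x, hxD, hx⟩ := EMetric.dense_iff.1 hD y _ hn0
      simp only [mem_iUnion]
      refine ⟨x, hx, n, fun z hz => hεU ?_, ?_⟩
      · rw [Metric.mem_eball] at *
        calc edist z y ≤ edist z x + edist x y := edist_triangle _ _ _
          _ < ε / 2 + ε / 2 := ENNReal.add_lt_add (hz.trans hn) (hxD.trans hn)
          _ = ε := ENNReal.add_halves ε
      · rw [Metric.mem_eball, edist_comm]
        exact hxD
    · simp only [iUnion_subset_iff]
      exact fun _ _ _ h => h
  rw [hU']
  simp only [preimage_iUnion]
  refine MeasurableSet.biUnion hDc fun x _ => MeasurableSet.iUnion fun n =>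
    MeasurableSet.iUnion fun _ => ?_
  exact measurableSet_lt (h x) measurable_const

lemma eLpNorm_two_sq {α F : Type*} [MeasurableSpace α] [NormedAddCommGroup F] (f : α → F)
    (μ : Measure α) : eLpNorm f 2 μ ^ 2 = ∫⁻ a, ‖f a‖ₑ ^ 2 ∂μ := by
  rw [eLpNorm_eq_lintegral_rpow_enorm_toReal two_ne_zero ENNReal.ofNat_ne_top,
    ← ENNReal.rpow_natCast, ← ENNReal.rpow_mul]
  norm_num

lemma eLpNorm_two_eq {α F : Type*} [MeasurableSpace α] [NormedAddCommGroup F] (f : α → F)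
    (μ : Measure α) : eLpNorm f 2 μ = (∫⁻ a, ‖f a‖ₑ ^ 2 ∂μ) ^ (1 / 2 : ℝ) := by
  rw [eLpNorm_eq_lintegral_rpow_enorm_toReal two_ne_zero ENNReal.ofNat_ne_top]
  norm_num

lemma HistMeasurable.ae_aestronglyMeasurable {γ : ℝ → ℝ → ℝ} (h : HistMeasurable γ) :
    ∀ᵐ s ∂(volume.restrict (Ioi (0 : ℝ))), AEStronglyMeasurable (γ s) volume :=
  h.prodMk_left

lemma HistMeasurable.aemeasurable_eLpNorm {γ : ℝ → ℝ → ℝ} (h : HistMeasurable γ) {p : ℝ≥0∞}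
    (hp0 : p ≠ 0) (hp : p ≠ ⊤) :
    AEMeasurable (fun s => eLpNorm (γ s) p volume) (volume.restrict (Ioi (0 : ℝ))) := by
  simp only [eLpNorm_eq_lintegral_rpow_enorm_toReal hp0 hp]
  refine AEMeasurable.pow_const ?_ _
  have : AEMeasurable (fun q : ℝ × ℝ => ‖γ q.1 q.2‖ₑ ^ p.toReal)
      ((volume.restrict (Ioi (0 : ℝ))).prod volume) := h.enorm.pow_const _
  exact this.lintegral_prod_right'

/-- A jointly measurable function is a measurable curve in `L²(ℝ)`. -/
lemma HistMeasurable.aestronglyMeasurable_toL2 {γ : ℝ → ℝ → ℝ} (h : HistMeasurable γ) :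
    AEStronglyMeasurable (fun s => toL2 (γ s)) (volume.restrict (Ioi (0 : ℝ))) := by
  obtain ⟨γ', hγ', hae⟩ := h
  have hae' := Measure.ae_ae_of_ae_prod hae
  have hcongr : (fun s => toL2 (γ s)) =ᵐ[volume.restrict (Ioi (0 : ℝ))]
      fun s => toL2 fun x => γ' (s, x) := by
    filter_upwards [hae'] with s hs
    exact toL2_congr hs
  refine AEStronglyMeasurable.congr ?_ hcongr.symm
  borelize LTwo
  have : Fact ((1 : ℝ≥0∞) ≤ 2) := ⟨one_le_two⟩
  have : SecondCountableTopology LTwo := by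
    have : Fact ((2 : ℝ≥0∞) ≠ ⊤) := ⟨by simp⟩
    infer_instance
  refine Measurable.aestronglyMeasurable (measurable_of_edist fun X => ?_)
  have hsec : ∀ s, AEStronglyMeasurable (fun x => γ' (s, x)) volume := fun s =>
    (hγ'.comp_measurable measurable_prodMk_left).aestronglyMeasurable
  have hm1 : Measurable fun s => eLpNorm (fun x => γ' (s, x)) 2 volume := by
    simp only [eLpNorm_two_eq]
    exact (Measurable.lintegral_prod_right' (f := fun q => ‖γ' q‖ₑ ^ 2)
      (hγ'.enorm.pow_const 2)).pow_const _
  have hX := (Lp.stronglyMeasurable X)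
  have hm2 : Measurable fun s => eLpNorm (fun x => ((γ' (s, x) : ℝ) : ℂ) - X x) 2 volume := by
    simp only [eLpNorm_two_eq]
    refine (Measurable.lintegral_prod_right' (f := fun q : ℝ × ℝ => ‖((γ' q : ℝ) : ℂ) - X q.2‖ₑ ^ 2)
      (StronglyMeasurable.enorm ?_ |>.pow_const 2)).pow_const _
    exact (Complex.continuous_ofReal.comp_stronglyMeasurable hγ').sub
      (hX.comp_measurable measurable_snd)
  have hset : MeasurableSet {s | eLpNorm (fun x => γ' (s, x)) 2 volume < ⊤} :=
    measurableSet_lt hm1 measurable_const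
  classical
  have heq : (fun s => edist (toL2 fun x => γ' (s, x)) X)
      = {s | eLpNorm (fun x => γ' (s, x)) 2 volume < ⊤}.piecewise
        (fun s => eLpNorm (fun x => ((γ' (s, x) : ℝ) : ℂ) - X x) 2 volume)
        (fun _ => edist (0 : LTwo) X) := by
    ext s
    by_cases hs : eLpNorm (fun x => γ' (s, x)) 2 volume < ⊤
    · have hs' : s ∈ {s | eLpNorm (fun x => γ' (s, x)) 2 volume < ⊤} := hs
      rw [piecewise_eq_of_mem _ _ _ hs', Lp.edist_def]
      refine eLpNorm_congr_ae ?_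
      filter_upwards [toL2_coe ⟨hsec s, hs⟩] with x hx
      simp [hx]
    · have hs' : s ∉ {s | eLpNorm (fun x => γ' (s, x)) 2 volume < ⊤} := hs
      rw [piecewise_eq_of_notMem _ _ _ hs', toL2, dif_neg fun h => hs h.2]
  rw [heq]
  exact hm2.piecewise hset measurable_const

variable {g : ℝ → ℝ} {k₁ k₂ : ℝ}

lemma HistMeasurable.ae_memLp {γ : ℝ → ℝ → ℝ} (h : HistMeasurable γ) (hg : MemoryKernel g k₁ k₂)
    {p : ℝ≥0∞} (hfin : histNorm g p γ < ⊤) (hp0 : p ≠ 0 := by simp) (hp : p ≠ ⊤ := by simp) :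
    ∀ᵐ s ∂(volume.restrict (Ioi (0 : ℝ))), MemLp (γ s) p volume := by
  have h1 : ∫⁻ s in Ioi (0 : ℝ), ENNReal.ofReal (g s) * eLpNorm (γ s) p volume ^ 2 ≠ ⊤ := by
    intro h0
    rw [histNorm, h0] at hfin
    simp at hfin
  filter_upwards [ae_lt_top' (hg.aemeasurable.ennreal_ofReal.mul
    ((h.aemeasurable_eLpNorm hp0 hp).pow_const 2)) h1, h.ae_aestronglyMeasurable,
    ae_restrict_mem measurableSet_Ioi] with s hs hm hs0
  refine ⟨hm, ?_⟩
  by_contra hc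
  rw [not_lt_top_iff] at hc
  have : ENNReal.ofReal (g s) ≠ 0 := by simpa using hg.pos s hs0
  simp [hc, ENNReal.mul_top this] at hs

lemma histNorm_eq (hg : MemoryKernel g k₁ k₂) {γ : ℝ → ℝ → ℝ} {F : ℝ → LTwo}
    (hF : ∀ᵐ s ∂(volume.restrict (Ioi (0 : ℝ))), ‖F s‖ₑ = eLpNorm (γ s) 2 volume) :
    eLpNorm F 2 (kernelMeasure g) = histNorm g 2 γ := by
  rw [eLpNorm_two_eq, histNorm, kernelMeasure, lintegral_withDensity_eq_lintegral_mul_non_measurable₀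
    _ hg.aemeasurable.ennreal_ofReal (Eventually.of_forall fun _ => ENNReal.ofReal_lt_top)]
  congr 1
  refine lintegral_congr_ae ?_
  filter_upwards [hF] with s hs
  simp [hs]

lemma HistMeasurable.memLp_toL2 {γ : ℝ → ℝ → ℝ} (h : HistMeasurable γ) (hg : MemoryKernel g k₁ k₂)
    (hfin : histNorm g 2 γ < ⊤) : MemLp (fun s => toL2 (γ s)) 2 (kernelMeasure g) := by
  refine ⟨h.aestronglyMeasurable_toL2.mono_ac (withDensity_absolutelyContinuous _ _), ?_⟩
  rw [histNorm_eq hg (γ := γ)]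
  · exact hfin
  · filter_upwards [h.ae_memLp hg hfin] with s hs using enorm_toL2 hs

/-- A history as an element of `L²(g(s) ds; L²(ℝ))`; junk if it is not square integrable. -/
noncomputable def histL2 (g : ℝ → ℝ) (γ : ℝ → ℝ → ℝ) : Lp LTwo 2 (kernelMeasure g) :=
  open scoped Classical in
  if h : MemLp (fun s => toL2 (γ s)) 2 (kernelMeasure g) then h.toLp _ else 0

lemma histL2_coe {γ : ℝ → ℝ → ℝ} (h : HistMeasurable γ) (hg : MemoryKernel g k₁ k₂)
    (hfin : histNorm g 2 γ < ⊤) :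
    ∀ᵐ s ∂(volume.restrict (Ioi (0 : ℝ))), histL2 g γ s = toL2 (γ s) := by
  have := h.memLp_toL2 hg hfin
  rw [← hg.ae_iff, histL2, dif_pos this]
  exact this.coeFn_toLp

lemma enorm_histL2_sub {γ γ' : ℝ → ℝ → ℝ} (h : HistMeasurable γ) (h' : HistMeasurable γ')
    (hg : MemoryKernel g k₁ k₂) (hfin : histNorm g 2 γ < ⊤) (hfin' : histNorm g 2 γ' < ⊤) :
    ‖histL2 g γ - histL2 g γ'‖ₑ = histNorm g 2 fun s x => γ s x - γ' s x := by
  rw [Lp.enorm_def, histNorm_eq hg]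
  filter_upwards [histL2_coe h hg hfin, histL2_coe h' hg hfin', h.ae_memLp hg hfin,
    h'.ae_memLp hg hfin', hg.ae_iff.1 (Lp.coeFn_sub (histL2 g γ) (histL2 g γ'))]
    with s h1 h2 h3 h4 h5
  rw [h5, Pi.sub_apply, h1, h2, ← toL2_sub h3 h4]
  exact enorm_toL2 (h3.sub h4)

end HistoryCurves

/-! ### Norms of weak derivatives -/

section DerivNorms

variable {g : ℝ → ℝ}

/-- The infimum that defines `derivNorm` is attained, by uniqueness of weak derivatives. -/
lemma derivNorm_eq {p : ℝ≥0∞} {j : ℕ} {f h : ℝ → ℝ} (H : IsWeakDeriv j f h) :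
    derivNorm p j f = eLpNorm h p volume := by
  refine le_antisymm (iInf₂_le h H) (le_iInf₂ fun h' H' => ?_)
  exact (eLpNorm_congr_ae (isWeakDeriv_unique H H')).le

lemma histDerivNorm_eq {p : ℝ≥0∞} {j : ℕ} {η h : ℝ → ℝ → ℝ} (H : IsHistDeriv j η h) :
    histDerivNorm g p j η = histNorm g p h := by
  refine le_antisymm (iInf₂_le h H) (le_iInf₂ fun h' H' => le_of_eq ?_)
  rw [histNorm, histNorm]
  congr 1
  refine lintegral_congr_ae ?_
  filter_upwards [H.2, H'.2] with s h1 h2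
  rw [eLpNorm_congr_ae (isWeakDeriv_unique h1 h2)]

lemma IsWeakDeriv.sub {j : ℕ} {f f' h h' : ℝ → ℝ} (H : IsWeakDeriv j f h)
    (H' : IsWeakDeriv j f' h') :
    IsWeakDeriv j (fun x => f x - f' x) (fun x => h x - h' x) := by
  refine ⟨H.1.sub H'.1, H.2.1.sub H'.2.1, fun φ hφ => ?_⟩
  have int : ∀ {f ψ : ℝ → ℝ}, LocallyIntegrable f → IsTest ψ → Integrable fun x => f x * ψ x :=
    fun hf hψ => by
      simpa [mul_comm] using
        hf.integrable_smul_left_of_hasCompactSupport hψ.1.continuous hψ.2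
  simp only [sub_mul]
  rw [integral_sub (int H.1 (hφ.iteratedDeriv j)) (int H'.1 (hφ.iteratedDeriv j)),
    integral_sub (int H.2.1 hφ) (int H'.2.1 hφ), H.2.2 φ hφ, H'.2.2 φ hφ]
  ring

lemma IsHistDeriv.sub {j : ℕ} {η η' h h' : ℝ → ℝ → ℝ} (H : IsHistDeriv j η h)
    (H' : IsHistDeriv j η' h') :
    IsHistDeriv j (fun s x => η s x - η' s x) (fun s x => h s x - h' s x) := by
  refine ⟨H.1.sub H'.1, ?_⟩
  filter_upwards [H.2, H'.2] with s h1 h2 using h1.sub h2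

lemma MemW.memLp {n : ℕ} {f : ℝ → ℝ} {p : ℝ≥0∞} (h : MemW n p f) : MemLp f p volume := by
  obtain ⟨h0, H, hm⟩ := h 0 (Nat.zero_le n)
  exact hm.ae_eq (isWeakDeriv_unique (isWeakDeriv_zero H.1) H).symm

lemma derivNorm_zero_eq {f : ℝ → ℝ} {p : ℝ≥0∞} (hf : LocallyIntegrable f) :
    derivNorm p 0 f = eLpNorm f p volume := derivNorm_eq (isWeakDeriv_zero hf)

end DerivNorms

/-! ### The system in Hilbert space and in frequency bands -/

section HilbertSpace

/-- `∂_t a = b₀ - ∂_x b₁ + ∂_x² b₂` in the weak sense. -/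
def WeakEvolution (a b₀ b₁ b₂ : ℝ → LTwo) : Prop :=
  ∀ φ, IsTest φ → ∀ t > 0, HasDerivAt (fun t => inner ℂ (toL2 φ) (a t))
    (inner ℂ (toL2 φ) (b₀ t) + inner ℂ (toL2 (deriv φ)) (b₁ t)
      + inner ℂ (toL2 (iteratedDeriv 2 φ)) (b₂ t)) t

/-- A solution as a curve in Hilbert space; `Γ` stands for `∂_x η`. -/
structure HilbertSolution (P : Coeffs) (v u z y θ : ℝ → LTwo)
    (Γ : ℝ → Lp LTwo 2 (kernelMeasure P.g)) : Prop where
  cont_v : ContinuousOn v (Ici 0)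
  cont_u : ContinuousOn u (Ici 0)
  cont_z : ContinuousOn z (Ici 0)
  cont_y : ContinuousOn y (Ici 0)
  cont_θ : ContinuousOn θ (Ici 0)
  cont_Γ : ContinuousOn Γ (Ici 0)
  eq_v : WeakEvolution v (fun t => -y t) (fun t => -u t) 0
  eq_u : WeakEvolution u 0 (fun t => -((P.k / P.ρ₁) • v t)) 0
  eq_z : WeakEvolution z 0 (fun t => -y t) 0
  eq_y : WeakEvolution y (fun t => (P.ρ₂⁻¹ * P.k) • v t)
    (fun t => -(P.ρ₂⁻¹ • (P.a • z t + P.m • histMean (Γ t) - P.δ • θ t))) 0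
  eq_θ : WeakEvolution θ 0 (fun t => (P.ρ₃⁻¹ * P.δ) • y t) (fun t => (P.ρ₃⁻¹ * P.βt) • θ t)
  eq_Γ : ∀ ψ, IsTest ψ → WeakEvolution (fun t => ∫ s in Ioi (0 : ℝ), ψ s • Γ t s)
    (fun t => ∫ s in Ioi (0 : ℝ), deriv ψ s • Γ t s)
    (fun t => -((∫ s in Ioi (0 : ℝ), ψ s) • y t)) 0

lemma inner_real_smul (r : ℝ) (x y : LTwo) : inner ℂ x (r • y) = (r : ℂ) * inner ℂ x y := by
  rw [RCLike.real_smul_eq_coe_smul (K := ℂ) r y, inner_smul_right]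
  rfl

lemma weakEvolution_of_real {a b₀ b₁ b₂ : ℝ → LTwo} (α α' : (ℝ → ℝ) → ℝ → ℝ)
    (ha : ∀ φ, IsTest φ → ∀ t > 0, inner ℂ (toL2 φ) (a t) = (α φ t : ℂ))
    (hd : ∀ φ, IsTest φ → ∀ t > 0, HasDerivAt (α φ) (α' φ t) t)
    (hb : ∀ φ, IsTest φ → ∀ t > 0, inner ℂ (toL2 φ) (b₀ t) + inner ℂ (toL2 (deriv φ)) (b₁ t)
      + inner ℂ (toL2 (iteratedDeriv 2 φ)) (b₂ t) = (α' φ t : ℂ)) :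
    WeakEvolution a b₀ b₁ b₂ := by
  intro φ hφ t ht
  rw [hb φ hφ t ht]
  refine (hd φ hφ t ht).ofReal_comp.congr_of_eventuallyEq ?_
  filter_upwards [Ioi_mem_nhds ht] with τ hτ using ha φ hφ τ hτ

variable {g : ℝ → ℝ} {k₁ k₂ : ℝ}

/-- A mean of the history, tested with `φ`; the derivative in `Γ = ∂_x η` is moved to `φ`. -/
lemma inner_setIntegral_hist (hg : MemoryKernel g k₁ k₂) {η γ : ℝ → ℝ → ℝ}
    (H : IsHistDeriv 1 η γ) (hfin : histNorm g 2 γ < ⊤) {w : ℝ → ℝ}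
    (hw : IntegrableOn (fun s => w s • histL2 g γ s) (Ioi 0)) {φ : ℝ → ℝ} (hφ : IsTest φ) :
    inner ℂ (toL2 φ) (∫ s in Ioi (0 : ℝ), w s • histL2 g γ s)
      = ((-∫ s in Ioi (0 : ℝ), w s * ∫ x, η s x * deriv φ x : ℝ) : ℂ) := by
  rw [← integral_inner hw, ← integral_neg, ← integral_complex_ofReal]
  refine integral_congr_ae ?_
  filter_upwards [histL2_coe H.1 hg hfin, H.2, H.1.ae_memLp hg hfin] with s h1 h2 h3
  have h4 := h2.2.2 φ hφ
  rw [iteratedDeriv_one, pow_one] at h4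
  rw [inner_real_smul, h1, inner_toL2_toL2 (hφ.memLp 2) h3, h4]
  push_cast
  ring

lemma continuousOn_of_enorm_sub_le {X : Type*} [NormedAddCommGroup X] {f : ℝ → X}
    {N : ℝ → ℝ → ℝ≥0∞} (h : ∀ t ≥ 0, ∀ t₀ ≥ 0, ‖f t - f t₀‖ₑ ≤ N t t₀)
    (hN : ∀ t₀ ≥ 0, Tendsto (fun t => N t t₀) (𝓝[Ici 0] t₀) (𝓝 0)) : ContinuousOn f (Ici 0) := by
  intro t₀ ht₀
  rw [ContinuousWithinAt, tendsto_iff_edist_tendsto_0]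
  refine tendsto_of_tendsto_of_tendsto_of_le_of_le' tendsto_const_nhds (hN t₀ ht₀)
    (Eventually.of_forall fun _ => zero_le) ?_
  refine eventually_nhdsWithin_of_forall fun t ht => ?_
  rw [edist_eq_enorm_sub]
  exact h t ht t₀ ht₀

lemma le_norm_add_components (g : ℝ → ℝ) (p : ℝ≥0∞) (j : ℕ) (V : State) :
    derivNorm p j V.v ≤ V.norm g p j ∧ derivNorm p j V.u ≤ V.norm g p j ∧
    derivNorm p j V.z ≤ V.norm g p j ∧ derivNorm p j V.y ≤ V.norm g p j ∧
    derivNorm p j V.θ ≤ V.norm g p j ∧ histDerivNorm g p (j + 1) V.η ≤ V.norm g p j := by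
  unfold State.norm
  refine ⟨?_, ?_, ?_, ?_, ?_, le_add_self⟩
  · exact ((le_self_add.trans le_self_add).trans (le_self_add.trans le_self_add)).trans le_self_add
  · exact ((le_add_self.trans le_self_add).trans (le_self_add.trans le_self_add)).trans le_self_add
  · exact (le_add_self.trans (le_self_add.trans le_self_add)).trans le_self_add
  · exact (le_add_self.trans le_self_add).trans le_self_add
  · exact le_add_self.trans le_self_add

lemma enorm_toL2_sub_le {f f' : ℝ → ℝ} (hf : MemW 0 2 f) (hf' : MemW 0 2 f') :
    ‖toL2 f - toL2 f'‖ₑ ≤ derivNorm 2 0 fun x => f x - f' x := by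
  have m := hf.memLp.sub hf'.memLp
  rw [← toL2_sub hf.memLp hf'.memLp]
  exact (enorm_toL2 m).le.trans (derivNorm_zero_eq (m.locallyIntegrable one_le_two)).ge

/-- A weak solution is a continuous curve of square integrable functions. The history equation is
tested with `φ'` to obtain the one for `Γ = ∂_x η`. -/
theorem IsSolution.exists_hilbertSolution {P : Coeffs} (hP : P.Admissible)
    (hg : MemoryKernel P.g k₁ k₂) {V₀ : State} {V : ℝ → State} (h : IsSolution P V₀ V) :
    ∃ γ : ℝ → ℝ → ℝ → ℝ,
      (∀ t ≥ 0, IsHistDeriv 1 (V t).η (γ t) ∧ histNorm P.g 2 (γ t) < ⊤) ∧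
      HilbertSolution P (fun t => toL2 (V t).v) (fun t => toL2 (V t).u) (fun t => toL2 (V t).z)
        (fun t => toL2 (V t).y) (fun t => toL2 (V t).θ) (fun t => histL2 P.g (γ t)) := by
  have := hg.isFiniteMeasure
  have hex : ∀ t, ∃ γ : ℝ → ℝ → ℝ, t ≥ 0 → IsHistDeriv 1 (V t).η γ ∧ histNorm P.g 2 γ < ⊤ := by
    intro t
    by_cases ht : t ≥ 0
    · obtain ⟨γ, h1, h2⟩ := (h.mem t ht).2.2.2.2.2.2 1 (by simp)
      exact ⟨γ, fun _ => ⟨h1, h2⟩⟩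
    · exact ⟨0, fun h => absurd h ht⟩
  choose γ hγ using hex
  have hc : ∀ t₀ ≥ 0, Tendsto (fun t => ((V t).sub (V t₀)).norm P.g 2 0) (𝓝[Ici 0] t₀) (𝓝 0) :=
    fun t₀ ht₀ => tendsto_of_tendsto_of_tendsto_of_le_of_le tendsto_const_nhds
      (h.continuous t₀ ht₀) (fun _ => zero_le) fun _ => le_self_add
  have le := fun t t₀ => le_norm_add_components P.g 2 0 ((V t).sub (V t₀))
  have mv := fun t ht => (h.mem t ht).1
  have mu := fun t ht => (h.mem t ht).2.1
  have mz := fun t ht => (h.mem t ht).2.2.1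
  have my := fun t ht => (h.mem t ht).2.2.2.1
  have mθ := fun t ht => (h.mem t ht).2.2.2.2.1
  have hi : ∀ t (w : ℝ → ℝ), IsTest w →
      IntegrableOn (fun s => w s • histL2 P.g (γ t) s) (Ioi 0) := fun t w hw =>
    hg.integrable_test_smul hw _
  have hd1 := fun {φ : ℝ → ℝ} (hφ : IsTest φ) => hφ.deriv.memLp 2
  have hd2 := fun {φ : ℝ → ℝ} (hφ : IsTest φ) => (hφ.iteratedDeriv 2).memLp 2
  refine ⟨γ, hγ, ?_, ?_, ?_, ?_, ?_, ?_, ?_, ?_, ?_, ?_, ?_, ?_⟩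
  · exact continuousOn_of_enorm_sub_le (fun t ht t₀ ht₀ =>
      (enorm_toL2_sub_le (mv t ht) (mv t₀ ht₀)).trans (le t t₀).1) hc
  · exact continuousOn_of_enorm_sub_le (fun t ht t₀ ht₀ =>
      (enorm_toL2_sub_le (mu t ht) (mu t₀ ht₀)).trans (le t t₀).2.1) hc
  · exact continuousOn_of_enorm_sub_le (fun t ht t₀ ht₀ =>
      (enorm_toL2_sub_le (mz t ht) (mz t₀ ht₀)).trans (le t t₀).2.2.1) hc
  · exact continuousOn_of_enorm_sub_le (fun t ht t₀ ht₀ =>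
      (enorm_toL2_sub_le (my t ht) (my t₀ ht₀)).trans (le t t₀).2.2.2.1) hc
  · exact continuousOn_of_enorm_sub_le (fun t ht t₀ ht₀ =>
      (enorm_toL2_sub_le (mθ t ht) (mθ t₀ ht₀)).trans (le t t₀).2.2.2.2.1) hc
  · refine continuousOn_of_enorm_sub_le (fun t ht t₀ ht₀ => ?_) hc
    rw [enorm_histL2_sub (hγ t ht).1.1 (hγ t₀ ht₀).1.1 hg (hγ t ht).2 (hγ t₀ ht₀).2,
      ← histDerivNorm_eq ((hγ t ht).1.sub (hγ t₀ ht₀).1)]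
    exact (le t t₀).2.2.2.2.2
  · refine weakEvolution_of_real _ _ (fun φ hφ t ht =>
      inner_toL2_toL2 (hφ.memLp 2) (mv t ht.le).memLp) h.eq_v fun φ hφ t ht => ?_
    rw [inner_neg_right, inner_neg_right, inner_toL2_toL2 (hφ.memLp 2) (my t ht.le).memLp,
      inner_toL2_toL2 (hd1 hφ) (mu t ht.le).memLp, Pi.zero_apply, inner_zero_right]
    push_cast
    ring
  · refine weakEvolution_of_real _ _ (fun φ hφ t ht =>
      inner_toL2_toL2 (hφ.memLp 2) (mu t ht.le).memLp)
      (fun φ hφ t ht => ((h.eq_u φ hφ t ht).const_mul P.ρ₁⁻¹).congr_of_eventuallyEq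
        (Eventually.of_forall fun τ => (inv_mul_cancel_left₀ hP.ρ₁_pos.ne' _).symm))
      fun φ hφ t ht => ?_
    rw [inner_neg_right, inner_real_smul, inner_toL2_toL2 (hd1 hφ) (mv t ht.le).memLp]
    simp only [Pi.zero_apply, inner_zero_right]
    push_cast
    ring
  · refine weakEvolution_of_real _ _ (fun φ hφ t ht =>
      inner_toL2_toL2 (hφ.memLp 2) (mz t ht.le).memLp) h.eq_z fun φ hφ t ht => ?_
    rw [inner_neg_right, inner_toL2_toL2 (hd1 hφ) (my t ht.le).memLp]
    simp only [Pi.zero_apply, inner_zero_right]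
    push_cast
    ring
  · refine weakEvolution_of_real _ _ (fun φ hφ t ht =>
      inner_toL2_toL2 (hφ.memLp 2) (my t ht.le).memLp)
      (fun φ hφ t ht => ((h.eq_y φ hφ t ht).const_mul P.ρ₂⁻¹).congr_of_eventuallyEq
        (Eventually.of_forall fun τ => (inv_mul_cancel_left₀ hP.ρ₂_pos.ne' _).symm))
      fun φ hφ t ht => ?_
    have hW : inner ℂ (toL2 (deriv φ)) (histMean (histL2 P.g (γ t)))
        = ((-∫ s in Ioi (0 : ℝ), P.g s * ∫ x, (V t).η s x * iteratedDeriv 2 φ x : ℝ) : ℂ) := by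
      rw [histMean, hg.integral_eq, inner_setIntegral_hist hg (hγ t ht.le).1 (hγ t ht.le).2
        (hg.integrable_iff.1 (integrable_coe _)) hφ.deriv]
      simp only [iteratedDeriv_succ, iteratedDeriv_zero]
    rw [inner_neg_right, inner_real_smul, inner_real_smul, inner_sub_right, inner_add_right,
      inner_real_smul, inner_real_smul, inner_real_smul, hW,
      inner_toL2_toL2 (hφ.memLp 2) (mv t ht.le).memLp,
      inner_toL2_toL2 (hd1 hφ) (mz t ht.le).memLp, inner_toL2_toL2 (hd1 hφ) (mθ t ht.le).memLp,
      Pi.zero_apply, inner_zero_right]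
    push_cast
    ring
  · refine weakEvolution_of_real _ _ (fun φ hφ t ht =>
      inner_toL2_toL2 (hφ.memLp 2) (mθ t ht.le).memLp)
      (fun φ hφ t ht => ((h.eq_θ φ hφ t ht).const_mul P.ρ₃⁻¹).congr_of_eventuallyEq
        (Eventually.of_forall fun τ => (inv_mul_cancel_left₀ hP.ρ₃_pos.ne' _).symm))
      fun φ hφ t ht => ?_
    rw [inner_real_smul, inner_real_smul, inner_toL2_toL2 (hd1 hφ) (my t ht.le).memLp,
      inner_toL2_toL2 (hd2 hφ) (mθ t ht.le).memLp, Pi.zero_apply, inner_zero_right]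
    push_cast
    ring
  · intro ψ hψ
    refine weakEvolution_of_real _ _ (fun φ hφ t ht =>
      inner_setIntegral_hist hg (hγ t ht.le).1 (hγ t ht.le).2 (hi t ψ hψ) hφ)
      (fun φ hφ t ht => (h.eq_η _ ψ hφ.deriv hψ t ht).neg) fun φ hφ t ht => ?_
    rw [inner_setIntegral_hist hg (hγ t ht.le).1 (hγ t ht.le).2 (hi t _ hψ.deriv) hφ,
      inner_neg_right, inner_real_smul, inner_toL2_toL2 (hd1 hφ) (my t ht.le).memLp,
      Pi.zero_apply, inner_zero_right]
    push_cast
    ring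

/-- A weak evolution equation on the line is a genuine differential equation in the band. -/
lemma WeakEvolution.band {a b₀ b₁ b₂ : ℝ → LTwo} (h : WeakEvolution a b₀ b₁ b₂) (B : Band)
    (h₀ : ContinuousOn b₀ (Ici 0)) (h₁ : ContinuousOn b₁ (Ici 0)) (h₂ : ContinuousOn b₂ (Ici 0))
    {t : ℝ} (ht : 0 < t) {d : LTwo}
    (hd : B.comp (b₀ t) - B.D (B.comp (b₁ t)) + B.D (B.D (B.comp (b₂ t))) = d) :
    HasDerivAt (fun t => B.comp (a t)) d t :=
  hd ▸ B.hasDerivAt_comp h₀ h₁ h₂ h ht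

/-- The part of a history in a frequency band. -/
noncomputable def Band.hist (B : Band) (g : ℝ → ℝ) :
    Lp LTwo 2 (kernelMeasure g) →L[ℝ] Lp LTwo 2 (kernelMeasure g) :=
  B.comp.compLpL 2 (kernelMeasure g)

lemma Band.hist_coe (B : Band) (hg : MemoryKernel g k₁ k₂) (Γ : Lp LTwo 2 (kernelMeasure g)) :
    ∀ᵐ s ∂(volume.restrict (Ioi (0 : ℝ))), B.hist g Γ s = B.comp (Γ s) :=
  hg.ae_iff.1 (B.comp.coeFn_compLp Γ)

lemma Band.setIntegral_hist (B : Band) (hg : MemoryKernel g k₁ k₂) {w : ℝ → ℝ}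
    (Γ : Lp LTwo 2 (kernelMeasure g)) (hw : IntegrableOn (fun s => w s • Γ s) (Ioi 0)) :
    ∫ s in Ioi (0 : ℝ), w s • B.hist g Γ s = B.comp (∫ s in Ioi (0 : ℝ), w s • Γ s) := by
  rw [← B.comp.integral_comp_comm hw]
  refine integral_congr_ae ?_
  filter_upwards [B.hist_coe hg Γ] with s hs
  rw [hs, map_smul]

lemma continuousOn_integral_test_smul {E : Type*} [NormedAddCommGroup E] [InnerProductSpace ℝ E]
    (hg : MemoryKernel g k₁ k₂) {Γ : ℝ → Lp E 2 (kernelMeasure g)}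
    (hΓ : ContinuousOn Γ (Ici 0)) {ψ : ℝ → ℝ} (hψ : IsTest ψ) :
    ContinuousOn (fun t => ∫ s in Ioi (0 : ℝ), ψ s • Γ t s) (Ici 0) := by
  obtain ⟨M, hM0, hM⟩ := hψ.exists_support_bound
  obtain ⟨C, hC0, hC⟩ := hψ.exists_bound
  obtain ⟨C', hC'0, hC'⟩ := hg.exists_setIntegral_Ioc_le (E := E) M
  have hL : LipschitzWith (Real.toNNReal (C * C'))
      (fun G : Lp E 2 (kernelMeasure g) => ∫ s in Ioi (0 : ℝ), ψ s • G s) :=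
    LipschitzWith.of_dist_le_mul fun G G' => by
      rw [dist_eq_norm, dist_eq_norm, Real.coe_toNNReal _ (by positivity),
        ← integral_sub (hg.integrable_test_smul hψ G) (hg.integrable_test_smul hψ G')]
      have e : ∫ s in Ioi (0 : ℝ), (ψ s • G s - ψ s • G' s)
          = ∫ s in Ioc 0 M, ψ s • (G - G' : Lp E 2 (kernelMeasure g)) s := by
        rw [← setIntegral_test_smul_eq hM0.le hM]
        refine integral_congr_ae ?_
        filter_upwards [hg.ae_iff.1 (Lp.coeFn_sub G G')] with s hs
        rw [hs, Pi.sub_apply, smul_sub]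
      rw [e, mul_assoc]
      refine (norm_integral_le_of_norm_le ((hg.integrableOn_Ioc (G - G') M).norm.const_mul C)
        (Eventually.of_forall fun s => ?_)).trans ?_
      · rw [norm_smul]
        exact mul_le_mul_of_nonneg_right (hC s) (norm_nonneg _)
      · rw [integral_const_mul]
        exact mul_le_mul_of_nonneg_left (hC' _) hC0
  exact hL.continuous.comp_continuousOn hΓ

variable {P : Coeffs} {v u z y θ : ℝ → LTwo} {Γ : ℝ → Lp LTwo 2 (kernelMeasure P.g)}

/-- In a band, `∂_x η` is transported with the source `∂_x y`. -/
lemma HilbertSolution.memoryFlow (h : HilbertSolution P v u z y θ Γ)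
    (hg : MemoryKernel P.g k₁ k₂) (B : Band) :
    MemoryFlow P.g (fun t => B.hist P.g (Γ t)) (fun t => B.D (B.comp (y t))) where
  cont := (B.hist P.g).continuous.comp_continuousOn h.cont_Γ
  cont_c := (B.D ∘L B.comp).continuous.comp_continuousOn h.cont_y
  transport ψ hψ t ht := by
    have hd := (h.eq_Γ ψ hψ).band B (continuousOn_integral_test_smul hg h.cont_Γ hψ.deriv)
      (h.cont_y.const_smul (∫ s in Ioi (0 : ℝ), ψ s)).neg continuousOn_const ht
      (d := (∫ s in Ioi (0 : ℝ), deriv ψ s • B.hist P.g (Γ t) s)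
        + (∫ s in Ioi (0 : ℝ), ψ s) • B.D (B.comp (y t))) (by
        rw [B.setIntegral_hist hg _ (hg.integrable_test_smul hψ.deriv _)]
        simp only [map_neg, map_smul, Pi.zero_apply, map_zero, sub_neg_eq_add, add_zero])
    exact hd.congr_of_eventuallyEq (Eventually.of_forall fun τ =>
      B.setIntegral_hist hg _ (hg.integrable_test_smul hψ _))

/-- In each band a solution is a band evolution, with the same constants for all bands. -/
theorem HilbertSolution.bandEvolution (h : HilbertSolution P v u z y θ Γ)
    (hg : MemoryKernel P.g k₁ k₂) (B : Band) :
    BandEvolution P k₂ ((1 + k₁) * √((kernelMeasure P.g).real univ)) B.D (fun t => B.comp (v t))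
      (fun t => B.comp (u t)) (fun t => B.comp (z t)) (fun t => B.comp (y t))
      (fun t => B.comp (θ t)) (fun t => histMean (B.hist P.g (Γ t)))
      (fun t => histDerivMean (B.hist P.g (Γ t))) (fun t => ‖B.hist P.g (Γ t)‖ ^ 2) := by
  have := hg.isFiniteMeasure
  have hf := h.memoryFlow hg B
  have hk₁ := hg.k₁_pos
  have cW : ContinuousOn (fun t => histMean (Γ t)) (Ici 0) :=
    hg.continuous_histMean.comp_continuousOn h.cont_Γ
  have c0 : ContinuousOn (0 : ℝ → LTwo) (Ici 0) := continuousOn_const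
  have hW : ∀ t, histMean (B.hist P.g (Γ t)) = B.comp (histMean (Γ t)) := fun t => by
    rw [histMean, histMean, hg.integral_eq, hg.integral_eq]
    exact B.setIntegral_hist hg _ (hg.integrable_iff.1 (integrable_coe _))
  have sq : ∀ {x n c : ℝ}, 0 ≤ x → x ≤ c * n → x ^ 2 ≤ c ^ 2 * n ^ 2 := fun hx hxn => by
    rw [← mul_pow]
    exact pow_le_pow_left₀ hx hxn 2
  refine
    { skew := B.skew
      cont_v := B.comp.continuous.comp_continuousOn h.cont_v
      cont_u := B.comp.continuous.comp_continuousOn h.cont_u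
      cont_z := B.comp.continuous.comp_continuousOn h.cont_z
      cont_y := B.comp.continuous.comp_continuousOn h.cont_y
      cont_θ := B.comp.continuous.comp_continuousOn h.cont_θ
      cont_W := hg.continuous_histMean.comp_continuousOn hf.cont
      cont_N := hf.cont.norm.pow 2
      deriv_v := fun t ht => ?_
      deriv_u := fun t ht => ?_
      deriv_z := fun t ht => ?_
      deriv_y := fun t ht => ?_
      deriv_θ := fun t ht => ?_
      deriv_W := fun t ht => hf.hasDerivWithinAt_histMean hg ht
      N_nonneg := fun t _ => sq_nonneg _
      norm_W := fun t _ => sq (norm_nonneg _) ((hg.norm_histMean_le _).trans ?_)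
      norm_R := fun t _ => sq (norm_nonneg _) ((hg.norm_histDerivMean_le _).trans ?_)
      touch_N := fun t ht => hf.exists_touch hg ht }
  · refine h.eq_v.band B h.cont_y.neg h.cont_u.neg c0 ht ?_
    simp only [map_neg, Pi.zero_apply, map_zero]
    abel
  · refine h.eq_u.band B c0 (h.cont_v.const_smul (P.k / P.ρ₁)).neg c0 ht ?_
    simp only [map_neg, map_smul, Pi.zero_apply, map_zero]
    abel
  · refine h.eq_z.band B c0 h.cont_y.neg c0 ht ?_
    simp only [map_neg, Pi.zero_apply, map_zero]
    abel
  · refine h.eq_y.band B (h.cont_v.const_smul (P.ρ₂⁻¹ * P.k)) ((((h.cont_z.const_smul P.a).add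
      (cW.const_smul P.m)).sub (h.cont_θ.const_smul P.δ)).const_smul P.ρ₂⁻¹).neg c0 ht ?_
    simp only [hW, map_neg, map_smul, map_sub, map_add, Pi.zero_apply, map_zero, mul_smul]
    module
  · refine h.eq_θ.band B c0 (h.cont_y.const_smul (P.ρ₃⁻¹ * P.δ))
      (h.cont_θ.const_smul (P.ρ₃⁻¹ * P.βt)) ht ?_
    simp only [map_smul, Pi.zero_apply, map_zero]
    module
  · have := Real.sqrt_nonneg ((kernelMeasure P.g).real univ)
    have := norm_nonneg (B.hist P.g (Γ t))
    gcongr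
    nlinarith
  · have h1 := Real.sqrt_nonneg ((kernelMeasure P.g).real univ)
    have h2 := norm_nonneg (B.hist P.g (Γ t))
    rw [mul_assoc]
    exact mul_le_mul_of_nonneg_right (by linarith) (mul_nonneg h1 h2)

end HilbertSpace

/-! ### The dyadic decomposition of the frequencies -/

section Dyadic

open scoped FourierTransform RealInnerProductSpace

lemma measurable_norm_symbol : Measurable fun ξ => ‖symbol ξ‖ :=
  continuous_symbol.norm.measurable

lemma volume_norm_symbol_lt_le (ν : ℝ) :
    volume {ξ | ‖symbol ξ‖ < ν} ≤ ENNReal.ofReal ν := by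
  have hsub : {ξ | ‖symbol ξ‖ < ν} ⊆ Metric.ball 0 (ν / 2) := by
    intro ξ hξ
    rw [mem_ofPred_eq, norm_symbol] at hξ
    rw [Metric.mem_ball, Real.dist_eq, sub_zero]
    nlinarith [Real.pi_gt_three, abs_nonneg ξ]
  refine (measure_mono hsub).trans (le_of_eq ?_)
  rw [Real.volume_ball]
  congr 1
  ring

/-- The band `ν ≤ |2πξ| < 2ν`. -/
noncomputable def dyadicBand (ν : ℝ) : Band where
  S := {ξ | ‖symbol ξ‖ ∈ Ico ν (2 * ν)}
  d := {ξ | ‖symbol ξ‖ ∈ Ico ν (2 * ν)}.piecewise symbol fun _ => ν * Complex.I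
  measurableSet := measurable_norm_symbol measurableSet_Ico
  memLp := by
    refine memLp_top_of_bound (C := |2 * ν| + |ν|) ?_ (Eventually.of_forall fun ξ => ?_)
    · exact (continuous_symbol.measurable.piecewise (measurable_norm_symbol measurableSet_Ico)
        measurable_const).aestronglyMeasurable
    · by_cases h : ξ ∈ {ξ | ‖symbol ξ‖ ∈ Ico ν (2 * ν)}
      · rw [piecewise_eq_of_mem _ _ _ h]
        have := h.2
        linarith [le_abs_self (2 * ν), abs_nonneg ν]
      · rw [piecewise_eq_of_notMem _ _ _ h]
        simp
  eq_symbol ξ h := piecewise_eq_of_mem _ _ _ h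
  re_eq_zero ξ := by
    by_cases h : ξ ∈ {ξ | ‖symbol ξ‖ ∈ Ico ν (2 * ν)}
    · rw [piecewise_eq_of_mem _ _ _ h]
      simp [symbol]
    · rw [piecewise_eq_of_notMem _ _ _ h]
      simp

/-- The band `|2πξ| < ν`. -/
noncomputable def lowBand (ν : ℝ) : Band where
  S := {ξ | ‖symbol ξ‖ < ν}
  d := {ξ | ‖symbol ξ‖ < ν}.indicator symbol
  measurableSet := measurable_norm_symbol measurableSet_Iio
  memLp := by
    refine memLp_top_of_bound (C := |ν|) ?_ (Eventually.of_forall fun ξ => ?_)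
    · exact (continuous_symbol.measurable.indicator
        (measurable_norm_symbol measurableSet_Iio)).aestronglyMeasurable
    · by_cases h : ξ ∈ {ξ | ‖symbol ξ‖ < ν}
      · rw [indicator_of_mem h]
        exact (le_of_lt h).trans (le_abs_self ν)
      · rw [indicator_of_notMem h]
        simp
  eq_symbol ξ h := indicator_of_mem h _
  re_eq_zero ξ := by
    by_cases h : ξ ∈ {ξ | ‖symbol ξ‖ < ν}
    · rw [indicator_of_mem h]
      simp [symbol]
    · rw [indicator_of_notMem h]
      simp

lemma norm_dyadicBand_d {ν : ℝ} (hν : 0 < ν) (ξ : ℝ) :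
    ν ≤ ‖(dyadicBand ν).d ξ‖ ∧ ‖(dyadicBand ν).d ξ‖ ≤ 2 * ν := by
  by_cases h : ξ ∈ {ξ | ‖symbol ξ‖ ∈ Ico ν (2 * ν)}
  · have e : (dyadicBand ν).d ξ = symbol ξ := (dyadicBand ν).eq_symbol ξ h
    rw [e]
    exact ⟨h.1, h.2.le⟩
  · have e : (dyadicBand ν).d ξ = ν * Complex.I := by
      simp only [dyadicBand]
      exact piecewise_eq_of_notMem _ _ _ h
    rw [e]
    simp [abs_of_pos hν]
    linarith

lemma le_norm_dyadicBand_D {ν : ℝ} (hν : 0 < ν) (x : LTwo) :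
    ν * ‖x‖ ≤ ‖(dyadicBand ν).D x‖ :=
  le_norm_mulOp _ hν (fun ξ => (norm_dyadicBand_d hν ξ).1) x

lemma norm_dyadicBand_D_le {ν : ℝ} (hν : 0 < ν) (x : LTwo) :
    ‖(dyadicBand ν).D x‖ ≤ 2 * ν * ‖x‖ :=
  norm_mulOp_le _ (fun ξ => (norm_dyadicBand_d hν ξ).2) x

lemma enorm_sq_eq_lintegral (f : LTwo) : ‖f‖ₑ ^ 2 = ∫⁻ ξ, ‖f ξ‖ₑ ^ 2 := by
  rw [Lp.enorm_def, eLpNorm_two_sq]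

lemma Band.enorm_comp_sq (B : Band) (f : LTwo) :
    ‖B.comp f‖ₑ ^ 2 = ∫⁻ ξ in B.S, ‖(𝓕 f : LTwo) ξ‖ₑ ^ 2 := by
  rw [enorm_sq_eq_lintegral, ← lintegral_indicator B.measurableSet]
  refine lintegral_congr_ae ?_
  filter_upwards [B.comp_coe f] with ξ hξ
  rw [hξ]
  by_cases h : ξ ∈ B.S <;> simp [h]

/-- The contribution of a band of finite measure is controlled by the `L¹` norm, since the Fourier
transform of an integrable function is bounded. -/
lemma Band.enorm_comp_toL2_sq_le (B : Band) {f : ℝ → ℝ} (hf : MemLp f 2 volume)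
    (hf1 : Integrable f) : ‖B.comp (toL2 f)‖ₑ ^ 2 ≤ volume B.S * eLpNorm f 1 volume ^ 2 := by
  rw [B.enorm_comp_sq]
  have h : ∫⁻ ξ in B.S, ‖(𝓕 (toL2 f) : LTwo) ξ‖ₑ ^ 2 ≤ ∫⁻ _ in B.S, eLpNorm f 1 volume ^ 2 := by
    refine lintegral_mono_ae (ae_restrict_of_ae ?_)
    filter_upwards [norm_fourier_toL2_le hf hf1] with ξ hξ
    rw [eLpNorm_one_eq_lintegral_enorm]
    gcongr
    rw [← ofReal_integral_norm_eq_lintegral_enorm hf1, ← ofReal_norm]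
    exact ENNReal.ofReal_le_ofReal hξ
  refine h.trans (le_of_eq ?_)
  rw [lintegral_const, Measure.restrict_apply_univ, mul_comm]

/-- The squared norm of `∂_x^k f` on the Fourier side. -/
noncomputable def weightedEnergy (k : ℕ) (f : LTwo) : ℝ≥0∞ :=
  ∫⁻ ξ, ‖symbol ξ‖ₑ ^ (2 * k) * ‖(𝓕 f : LTwo) ξ‖ₑ ^ 2

lemma enorm_symbol_eq (ξ : ℝ) : ‖symbol ξ‖ₑ = ENNReal.ofReal ‖symbol ξ‖ :=
  (ofReal_norm _).symm

lemma pairwise_disjoint_dyadic {ν : ℝ} (hν : 0 < ν) :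
    Pairwise (Function.onFun Disjoint fun n : ℕ => (dyadicBand (2 ^ n * ν)).S) := by
  have key : ∀ m n : ℕ, m < n →
      Disjoint (dyadicBand (2 ^ m * ν)).S (dyadicBand (2 ^ n * ν)).S := by
    intro m n hmn
    rw [Set.disjoint_left]
    intro ξ h1 h2
    have h3 : ‖symbol ξ‖ < 2 * (2 ^ m * ν) := h1.2
    have h4 : 2 ^ n * ν ≤ ‖symbol ξ‖ := h2.1
    have h5 : (2 : ℝ) ^ (m + 1) ≤ 2 ^ n := pow_le_pow_right₀ one_le_two hmn
    have := mul_le_mul_of_nonneg_right h5 hν.le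
    rw [pow_succ] at this
    linarith
  intro m n hmn
  rcases lt_or_gt_of_ne hmn with h | h
  · exact key m n h
  · exact (key n m h).symm

/-- The bands above `ν` are disjoint, and the weight is at least `(2 ^ n * ν) ^ (2 * j)` on them. -/
lemma tsum_dyadic_le {ν : ℝ} (hν : 0 < ν) (j : ℕ) (f : LTwo) :
    ∑' n : ℕ, ENNReal.ofReal ((2 ^ n * ν) ^ (2 * j)) * ‖(dyadicBand (2 ^ n * ν)).comp f‖ₑ ^ 2
      ≤ weightedEnergy j f := by
  have h : ∀ n : ℕ, ENNReal.ofReal ((2 ^ n * ν) ^ (2 * j))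
      * ‖(dyadicBand (2 ^ n * ν)).comp f‖ₑ ^ 2 ≤ ∫⁻ ξ in (dyadicBand (2 ^ n * ν)).S,
        ‖symbol ξ‖ₑ ^ (2 * j) * ‖(𝓕 f : LTwo) ξ‖ₑ ^ 2 := by
    intro n
    rw [Band.enorm_comp_sq, ← lintegral_const_mul' _ _ ENNReal.ofReal_ne_top]
    refine setLIntegral_mono' (dyadicBand _).measurableSet fun ξ hξ => ?_
    gcongr
    rw [enorm_symbol_eq, ← ENNReal.ofReal_pow (norm_nonneg _)]
    exact ENNReal.ofReal_le_ofReal (pow_le_pow_left₀ (by positivity) hξ.1 _)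
  refine (ENNReal.tsum_le_tsum h).trans ?_
  rw [← lintegral_iUnion (fun n => (dyadicBand (2 ^ n * ν)).measurableSet)
    (pairwise_disjoint_dyadic hν)]
  exact setLIntegral_le_lintegral _ _

/-- The low band and the dyadic bands cover the line, and the weight is at most
`(2 * (2 ^ n * ν)) ^ (2 * k)` on the bands. -/
lemma weightedEnergy_le_tsum {ν : ℝ} (hν : 0 < ν) (k : ℕ) (f : LTwo) :
    weightedEnergy k f ≤ ENNReal.ofReal (ν ^ (2 * k)) * ‖(lowBand ν).comp f‖ₑ ^ 2
      + ∑' n : ℕ, ENNReal.ofReal ((2 * (2 ^ n * ν)) ^ (2 * k))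
        * ‖(dyadicBand (2 ^ n * ν)).comp f‖ₑ ^ 2 := by
  have hcover : (univ : Set ℝ) = (lowBand ν).S ∪ ⋃ n : ℕ, (dyadicBand (2 ^ n * ν)).S := by
    refine (eq_univ_of_forall fun ξ => ?_).symm
    by_cases h : ‖symbol ξ‖ < ν
    · exact Or.inl h
    · have h1 : 1 ≤ ‖symbol ξ‖ / ν := by rw [one_le_div hν]; exact not_lt.1 h
      obtain ⟨n, hn⟩ := exists_nat_pow_near h1 one_lt_two
      refine Or.inr (mem_iUnion.2 ⟨n, ?_, ?_⟩)
      · exact (le_div_iff₀ hν).1 hn.1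
      · have := (div_lt_iff₀ hν).1 hn.2
        rw [pow_succ] at this
        change ‖symbol ξ‖ < 2 * (2 ^ n * ν)
        linarith
  have hband : ∀ (B : Band) (c : ℝ), (∀ ξ ∈ B.S, ‖symbol ξ‖ ≤ c) →
      ∫⁻ ξ in B.S, ‖symbol ξ‖ₑ ^ (2 * k) * ‖(𝓕 f : LTwo) ξ‖ₑ ^ 2
        ≤ ENNReal.ofReal (c ^ (2 * k)) * ‖B.comp f‖ₑ ^ 2 := by
    intro B c hc
    rw [Band.enorm_comp_sq, ← lintegral_const_mul' _ _ ENNReal.ofReal_ne_top]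
    refine setLIntegral_mono' B.measurableSet fun ξ hξ => ?_
    gcongr
    rw [enorm_symbol_eq, ← ENNReal.ofReal_pow (norm_nonneg _)]
    exact ENNReal.ofReal_le_ofReal (pow_le_pow_left₀ (norm_nonneg _) (hc ξ hξ) _)
  rw [weightedEnergy, ← setLIntegral_univ, hcover]
  refine (lintegral_union_le _ _ _).trans (add_le_add ?_ ?_)
  · exact hband _ _ fun ξ hξ => le_of_lt hξ
  · refine (lintegral_iUnion_le _ _).trans (ENNReal.tsum_le_tsum fun n => ?_)
    exact hband _ _ fun ξ hξ => le_of_lt hξ.2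

end Dyadic

/-! ### Representatives of curves in `L²(ℝ)` -/

section Representatives

open scoped FourierTransform

lemma continuous_setIntegral_LTwo {S : Set ℝ} (hS : MeasurableSet S) (hfin : volume S ≠ ⊤) :
    Continuous fun f : LTwo => ∫ x in S, f x := by
  have : (fun f : LTwo => ∫ x in S, f x)
      = fun f => inner ℂ (indicatorConstLp 2 hS hfin (1 : ℂ)) f := by
    ext f
    rw [L2.inner_indicatorConstLp_one]
  rw [this]
  exact continuous_const.inner continuous_id

/-- A measurable curve in `L²(ℝ)` has a jointly measurable representative: by Lebesgue's theorem its
values are limits of the difference quotients of the primitives. -/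
lemma exists_joint_representative {μ : Measure ℝ} {F : ℝ → LTwo}
    (hF : AEStronglyMeasurable F μ) :
    ∃ f : ℝ × ℝ → ℂ, StronglyMeasurable f ∧ ∀ᵐ s ∂μ, (fun x => f (s, x)) =ᵐ[volume] F s := by
  obtain ⟨F', hF', hae⟩ := hF
  have hloc : ∀ f : LTwo, LocallyIntegrable f := fun f =>
    (Lp.memLp f).locallyIntegrable one_le_two
  let p : ℝ → ℝ → ℂ := fun x s => ∫ r in (0 : ℝ)..x, F' s r
  have hp : StronglyMeasurable (Function.uncurry p) := by
    refine stronglyMeasurable_uncurry_of_continuous_of_stronglyMeasurable (fun s => ?_) fun x => ?_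
    · exact intervalIntegral.continuous_primitive (fun a b =>
        (LocallyIntegrable.integrableOn_isCompact (hloc (F' s)) isCompact_uIcc).intervalIntegrable) 0
    · have : Continuous fun f : LTwo => ∫ r in (0 : ℝ)..x, f r :=
        (continuous_setIntegral_LTwo measurableSet_Ioc (by simp)).sub
          (continuous_setIntegral_LTwo measurableSet_Ioc (by simp))
      exact this.comp_stronglyMeasurable hF'
  let q : ℕ → ℝ × ℝ → ℂ := fun n z => ((n : ℝ) + 1) • (p (z.2 + ((n : ℝ) + 1)⁻¹) z.1 - p z.2 z.1)
  have hq : ∀ n, StronglyMeasurable (q n) := fun n => by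
    have h1 : Measurable fun z : ℝ × ℝ => (z.2 + ((n : ℝ) + 1)⁻¹, z.1) := by fun_prop
    have h2 : Measurable fun z : ℝ × ℝ => (z.2, z.1) := by fun_prop
    exact ((hp.comp_measurable h1).sub (hp.comp_measurable h2)).const_smul ((n : ℝ) + 1)
  refine ⟨fun z => limUnder atTop fun n => q n z, StronglyMeasurable.limUnder hq, ?_⟩
  filter_upwards [hae] with s hs
  rw [hs]
  filter_upwards [LocallyIntegrable.ae_hasDerivAt_integral (hloc (F' s))] with x hx
  have h1 := (hasDerivAt_iff_tendsto_slope_zero.1 (hx 0))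
  have h2 : Tendsto (fun n : ℕ => ((n : ℝ) + 1)⁻¹) atTop (𝓝[≠] 0) := by
    refine tendsto_nhdsWithin_iff.2 ⟨?_, Eventually.of_forall fun n => ?_⟩
    · exact (tendsto_one_div_add_atTop_nhds_zero_nat (𝕜 := ℝ)).congr fun n => by simp
    · simp only [mem_compl_iff, mem_singleton_iff]
      positivity
  have h3 := h1.comp h2
  refine Tendsto.limUnder_eq (h3.congr fun n => ?_)
  simp [q, p]

lemma memLp_truncated_symbol (k N : ℕ) :
    MemLp ({ξ | ‖symbol ξ‖ < N}.indicator fun ξ => symbol ξ ^ k) ∞ volume := by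
  refine memLp_top_of_bound (C := (N : ℝ) ^ k) ?_ (Eventually.of_forall fun ξ => ?_)
  · exact ((continuous_symbol.pow k).measurable.indicator
      (measurable_norm_symbol measurableSet_Iio)).aestronglyMeasurable
  · by_cases h : ξ ∈ {ξ | ‖symbol ξ‖ < N}
    · rw [indicator_of_mem h, norm_pow]
      exact pow_le_pow_left₀ (norm_nonneg _) (le_of_lt h) k
    · rw [indicator_of_notMem h, norm_zero]
      positivity

/-- `∂_x^k` on the Fourier side, truncated to bounded frequencies. -/
noncomputable def truncMul (k N : ℕ) : LTwo →L[ℝ] LTwo := mulOp _ (memLp_truncated_symbol k N)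

lemma memLp_symbol_mul {k : ℕ} {f : LTwo} (hf : weightedEnergy k f < ⊤) :
    MemLp (fun ξ => symbol ξ ^ k * (𝓕 f : LTwo) ξ) 2 volume := by
  refine ⟨(continuous_symbol.pow k).aestronglyMeasurable.mul (Lp.aestronglyMeasurable _), ?_⟩
  rw [eLpNorm_two_eq]
  refine ENNReal.rpow_lt_top_of_nonneg (by norm_num) (ne_of_lt (lt_of_eq_of_lt ?_ hf))
  refine lintegral_congr fun ξ => ?_
  rw [enorm_mul, enorm_pow, mul_pow, ← pow_mul, mul_comm k 2]

/-- The Fourier transform of `∂_x^k f`; junk if the weighted energy is infinite. -/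
noncomputable def fourierDeriv (k : ℕ) (f : LTwo) : LTwo :=
  open scoped Classical in
  if h : weightedEnergy k f < ⊤ then (memLp_symbol_mul h).toLp _ else 0

lemma fourierDeriv_coe {k : ℕ} {f : LTwo} (h : weightedEnergy k f < ⊤) :
    ∀ᵐ ξ, fourierDeriv k f ξ = symbol ξ ^ k * (𝓕 f : LTwo) ξ := by
  rw [fourierDeriv, dif_pos h]
  exact (memLp_symbol_mul h).coeFn_toLp

lemma enorm_fourierDeriv_sq {k : ℕ} {f : LTwo} (h : weightedEnergy k f < ⊤) :
    ‖fourierDeriv k f‖ₑ ^ 2 = weightedEnergy k f := by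
  rw [enorm_sq_eq_lintegral, weightedEnergy]
  refine lintegral_congr_ae ?_
  filter_upwards [fourierDeriv_coe h] with ξ hξ
  rw [hξ, enorm_mul, enorm_pow, mul_pow, ← pow_mul, mul_comm k 2]

lemma tendsto_truncMul {k : ℕ} {f : LTwo} (h : weightedEnergy k f < ⊤) :
    Tendsto (fun N => truncMul k N (𝓕 f : LTwo)) atTop (𝓝 (fourierDeriv k f)) := by
  rw [Lp.tendsto_Lp_iff_tendsto_eLpNorm']
  simp only [eLpNorm_two_eq]
  have key : Tendsto (fun N : ℕ => ∫⁻ ξ, ‖(truncMul k N (𝓕 f : LTwo) - fourierDeriv k f : ℝ → ℂ) ξ‖ₑ ^ 2)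
      atTop (𝓝 (∫⁻ _ : ℝ, 0)) := by
    have heq : ∀ N : ℕ, ∀ᵐ ξ, (truncMul k N (𝓕 f : LTwo) - fourierDeriv k f : ℝ → ℂ) ξ
        = ({ξ | ‖symbol ξ‖ < N}.indicator (fun ξ => symbol ξ ^ k) ξ - symbol ξ ^ k)
          * (𝓕 f : LTwo) ξ := fun N => by
      filter_upwards [mulOp_coe (memLp_truncated_symbol k N) (𝓕 f : LTwo), fourierDeriv_coe h] with ξ h1 h2
      rw [Pi.sub_apply, h2, sub_mul, truncMul, h1]
    refine tendsto_lintegral_of_dominated_convergence'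
      (fun ξ => ‖symbol ξ‖ₑ ^ (2 * k) * ‖(𝓕 f : LTwo) ξ‖ₑ ^ 2) (fun N => ?_) (fun N => ?_) h.ne ?_
    · exact ((Lp.aestronglyMeasurable _).sub (Lp.aestronglyMeasurable _)).enorm.pow_const 2
    · filter_upwards [heq N] with ξ hξ
      rw [hξ, enorm_mul, mul_pow, pow_mul', ← enorm_pow]
      gcongr
      by_cases hN : ξ ∈ {ξ | ‖symbol ξ‖ < N}
      · simp [indicator_of_mem hN]
      · simp [indicator_of_notMem hN]
    · filter_upwards [ae_all_iff.2 heq] with ξ hξ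
      refine tendsto_const_nhds.congr' ?_
      obtain ⟨N₀, hN₀⟩ := exists_nat_gt ‖symbol ξ‖
      filter_upwards [eventually_ge_atTop N₀] with N hN
      have : ξ ∈ {ξ | ‖symbol ξ‖ < N} := hN₀.trans_le (by exact_mod_cast hN)
      rw [hξ, indicator_of_mem this]
      simp
  rw [lintegral_zero] at key
  have := (ENNReal.continuous_rpow_const (y := 1 / 2)).tendsto 0 |>.comp key
  simpa [Function.comp_def] using this

/-- `fourierDeriv` is not continuous, but it is a limit of the bounded operators `truncMul`. -/
lemma aestronglyMeasurable_fourierDeriv {μ : Measure ℝ} {F : ℝ → LTwo} {k : ℕ}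
    (hF : AEStronglyMeasurable F μ) (hfin : ∀ᵐ s ∂μ, weightedEnergy k (F s) < ⊤) :
    AEStronglyMeasurable (fun s => fourierDeriv k (F s)) μ := by
  have hc : Continuous fun f : LTwo => (𝓕 f : LTwo) :=
    (Lp.fourierTransformₗᵢ ℝ ℂ).continuous
  refine aestronglyMeasurable_of_tendsto_ae atTop
    (f := fun N s => truncMul k N (𝓕 (F s) : LTwo)) (fun N => ?_) ?_
  · exact ((truncMul k N).continuous.comp hc).comp_aestronglyMeasurable hF
  · filter_upwards [hfin] with s hs using tendsto_truncMul hs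

end Representatives

/-! ### Sobolev norms and frequency bands -/

section SobolevNorms

open scoped FourierTransform

variable {g : ℝ → ℝ} {k₁ k₂ : ℝ}

lemma enorm_fourier_eq (f : LTwo) : ‖(𝓕 f : LTwo)‖ₑ = ‖f‖ₑ := by
  rw [← ofReal_norm, ← ofReal_norm, Lp.norm_fourier_eq]

lemma enorm_fourierInv_eq (f : LTwo) : ‖(𝓕⁻ f : LTwo)‖ₑ = ‖f‖ₑ := by
  rw [← enorm_fourier_eq, FourierTransform.fourier_fourierInv_eq]

/-- Plancherel's identity for weak derivatives. -/
lemma weightedEnergy_toL2 {n j : ℕ} {f : ℝ → ℝ} (hf : MemW n 2 f) (hj : j ≤ n) :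
    weightedEnergy j (toL2 f) = derivNorm 2 j f ^ 2 := by
  obtain ⟨h, H, hm⟩ := hf j hj
  rw [derivNorm_eq H, ← enorm_toL2 hm, ← enorm_fourier_eq, enorm_sq_eq_lintegral, weightedEnergy]
  refine lintegral_congr_ae ?_
  filter_upwards [fourier_weakDeriv hf j hj h H hm] with ξ hξ
  rw [hξ, enorm_mul, enorm_pow, mul_pow, ← pow_mul, mul_comm j 2]

/-- The weak derivative of order `k` that a finite weighted energy provides. -/
lemma isWeakDeriv_fourierDeriv {f : ℝ → ℝ} (hf : MemLp f 2 volume) {k : ℕ}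
    (h : weightedEnergy k (toL2 f) < ⊤) :
    IsWeakDeriv k f fun x => ((𝓕⁻ (fourierDeriv k (toL2 f)) : LTwo) x).re :=
  isWeakDeriv_of_fourier hf k _ (fourierDeriv_coe h)

lemma eLpNorm_re_sq_le {f : LTwo} {k : ℕ} (h : weightedEnergy k f < ⊤) :
    eLpNorm (fun x => ((𝓕⁻ (fourierDeriv k f) : LTwo) x).re) 2 volume ^ 2 ≤ weightedEnergy k f := by
  rw [← enorm_fourierDeriv_sq h, ← enorm_fourierInv_eq, Lp.enorm_def]
  gcongr
  refine eLpNorm_mono fun x => ?_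
  exact Complex.abs_re_le_norm _

/-- No derivative is assumed to exist: the right-hand side is `∞` unless it does. -/
lemma derivNorm_sq_le {f : ℝ → ℝ} (hf : MemLp f 2 volume) (k : ℕ) :
    derivNorm 2 k f ^ 2 ≤ weightedEnergy k (toL2 f) := by
  by_cases h : weightedEnergy k (toL2 f) < ⊤
  · rw [derivNorm_eq (isWeakDeriv_fourierDeriv hf h)]
    exact eLpNorm_re_sq_le h
  · rw [not_lt_top_iff.1 h]
    exact le_top

lemma lintegral_kernelMeasure (hg : MemoryKernel g k₁ k₂) (f : ℝ → ℝ≥0∞) :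
    ∫⁻ s, f s ∂(kernelMeasure g) = ∫⁻ s in Ioi (0 : ℝ), ENNReal.ofReal (g s) * f s := by
  rw [kernelMeasure, lintegral_withDensity_eq_lintegral_mul_non_measurable₀
    _ hg.aemeasurable.ennreal_ofReal (Eventually.of_forall fun _ => ENNReal.ofReal_lt_top)]
  rfl

lemma histNorm_sq (hg : MemoryKernel g k₁ k₂) (p : ℝ≥0∞) (h : ℝ → ℝ → ℝ) :
    histNorm g p h ^ 2 = ∫⁻ s, eLpNorm (h s) p volume ^ 2 ∂(kernelMeasure g) := by
  rw [lintegral_kernelMeasure hg, histNorm, ← ENNReal.rpow_natCast, ← ENNReal.rpow_mul]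
  norm_num

/-- The squared norm of `∂_x^k` of a history on the Fourier side. -/
noncomputable def histWeightedEnergy (k : ℕ) (Γ : Lp LTwo 2 (kernelMeasure g)) : ℝ≥0∞ :=
  ∫⁻ s, weightedEnergy k (Γ s) ∂(kernelMeasure g)

lemma Band.enorm_hist_sq (B : Band) (Γ : Lp LTwo 2 (kernelMeasure g)) :
    ‖B.hist g Γ‖ₑ ^ 2 = ∫⁻ s, ‖B.comp (Γ s)‖ₑ ^ 2 ∂(kernelMeasure g) := by
  rw [Lp.enorm_def, eLpNorm_two_sq]
  refine lintegral_congr_ae ?_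
  filter_upwards [B.comp.coeFn_compLp Γ] with s hs
  exact congrArg (fun x : LTwo => ‖x‖ₑ ^ 2) hs

lemma Band.aemeasurable_enorm_comp_sq (B : Band) (Γ : Lp LTwo 2 (kernelMeasure g)) (c : ℝ≥0∞) :
    AEMeasurable (fun s => c * ‖B.comp (Γ s)‖ₑ ^ 2) (kernelMeasure g) :=
  ((B.comp.continuous.comp_aestronglyMeasurable
    (Lp.aestronglyMeasurable Γ)).enorm.pow_const 2).const_mul c

lemma tsum_dyadic_hist_le {ν : ℝ} (hν : 0 < ν) (j : ℕ) (Γ : Lp LTwo 2 (kernelMeasure g)) :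
    ∑' n : ℕ, ENNReal.ofReal ((2 ^ n * ν) ^ (2 * j)) * ‖(dyadicBand (2 ^ n * ν)).hist g Γ‖ₑ ^ 2
      ≤ histWeightedEnergy j Γ := by
  simp only [Band.enorm_hist_sq, ← lintegral_const_mul' _ _ ENNReal.ofReal_ne_top]
  rw [← lintegral_tsum fun n => Band.aemeasurable_enorm_comp_sq _ _ _]
  exact lintegral_mono fun s => tsum_dyadic_le hν j (Γ s)

lemma histWeightedEnergy_le_tsum {ν : ℝ} (hν : 0 < ν) (k : ℕ) (Γ : Lp LTwo 2 (kernelMeasure g)) :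
    histWeightedEnergy k Γ ≤ ENNReal.ofReal (ν ^ (2 * k)) * ‖(lowBand ν).hist g Γ‖ₑ ^ 2
      + ∑' n : ℕ, ENNReal.ofReal ((2 * (2 ^ n * ν)) ^ (2 * k))
        * ‖(dyadicBand (2 ^ n * ν)).hist g Γ‖ₑ ^ 2 := by
  simp only [Band.enorm_hist_sq, ← lintegral_const_mul' _ _ ENNReal.ofReal_ne_top]
  rw [← lintegral_tsum fun n => Band.aemeasurable_enorm_comp_sq _ _ _,
    ← lintegral_add_left' (Band.aemeasurable_enorm_comp_sq _ _ _)]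
  exact lintegral_mono fun s => weightedEnergy_le_tsum hν k (Γ s)

lemma Band.enorm_hist_histL2_sq_le (B : Band) (hS : volume B.S ≠ ⊤)
    (hg : MemoryKernel g k₁ k₂) {γ : ℝ → ℝ → ℝ} (h : HistMeasurable γ) (hfin : histNorm g 2 γ < ⊤)
    (h1 : ∀ᵐ s ∂(volume.restrict (Ioi (0 : ℝ))), Integrable (γ s)) :
    ‖B.hist g (histL2 g γ)‖ₑ ^ 2 ≤ volume B.S * histNorm g 1 γ ^ 2 := by
  rw [B.enorm_hist_sq, histNorm_sq hg]
  rw [← lintegral_const_mul' _ _ hS]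
  refine lintegral_mono_ae ?_
  filter_upwards [hg.ae_iff.2 h1, hg.ae_iff.2 (histL2_coe h hg hfin),
    hg.ae_iff.2 (h.ae_memLp hg hfin)] with s h2 h3 h4
  rw [h3]
  exact B.enorm_comp_toL2_sq_le h4 h2

lemma histWeightedEnergy_histL2_le (hg : MemoryKernel g k₁ k₂) {n j : ℕ} {η γ : ℝ → ℝ → ℝ}
    (hη : MemHist g (1 + n) 2 η) (H : IsHistDeriv 1 η γ) (hfin : histNorm g 2 γ < ⊤)
    (hj : j ≤ n) : histWeightedEnergy j (histL2 g γ) ≤ histDerivNorm g 2 (j + 1) η ^ 2 := by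
  have hex : ∀ i, ∃ h : ℝ → ℝ → ℝ, i ≤ n → IsHistDeriv (1 + i) η h ∧ histNorm g 2 h < ⊤ := by
    intro i
    by_cases hi : i ≤ n
    · obtain ⟨h, h1, h2⟩ := hη.2 (1 + i) (by omega)
      exact ⟨h, fun _ => ⟨h1, h2⟩⟩
    · exact ⟨0, fun h => absurd h hi⟩
  choose h hh using hex
  have hmem : ∀ᵐ s ∂(volume.restrict (Ioi (0 : ℝ))), ∀ i ≤ n,
      IsWeakDeriv i (γ s) (h i s) ∧ MemLp (h i s) 2 volume := by
    rw [ae_all_iff]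
    intro i
    by_cases hi : i ≤ n
    · filter_upwards [(hh i hi).1.2, H.2, (hh i hi).1.1.ae_memLp hg (hh i hi).2] with s h1 h2 h3 _
      exact ⟨h2.of_add h1, h3⟩
    · exact Eventually.of_forall fun s h => absurd h hi
  rw [add_comm j 1, histDerivNorm_eq (hh j hj).1, histNorm_sq hg]
  refine lintegral_mono_ae ?_
  filter_upwards [hg.ae_iff.2 hmem, hg.ae_iff.2 (histL2_coe H.1 hg hfin)] with s h1 h2
  have hW : MemW n 2 (γ s) := fun i hi => ⟨h i s, h1 i hi⟩
  rw [h2, weightedEnergy_toL2 hW hj, derivNorm_eq (h1 j hj).1]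

/-- `weightedEnergy k` is not continuous; a jointly measurable representative of the Fourier transforms
gives the measurability. -/
lemma aemeasurable_weightedEnergy (k : ℕ) (Γ : Lp LTwo 2 (kernelMeasure g)) :
    AEMeasurable (fun s => weightedEnergy k (Γ s)) (kernelMeasure g) := by
  have hc : Continuous fun f : LTwo => (𝓕 f : LTwo) :=
    (Lp.fourierTransformₗᵢ ℝ ℂ).continuous
  obtain ⟨f, hf, hae⟩ := exists_joint_representative
    (hc.comp_aestronglyMeasurable (Lp.aestronglyMeasurable Γ))
  have hm : Measurable fun s => ∫⁻ ξ, ‖symbol ξ‖ₑ ^ (2 * k) * ‖f (s, ξ)‖ₑ ^ 2 := by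
    refine Measurable.lintegral_prod_right' (f := fun z => ‖symbol z.2‖ₑ ^ (2 * k) * ‖f z‖ₑ ^ 2) ?_
    exact ((continuous_symbol.measurable.comp measurable_snd).enorm.pow_const _).mul
      (hf.enorm.pow_const 2)
  refine ⟨_, hm, ?_⟩
  filter_upwards [hae] with s hs
  refine lintegral_congr_ae ?_
  filter_upwards [hs] with ξ hξ
  rw [hξ]

/-- The version of `derivNorm_sq_le` for histories. The derivatives for almost every `s` are assembled
into one function by means of `exists_joint_representative`, as `IsHistDeriv` asks for joint
measurability. -/
lemma histDerivNorm_sq_le (hg : MemoryKernel g k₁ k₂) {η γ : ℝ → ℝ → ℝ}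
    (H : IsHistDeriv 1 η γ) (hfin : histNorm g 2 γ < ⊤) (k : ℕ) :
    histDerivNorm g 2 (k + 1) η ^ 2 ≤ histWeightedEnergy k (histL2 g γ) := by
  by_cases h : histWeightedEnergy k (histL2 g γ) = ⊤
  · rw [h]
    exact le_top
  have hlt : ∀ᵐ s ∂(kernelMeasure g), weightedEnergy k (histL2 g γ s) < ⊤ :=
    ae_lt_top' (aemeasurable_weightedEnergy k _) h
  have hc : Continuous fun f : LTwo => (𝓕⁻ f : LTwo) :=
    (Lp.fourierTransformₗᵢ ℝ ℂ).symm.continuous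
  obtain ⟨f, hf, hae⟩ := exists_joint_representative (hc.comp_aestronglyMeasurable
    (aestronglyMeasurable_fourierDeriv (Lp.aestronglyMeasurable (histL2 g γ)) hlt))
  have hre : ∀ᵐ s ∂(kernelMeasure g), (fun x => (f (s, x)).re) =ᵐ[volume]
      fun x => ((𝓕⁻ (fourierDeriv k (histL2 g γ s)) : LTwo) x).re := by
    filter_upwards [hae] with s hs
    filter_upwards [hs] with x hx
    rw [hx]
  have HD : IsHistDeriv (1 + k) η fun s x => (f (s, x)).re := by
    refine ⟨(Complex.continuous_re.comp_stronglyMeasurable hf).aestronglyMeasurable, ?_⟩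
    filter_upwards [hg.ae_iff.1 hre, hg.ae_iff.1 hlt, H.2, histL2_coe H.1 hg hfin,
      H.1.ae_memLp hg hfin] with s h1 h2 h3 h4 h5
    rw [h4] at h1 h2
    exact h3.add ((isWeakDeriv_fourierDeriv h5 h2).congr EventuallyEq.rfl h1.symm)
  rw [add_comm k 1, histDerivNorm_eq HD, histNorm_sq hg]
  refine lintegral_mono_ae ?_
  filter_upwards [hre, hlt] with s h1 h2
  rw [eLpNorm_congr_ae h1]
  exact eLpNorm_re_sq_le h2

end SobolevNorms

/-! ### Decay factors of the bands -/

section Factors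

lemma pow_mul_exp_neg_le {c x : ℝ} (hc : 0 < c) (hx : 0 ≤ x) (p : ℕ) :
    x ^ p * Real.exp (-(c * x)) ≤ p.factorial / c ^ p := by
  have h := Real.pow_div_factorial_le_exp (c * x) (by positivity) p
  rw [Real.exp_neg, ← div_eq_mul_inv, div_le_div_iff₀ (Real.exp_pos _) (by positivity)]
  rw [div_le_iff₀ (by positivity), mul_pow] at h
  linarith

lemma summable_pow_mul_exp {c : ℝ} (hc : 0 < c) (k : ℕ) :
    Summable fun n : ℕ => ((2 : ℝ) ^ n) ^ (2 * k + 1) * Real.exp (-(c * 16 ^ n)) := by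
  refine Summable.of_nonneg_of_le (fun n => by positivity) (fun n => ?_)
    (summable_geometric_two.mul_left ((k + 1).factorial / c ^ (k + 1)))
  have h1 := pow_mul_exp_neg_le hc (by positivity : (0 : ℝ) ≤ 16 ^ n) (k + 1)
  have h2 : ((2 : ℝ) ^ n) ^ (2 * k + 1) ≤ (16 ^ n) ^ (k + 1) * (1 / 2) ^ n := by
    have e : ((16 : ℝ) ^ n) ^ (k + 1) = ((2 ^ n) ^ (2 * k + 1) * 2 ^ n) * (2 ^ n) ^ (2 * k + 2) := by
      have : (16 : ℝ) ^ n = (2 ^ n) ^ 4 := by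
        rw [← pow_mul, mul_comm, pow_mul]
        norm_num
      rw [this]
      ring
    have h3 : (1 : ℝ) ≤ (2 ^ n) ^ (2 * k + 2) := one_le_pow₀ (one_le_pow₀ one_le_two)
    have h4 : (2 : ℝ) ^ n * (1 / 2) ^ n = 1 := by rw [← mul_pow]; norm_num
    calc ((2 : ℝ) ^ n) ^ (2 * k + 1) = (2 ^ n) ^ (2 * k + 1) * (2 ^ n * (1 / 2) ^ n) := by
          rw [h4, mul_one]
      _ ≤ (2 ^ n) ^ (2 * k + 1) * (2 ^ n * (1 / 2) ^ n) * (2 ^ n) ^ (2 * k + 2) :=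
          le_mul_of_one_le_right (by positivity) h3
      _ = _ := by rw [e]; ring
  calc ((2 : ℝ) ^ n) ^ (2 * k + 1) * Real.exp (-(c * 16 ^ n))
      ≤ (16 ^ n) ^ (k + 1) * (1 / 2) ^ n * Real.exp (-(c * 16 ^ n)) := by gcongr
    _ = (16 ^ n) ^ (k + 1) * Real.exp (-(c * 16 ^ n)) * (1 / 2) ^ n := by ring
    _ ≤ _ := by gcongr

/-- Frequencies between `(1 + t)^(-1/4)` and `1` decay like the heat kernel of order four. -/
lemma exp_mid_le {c ν T : ℝ} (hc : 0 < c) (hν : 0 < ν) (hT : 1 ≤ T) (hνT : ν ^ 4 * T = 1) {n : ℕ}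
    (hn : 2 ^ n * ν ≤ 1) :
    Real.exp (-(c * ((2 ^ n * ν) ^ 4 / (1 + (2 ^ n * ν) ^ 2) ^ 3)) * (T - 1))
      ≤ Real.exp (c / 8) * Real.exp (-(c / 8 * 16 ^ n)) := by
  set μ := 2 ^ n * ν with hμ
  have hμ0 : 0 < μ := by positivity
  rw [← Real.exp_add]
  refine Real.exp_le_exp.2 ?_
  have h1 : (1 + μ ^ 2) ^ 3 ≤ 8 := by
    have : 1 + μ ^ 2 ≤ 2 := by nlinarith
    calc (1 + μ ^ 2) ^ 3 ≤ 2 ^ 3 := pow_le_pow_left₀ (by positivity) this 3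
      _ = 8 := by norm_num
  have h2 : μ ^ 4 / 8 ≤ μ ^ 4 / (1 + μ ^ 2) ^ 3 :=
    div_le_div_of_nonneg_left (by positivity) (by positivity) h1
  have h3 : μ ^ 4 * T = 16 ^ n := by
    rw [hμ, mul_pow, mul_assoc, hνT, mul_one, ← pow_mul, mul_comm n 4, pow_mul]
    norm_num
  have h4 : μ ^ 4 ≤ 1 := pow_le_one₀ hμ0.le hn
  have h5 := mul_le_mul_of_nonneg_right h2 (by linarith : 0 ≤ T - 1)
  have h6 : (16 ^ n - 1) / 8 ≤ μ ^ 4 / (1 + μ ^ 2) ^ 3 * (T - 1) := by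
    refine le_trans ?_ h5
    have : μ ^ 4 / 8 * (T - 1) = (μ ^ 4 * T - μ ^ 4) / 8 := by ring
    rw [this, h3]
    linarith
  have h7 := mul_le_mul_of_nonneg_left h6 hc.le
  linarith

/-- Frequencies above `1` trade decay in time for regularity, two derivatives for each factor
`(1 + t)⁻¹`. -/
lemma exp_high_le {c μ T : ℝ} (hc : 0 < c) (hT : 1 ≤ T) (hμ : 1 ≤ μ) (l : ℕ) :
    Real.exp (-(c * (μ ^ 4 / (1 + μ ^ 2) ^ 3)) * (T - 1))
      ≤ Real.exp (c / 8) * (l.factorial / (c / 8) ^ l) * (μ ^ (2 * l) / T ^ l) := by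
  have hμ0 : 0 < μ := by linarith
  have hT0 : 0 < T := by linarith
  have h1 : 1 / (8 * μ ^ 2) ≤ μ ^ 4 / (1 + μ ^ 2) ^ 3 := by
    have hb : (1 + μ ^ 2) ^ 3 ≤ 8 * μ ^ 6 := by
      have : 1 + μ ^ 2 ≤ 2 * μ ^ 2 := by nlinarith
      calc (1 + μ ^ 2) ^ 3 ≤ (2 * μ ^ 2) ^ 3 := pow_le_pow_left₀ (by positivity) this 3
        _ = 8 * μ ^ 6 := by ring
    rw [div_le_div_iff₀ (by positivity) (by positivity)]
    calc 1 * (1 + μ ^ 2) ^ 3 ≤ 8 * μ ^ 6 := by linarith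
      _ = μ ^ 4 * (8 * μ ^ 2) := by ring
  have h2 := pow_mul_exp_neg_le (by positivity : 0 < c / 8) (by positivity : 0 ≤ T / μ ^ 2) l
  have h3 : -(c * (μ ^ 4 / (1 + μ ^ 2) ^ 3)) * (T - 1) ≤ c / 8 + -(c / 8 * (T / μ ^ 2)) := by
    have h4 := mul_le_mul_of_nonneg_left
      (mul_le_mul_of_nonneg_right h1 (by linarith : 0 ≤ T - 1)) hc.le
    have h5 : 1 / μ ^ 2 ≤ 1 := (div_le_one (by positivity)).2 (one_le_pow₀ hμ)
    have h6 : c * (1 / (8 * μ ^ 2) * (T - 1)) = c / 8 * (T / μ ^ 2) - c / 8 * (1 / μ ^ 2) := by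
      field_simp
    have h7 := mul_le_mul_of_nonneg_left h5 (by positivity : 0 ≤ c / 8)
    linarith
  refine (Real.exp_le_exp.2 h3).trans ?_
  rw [Real.exp_add, mul_assoc]
  refine mul_le_mul_of_nonneg_left ?_ (Real.exp_nonneg _)
  have e : Real.exp (-(c / 8 * (T / μ ^ 2)))
      = (T / μ ^ 2) ^ l * Real.exp (-(c / 8 * (T / μ ^ 2))) * (μ ^ (2 * l) / T ^ l) := by
    rw [div_pow, ← pow_mul]
    field_simp
  rw [e]
  gcongr

end Factors

/-! ### Summation over the bands -/

section Summation

variable {P : Coeffs} {k₁ k₂ : ℝ}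

/-- The squared norm of the part of a state in a frequency band; `γ` stands for `∂_x η`. -/
noncomputable def bandNormSq (g : ℝ → ℝ) (B : Band) (V : State) (γ : ℝ → ℝ → ℝ) : ℝ≥0∞ :=
  ‖B.comp (toL2 V.v)‖ₑ ^ 2 + ‖B.comp (toL2 V.u)‖ₑ ^ 2 + ‖B.comp (toL2 V.z)‖ₑ ^ 2
    + ‖B.comp (toL2 V.y)‖ₑ ^ 2 + ‖B.comp (toL2 V.θ)‖ₑ ^ 2 + ‖B.hist g (histL2 g γ)‖ₑ ^ 2

lemma ofReal_sum_norm_sq {H K : Type*} [NormedAddCommGroup H] [NormedAddCommGroup K]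
    (a b c d e : H) (f : K) :
    ENNReal.ofReal (‖a‖ ^ 2 + ‖b‖ ^ 2 + ‖c‖ ^ 2 + ‖d‖ ^ 2 + ‖e‖ ^ 2 + ‖f‖ ^ 2)
      = ‖a‖ₑ ^ 2 + ‖b‖ₑ ^ 2 + ‖c‖ₑ ^ 2 + ‖d‖ₑ ^ 2 + ‖e‖ₑ ^ 2 + ‖f‖ₑ ^ 2 := by
  rw [ENNReal.ofReal_add (by positivity) (by positivity),
    ENNReal.ofReal_add (by positivity) (by positivity),
    ENNReal.ofReal_add (by positivity) (by positivity),
    ENNReal.ofReal_add (by positivity) (by positivity),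
    ENNReal.ofReal_add (by positivity) (by positivity)]
  simp only [ENNReal.ofReal_pow (norm_nonneg _), ofReal_norm]

lemma HilbertSolution.exists_bandNormSq_le (hP : P.Admissible) (hg : MemoryKernel P.g k₁ k₂) :
    ∃ C > 0, ∀ (V : ℝ → State) (γ : ℝ → ℝ → ℝ → ℝ),
      HilbertSolution P (fun t => toL2 (V t).v) (fun t => toL2 (V t).u) (fun t => toL2 (V t).z)
        (fun t => toL2 (V t).y) (fun t => toL2 (V t).θ) (fun t => histL2 P.g (γ t)) →
      ∀ (B : Band), ∀ t ≥ 0,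
        bandNormSq P.g B (V t) (γ t) ≤ ENNReal.ofReal C * bandNormSq P.g B (V 0) (γ 0) := by
  obtain ⟨C, hC, H⟩ := BandEvolution.exists_bounded (H := LTwo) hP hg.k₂_pos.le
    ((1 + k₁) * √((kernelMeasure P.g).real univ))
  refine ⟨C, hC, fun V γ h B t ht => ?_⟩
  have := H (h.bandEvolution hg B) t ht
  rw [bandNormSq, bandNormSq, ← ofReal_sum_norm_sq, ← ofReal_sum_norm_sq,
    ← ENNReal.ofReal_mul hC.le]
  exact ENNReal.ofReal_le_ofReal this

lemma HilbertSolution.exists_bandNormSq_dyadic_le (hP : P.Admissible)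
    (hg : MemoryKernel P.g k₁ k₂) :
    ∃ C > 0, ∃ c > 0, ∀ (V : ℝ → State) (γ : ℝ → ℝ → ℝ → ℝ),
      HilbertSolution P (fun t => toL2 (V t).v) (fun t => toL2 (V t).u) (fun t => toL2 (V t).z)
        (fun t => toL2 (V t).y) (fun t => toL2 (V t).θ) (fun t => histL2 P.g (γ t)) →
      ∀ ν > 0, ∀ t ≥ 0, bandNormSq P.g (dyadicBand ν) (V t) (γ t)
        ≤ ENNReal.ofReal (C * Real.exp (-(c * (ν ^ 4 / (1 + ν ^ 2) ^ 3)) * t))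
          * bandNormSq P.g (dyadicBand ν) (V 0) (γ 0) := by
  have hk₁ := hg.k₁_pos
  obtain ⟨C, hC, c, hc, H⟩ := BandEvolution.exists_decay (H := LTwo) hP hg.integral_pos
    hg.k₂_pos (by positivity : 0 ≤ (1 + k₁) * √((kernelMeasure P.g).real univ))
  refine ⟨C, hC, c, hc, fun V γ h ν hν t ht => ?_⟩
  have := H (h.bandEvolution hg (dyadicBand ν)) hν (le_norm_dyadicBand_D hν)
    (norm_dyadicBand_D_le hν) t ht
  rw [bandNormSq, bandNormSq, ← ofReal_sum_norm_sq, ← ofReal_sum_norm_sq,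
    ← ENNReal.ofReal_mul (by positivity)]
  exact ENNReal.ofReal_le_ofReal this

lemma sum_six_le {M : ℝ≥0∞} {a b c d e f : ℝ≥0∞}
    (h : a ≤ M ∧ b ≤ M ∧ c ≤ M ∧ d ≤ M ∧ e ≤ M ∧ f ≤ M) :
    a + b + c + d + e + f ≤ 6 * M := by
  obtain ⟨ha, hb, hc, hd, he, hf⟩ := h
  calc a + b + c + d + e + f ≤ M + M + M + M + M + M := by gcongr
    _ = 6 * M := by ring

/-- A band contributes at most its length times the square of the `L¹` norm. -/
lemma bandNormSq_le_volume (hg : MemoryKernel P.g k₁ k₂) {n : ℕ} {V : State} {γ : ℝ → ℝ → ℝ}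
    (h2 : MemH P.g n V) (h1 : MemL1 P.g V) (H : IsHistDeriv 1 V.η γ) (hfin : histNorm P.g 2 γ < ⊤)
    (B : Band) (hS : volume B.S ≠ ⊤) :
    bandNormSq P.g B V γ ≤ 6 * (volume B.S * V.norm P.g 1 0 ^ 2) := by
  have key : ∀ f : ℝ → ℝ, MemW n 2 f → MemW 0 1 f → derivNorm 1 0 f ≤ V.norm P.g 1 0 →
      ‖B.comp (toL2 f)‖ₑ ^ 2 ≤ volume B.S * V.norm P.g 1 0 ^ 2 := by
    intro f hf2 hf1 hle
    refine (B.enorm_comp_toL2_sq_le hf2.memLp (memLp_one_iff_integrable.1 hf1.memLp)).trans ?_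
    rw [derivNorm_zero_eq (hf2.memLp.locallyIntegrable one_le_two)] at hle
    gcongr
  obtain ⟨l1, l2, l3, l4, l5, l6⟩ := le_norm_add_components P.g 1 0 V
  obtain ⟨m1, m2, m3, m4, m5, m6⟩ := h2
  obtain ⟨n1, n2, n3, n4, n5, n6⟩ := h1
  refine sum_six_le ⟨key _ m1 n1 l1, key _ m2 n2 l2, key _ m3 n3 l3, key _ m4 n4 l4,
    key _ m5 n5 l5, ?_⟩
  obtain ⟨h, Hh, hh⟩ := n6.2 1 le_rfl
  refine (B.enorm_hist_histL2_sq_le hS hg H.1 hfin ?_).trans ?_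
  · filter_upwards [Hh.2, H.2, Hh.1.ae_memLp hg hh] with s e1 e2 e3
    exact (memLp_one_iff_integrable.1 e3).congr (isWeakDeriv_unique e1 e2)
  · rw [← histDerivNorm_eq H]
    gcongr

lemma tsum_bandNormSq_le (hg : MemoryKernel P.g k₁ k₂) {n j : ℕ} {V : State} {γ : ℝ → ℝ → ℝ}
    (h2 : MemH P.g n V) (H : IsHistDeriv 1 V.η γ) (hfin : histNorm P.g 2 γ < ⊤) (hj : j ≤ n)
    {ν : ℝ} (hν : 0 < ν) :
    ∑' i : ℕ, ENNReal.ofReal ((2 ^ i * ν) ^ (2 * j)) * bandNormSq P.g (dyadicBand (2 ^ i * ν)) V γ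
      ≤ 6 * V.norm P.g 2 j ^ 2 := by
  have key : ∀ f : ℝ → ℝ, MemW n 2 f → derivNorm 2 j f ≤ V.norm P.g 2 j →
      ∑' i : ℕ, ENNReal.ofReal ((2 ^ i * ν) ^ (2 * j)) * ‖(dyadicBand (2 ^ i * ν)).comp (toL2 f)‖ₑ ^ 2
        ≤ V.norm P.g 2 j ^ 2 := by
    intro f hf hle
    refine (tsum_dyadic_le hν j _).trans ?_
    rw [weightedEnergy_toL2 hf hj]
    gcongr
  obtain ⟨l1, l2, l3, l4, l5, l6⟩ := le_norm_add_components P.g 2 j V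
  obtain ⟨m1, m2, m3, m4, m5, m6⟩ := h2
  simp only [bandNormSq, mul_add, ENNReal.tsum_add]
  refine sum_six_le ⟨key _ m1 l1, key _ m2 l2, key _ m3 l3, key _ m4 l4, key _ m5 l5, ?_⟩
  refine (tsum_dyadic_hist_le hν j _).trans
    ((histWeightedEnergy_histL2_le hg m6 H hfin hj).trans ?_)
  gcongr

/-- The Sobolev norm of a state, bounded by its band norms; in particular, the weak derivatives exist
when the sum is finite. -/
lemma norm_le_rpow_bands (hg : MemoryKernel P.g k₁ k₂) {V : State} {γ : ℝ → ℝ → ℝ}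
    (h2 : MemH P.g 0 V) (H : IsHistDeriv 1 V.η γ) (hfin : histNorm P.g 2 γ < ⊤) (k : ℕ)
    {ν : ℝ} (hν : 0 < ν) :
    V.norm P.g 2 k ≤ 6 * (ENNReal.ofReal (ν ^ (2 * k)) * bandNormSq P.g (lowBand ν) V γ
      + ∑' i : ℕ, ENNReal.ofReal ((2 * (2 ^ i * ν)) ^ (2 * k))
        * bandNormSq P.g (dyadicBand (2 ^ i * ν)) V γ) ^ (1 / 2 : ℝ) := by
  set Q := ENNReal.ofReal (ν ^ (2 * k)) * bandNormSq P.g (lowBand ν) V γ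
      + ∑' i : ℕ, ENNReal.ofReal ((2 * (2 ^ i * ν)) ^ (2 * k))
        * bandNormSq P.g (dyadicBand (2 ^ i * ν)) V γ with hQ
  have root : ∀ x : ℝ≥0∞, x ^ 2 ≤ Q → x ≤ Q ^ (1 / 2 : ℝ) := by
    intro x hx
    have := ENNReal.rpow_le_rpow hx (by norm_num : (0 : ℝ) ≤ 1 / 2)
    rwa [← ENNReal.rpow_natCast, ← ENNReal.rpow_mul, Nat.cast_ofNat,
      mul_one_div_cancel two_ne_zero, ENNReal.rpow_one] at this
  have key : ∀ f : ℝ → ℝ, MemW 0 2 f → (∀ B, ‖Band.comp B (toL2 f)‖ₑ ^ 2 ≤ bandNormSq P.g B V γ) →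
      derivNorm 2 k f ≤ Q ^ (1 / 2 : ℝ) := by
    intro f hf hle
    refine root _ ((derivNorm_sq_le hf.memLp k).trans ((weightedEnergy_le_tsum hν k _).trans ?_))
    exact add_le_add (mul_le_mul_right (hle _) _)
      (ENNReal.tsum_le_tsum fun i => mul_le_mul_right (hle _) _)
  obtain ⟨m1, m2, m3, m4, m5, m6⟩ := h2
  unfold State.norm
  refine sum_six_le ⟨key _ m1 fun B => ?_, key _ m2 fun B => ?_, key _ m3 fun B => ?_,
    key _ m4 fun B => ?_, key _ m5 fun B => ?_, ?_⟩
  · exact ((le_self_add.trans le_self_add).trans (le_self_add.trans le_self_add)).trans le_self_add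
  · exact ((le_add_self.trans le_self_add).trans (le_self_add.trans le_self_add)).trans le_self_add
  · exact (le_add_self.trans (le_self_add.trans le_self_add)).trans le_self_add
  · exact (le_add_self.trans le_self_add).trans le_self_add
  · exact le_add_self.trans le_self_add
  · refine root _ ((histDerivNorm_sq_le hg H hfin k).trans
      ((histWeightedEnergy_le_tsum hν k _).trans ?_))
    exact add_le_add (mul_le_mul_right le_add_self _)
      (ENNReal.tsum_le_tsum fun i => mul_le_mul_right le_add_self _)

/-- The decay estimate with squared norms and cutoff frequency `ν = (1 + t)^(-1/4)`. The low band and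
the dyadic bands up to frequency `1` are bounded by the `L¹` norm, the bands above `1` by the norm of
the derivative of order `k + l`. -/
lemma exists_bands_le (hP : P.Admissible) (hg : MemoryKernel P.g k₁ k₂) (k l : ℕ) :
    ∃ A > 0, ∃ M > 0, ∀ (V : ℝ → State) (γ : ℝ → ℝ → ℝ → ℝ) (n : ℕ), k + l ≤ n →
      MemH P.g n (V 0) → MemL1 P.g (V 0) → IsHistDeriv 1 (V 0).η (γ 0) →
      histNorm P.g 2 (γ 0) < ⊤ →
      HilbertSolution P (fun t => toL2 (V t).v) (fun t => toL2 (V t).u) (fun t => toL2 (V t).z)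
        (fun t => toL2 (V t).y) (fun t => toL2 (V t).θ) (fun t => histL2 P.g (γ t)) →
      ∀ t ≥ 0, ∀ ν > 0, ν ^ 4 * (1 + t) = 1 →
      ENNReal.ofReal (ν ^ (2 * k)) * bandNormSq P.g (lowBand ν) (V t) (γ t)
        + ∑' i : ℕ, ENNReal.ofReal ((2 * (2 ^ i * ν)) ^ (2 * k))
          * bandNormSq P.g (dyadicBand (2 ^ i * ν)) (V t) (γ t)
      ≤ ENNReal.ofReal (A * ν ^ (2 * k + 1)) * (V 0).norm P.g 1 0 ^ 2
        + ENNReal.ofReal (M / (1 + t) ^ l) * (V 0).norm P.g 2 (k + l) ^ 2 := by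
  obtain ⟨C₁, hC₁, H₁⟩ := HilbertSolution.exists_bandNormSq_le hP hg
  obtain ⟨C₂, hC₂, c, hc, H₂⟩ := HilbertSolution.exists_bandNormSq_dyadic_le hP hg
  have hsum := summable_pow_mul_exp (by positivity : 0 < c / 8) k
  set a : ℕ → ℝ := fun i => (2 ^ i) ^ (2 * k + 1) * Real.exp (-(c / 8 * 16 ^ i)) with ha
  have ha0 : ∀ i, 0 ≤ a i := fun i => by positivity
  have hS0 : 0 ≤ ∑' i, a i := tsum_nonneg ha0
  set D := 12 * 4 ^ k * C₂ * Real.exp (c / 8) with hD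
  set M₀ := Real.exp (c / 8) * (l.factorial / (c / 8) ^ l) with hM₀
  have hM₀' : 0 < M₀ := by positivity
  refine ⟨6 * C₁ + D * ∑' i, a i, by positivity, 6 * (4 ^ k * C₂ * M₀),
    by positivity, ?_⟩
  intro V γ n hn h2 h1 H hfin hsol t ht ν hν hνT
  set N₁ := (V 0).norm P.g 1 0
  set N₂ := (V 0).norm P.g 2 (k + l)
  have hvol : ∀ i : ℕ, volume (dyadicBand (2 ^ i * ν)).S ≤ ENNReal.ofReal (2 * (2 ^ i * ν)) :=
    fun i => (measure_mono fun ξ hξ => hξ.2).trans (volume_norm_symbol_lt_le _)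
  have six : (6 : ℝ≥0∞) = ENNReal.ofReal 6 := by norm_num
  have hlow : ENNReal.ofReal (ν ^ (2 * k)) * bandNormSq P.g (lowBand ν) (V t) (γ t)
      ≤ ENNReal.ofReal (6 * C₁ * ν ^ (2 * k + 1)) * N₁ ^ 2 := by
    have hv : volume (lowBand ν).S ≤ ENNReal.ofReal ν := volume_norm_symbol_lt_le ν
    have e1 := bandNormSq_le_volume hg h2 h1 H hfin (lowBand ν)
      (ne_top_of_le_ne_top ENNReal.ofReal_ne_top hv)
    calc ENNReal.ofReal (ν ^ (2 * k)) * bandNormSq P.g (lowBand ν) (V t) (γ t)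
        ≤ ENNReal.ofReal (ν ^ (2 * k)) * (ENNReal.ofReal C₁ * (6 * (ENNReal.ofReal ν * N₁ ^ 2))) := by
          gcongr
          refine (H₁ V γ hsol _ t ht).trans ?_
          gcongr
          refine e1.trans ?_
          gcongr
      _ = ENNReal.ofReal (6 * C₁ * ν ^ (2 * k + 1)) * N₁ ^ 2 := by
          rw [six, ← mul_assoc (ENNReal.ofReal 6), ← mul_assoc (ENNReal.ofReal C₁),
            ← mul_assoc (ENNReal.ofReal (ν ^ (2 * k))), ← ENNReal.ofReal_mul (by positivity),
            ← ENNReal.ofReal_mul (by positivity), ← ENNReal.ofReal_mul (by positivity)]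
          congr 2
          ring
  have hterm : ∀ i : ℕ, ENNReal.ofReal ((2 * (2 ^ i * ν)) ^ (2 * k))
      * bandNormSq P.g (dyadicBand (2 ^ i * ν)) (V t) (γ t)
      ≤ ENNReal.ofReal (D * ν ^ (2 * k + 1) * a i) * N₁ ^ 2
        + ENNReal.ofReal (4 ^ k * C₂ * M₀ / (1 + t) ^ l) * (ENNReal.ofReal ((2 ^ i * ν) ^ (2 * (k + l)))
          * bandNormSq P.g (dyadicBand (2 ^ i * ν)) (V 0) (γ 0)) := by
    intro i
    set μ := 2 ^ i * ν with hμ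
    have hμ0 : 0 < μ := by positivity
    have h3 := H₂ V γ hsol μ hμ0 t ht
    set x := Real.exp (-(c * (μ ^ 4 / (1 + μ ^ 2) ^ 3)) * t) with hx
    have h4 : ENNReal.ofReal ((2 * μ) ^ (2 * k)) * bandNormSq P.g (dyadicBand μ) (V t) (γ t)
        ≤ ENNReal.ofReal ((2 * μ) ^ (2 * k) * (C₂ * x))
          * bandNormSq P.g (dyadicBand μ) (V 0) (γ 0) := by
      rw [ENNReal.ofReal_mul (by positivity), mul_assoc]
      gcongr
    have pow4 : (2 * μ) ^ (2 * k) = 4 ^ k * μ ^ (2 * k) := by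
      rw [mul_pow, pow_mul]
      norm_num
    rcases le_or_gt μ 1 with hle | hgt
    -- band of length `2 μ`, with decay `exp (-c t μ ^ 4 / 8)`
    · refine le_trans (h4.trans ?_) le_self_add
      have hxm : x ≤ Real.exp (c / 8) * Real.exp (-(c / 8 * 16 ^ i)) := by
        have := exp_mid_le hc hν (by linarith : 1 ≤ 1 + t) hνT hle
        rwa [add_sub_cancel_left] at this
      have e1 := bandNormSq_le_volume hg h2 h1 H hfin (dyadicBand μ)
        (ne_top_of_le_ne_top ENNReal.ofReal_ne_top (hvol i))
      calc ENNReal.ofReal ((2 * μ) ^ (2 * k) * (C₂ * x)) * bandNormSq P.g (dyadicBand μ) (V 0) (γ 0)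
          ≤ ENNReal.ofReal ((2 * μ) ^ (2 * k)
              * (C₂ * (Real.exp (c / 8) * Real.exp (-(c / 8 * 16 ^ i)))))
            * (6 * (ENNReal.ofReal (2 * μ) * N₁ ^ 2)) := by
            gcongr
            refine e1.trans ?_
            gcongr
            exact hvol i
        _ = ENNReal.ofReal (D * ν ^ (2 * k + 1) * a i) * N₁ ^ 2 := by
            rw [six, ← mul_assoc (ENNReal.ofReal 6), ← mul_assoc,
              ← ENNReal.ofReal_mul (by positivity), ← ENNReal.ofReal_mul (by positivity)]
            congr 2
            rw [pow4, ha, hD, hμ]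
            ring
    -- decay `exp (-c t / (8 μ ^ 2))`, of which `μ ^ (2 * l) / (1 + t) ^ l` is retained
    · refine le_trans (h4.trans ?_) le_add_self
      have hxh : x ≤ M₀ * (μ ^ (2 * l) / (1 + t) ^ l) := by
        have := exp_high_le hc (by linarith : 1 ≤ 1 + t) hgt.le l
        rwa [add_sub_cancel_left] at this
      rw [← mul_assoc (ENNReal.ofReal (4 ^ k * C₂ * M₀ / (1 + t) ^ l)),
        ← ENNReal.ofReal_mul (by positivity)]
      refine mul_le_mul_left (ENNReal.ofReal_le_ofReal ?_) _
      calc (2 * μ) ^ (2 * k) * (C₂ * x)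
          ≤ (2 * μ) ^ (2 * k) * (C₂ * (M₀ * (μ ^ (2 * l) / (1 + t) ^ l))) := by gcongr
        _ = _ := by
          rw [pow4, mul_add 2 k l, pow_add]
          ring
  have htsum : ∑' i : ℕ, ENNReal.ofReal ((2 * (2 ^ i * ν)) ^ (2 * k))
      * bandNormSq P.g (dyadicBand (2 ^ i * ν)) (V t) (γ t)
      ≤ ENNReal.ofReal (D * (∑' i, a i) * ν ^ (2 * k + 1)) * N₁ ^ 2
        + ENNReal.ofReal (6 * (4 ^ k * C₂ * M₀) / (1 + t) ^ l) * N₂ ^ 2 := by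
    refine (ENNReal.tsum_le_tsum hterm).trans ?_
    rw [ENNReal.tsum_add, ENNReal.tsum_mul_right, ENNReal.tsum_mul_left]
    refine add_le_add (le_of_eq ?_) ?_
    · rw [← ENNReal.ofReal_tsum_of_nonneg (fun i => by have := ha0 i; positivity)
        (hsum.mul_left _), tsum_mul_left]
      congr 2
      ring
    · refine (mul_le_mul_right (tsum_bandNormSq_le hg h2 H hfin hn hν) _).trans (le_of_eq ?_)
      rw [six, ← mul_assoc, ← ENNReal.ofReal_mul (by positivity)]
      congr 2
      ring
  refine (add_le_add hlow htsum).trans (le_of_eq ?_)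
  rw [← add_assoc, ← add_mul, ← ENNReal.ofReal_add (by positivity) (by positivity)]
  congr 3
  ring

/-- The decay estimate for one pair of orders. -/
theorem exists_decay_estimate (hP : P.Admissible) (k l : ℕ) :
    ∃ C₁ > (0 : ℝ), ∃ C₂ > (0 : ℝ), ∀ (n : ℕ) (V₀ : State) (V : ℝ → State), k + l ≤ n →
      MemH P.g n V₀ → MemL1 P.g V₀ → IsSolution P V₀ V → ∀ t : ℝ, 0 ≤ t →
      (V t).norm P.g 2 k ≤
        ENNReal.ofReal (C₁ * (1 + t) ^ (-(1 / 8 : ℝ) - (k : ℝ) / 4)) * V₀.norm P.g 1 0 +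
        ENNReal.ofReal (C₂ * (1 + t) ^ (-(l : ℝ) / 2)) * V₀.norm P.g 2 (k + l) := by
  obtain ⟨k₁, k₂, hg⟩ := hP.exists_memoryKernel
  obtain ⟨A, hA, M, hM, key⟩ := exists_bands_le hP hg k l
  refine ⟨6 * A ^ (1 / 2 : ℝ), by positivity, 6 * M ^ (1 / 2 : ℝ), by positivity, ?_⟩
  intro n V₀ V hn h2 h1 hV t ht
  obtain ⟨γ, hγ, hsol⟩ := hV.exists_hilbertSolution hP hg
  have hV0 := hV.initial
  subst hV0
  have hT : 0 < 1 + t := by linarith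
  set ν := (1 + t) ^ (-(1 / 4) : ℝ) with hν
  have hν0 : 0 < ν := Real.rpow_pos_of_pos hT _
  have hνT : ν ^ 4 * (1 + t) = 1 := by
    rw [hν, ← Real.rpow_natCast, ← Real.rpow_mul hT.le]
    norm_num
    rw [Real.rpow_neg_one, inv_mul_cancel₀ hT.ne']
  have b := key V γ n hn h2 h1 (hγ 0 le_rfl).1 (hγ 0 le_rfl).2 hsol t ht ν hν0 hνT
  refine (norm_le_rpow_bands hg (hV.mem t ht) (hγ t ht).1 (hγ t ht).2 k hν0).trans ?_
  have root : ∀ {r : ℝ} (x : ℝ≥0∞), 0 ≤ r →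
      (ENNReal.ofReal r * x ^ 2) ^ (1 / 2 : ℝ) = ENNReal.ofReal (r ^ (1 / 2 : ℝ)) * x := by
    intro r x hr
    rw [ENNReal.mul_rpow_of_nonneg _ _ (by norm_num), ← ENNReal.rpow_natCast, ← ENNReal.rpow_mul,
      ENNReal.ofReal_rpow_of_nonneg hr (by norm_num), Nat.cast_ofNat,
      mul_one_div_cancel two_ne_zero, ENNReal.rpow_one]
  have six : (6 : ℝ≥0∞) = ENNReal.ofReal 6 := by norm_num
  calc _ ≤ 6 * (ENNReal.ofReal (A * ν ^ (2 * k + 1)) * (V 0).norm P.g 1 0 ^ 2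
        + ENNReal.ofReal (M / (1 + t) ^ l) * (V 0).norm P.g 2 (k + l) ^ 2) ^ (1 / 2 : ℝ) := by
        gcongr
    _ ≤ 6 * (ENNReal.ofReal ((A * ν ^ (2 * k + 1)) ^ (1 / 2 : ℝ)) * (V 0).norm P.g 1 0
        + ENNReal.ofReal ((M / (1 + t) ^ l) ^ (1 / 2 : ℝ)) * (V 0).norm P.g 2 (k + l)) := by
        rw [← root _ (by positivity), ← root _ (by positivity)]
        gcongr
        exact ENNReal.rpow_add_le_add_rpow _ _ (by norm_num) (by norm_num)
    _ = _ := by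
        rw [mul_add, six, ← mul_assoc, ← mul_assoc, ← ENNReal.ofReal_mul (by norm_num),
          ← ENNReal.ofReal_mul (by norm_num)]
        have e1 : (ν ^ (2 * k + 1)) ^ (1 / 2 : ℝ) = (1 + t) ^ (-(1 / 8 : ℝ) - (k : ℝ) / 4) := by
          rw [hν, ← Real.rpow_natCast, ← Real.rpow_mul hT.le, ← Real.rpow_mul hT.le]
          congr 1
          push_cast
          ring
        have e2 : (((1 + t) ^ l)⁻¹) ^ (1 / 2 : ℝ) = (1 + t) ^ (-(l : ℝ) / 2) := by
          rw [← Real.rpow_natCast, ← Real.rpow_neg hT.le, ← Real.rpow_mul hT.le]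
          congr 1
          ring
        rw [Real.mul_rpow hA.le (by positivity), e1, div_eq_mul_inv M ((1 + t) ^ l),
          Real.mul_rpow hM.le (by positivity), e2, ← mul_assoc (6 : ℝ) (A ^ (1 / 2 : ℝ)),
          ← mul_assoc (6 : ℝ) (M ^ (1 / 2 : ℝ))]

end Summation

end Timoshenko

theorem theorem4p2 (P : Timoshenko.Coeffs) (hP : P.Admissible) (s : ℕ) :
    ∃ C₁ > (0 : ℝ), ∃ C₂ > (0 : ℝ),
      ∀ (V₀ : Timoshenko.State) (V : ℝ → Timoshenko.State),
        Timoshenko.MemH P.g s V₀ → Timoshenko.MemL1 P.g V₀ → Timoshenko.IsSolution P V₀ V →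
        ∀ k l : ℕ, k + l ≤ s → ∀ t : ℝ, 0 ≤ t →
          (P.χ₀ = 0 →
            (V t).norm P.g 2 k ≤
              ENNReal.ofReal (C₁ * (1 + t) ^ (-(1 / 8 : ℝ) - (k : ℝ) / 4)) * V₀.norm P.g 1 0 +
              ENNReal.ofReal (C₂ * (1 + t) ^ (-(l : ℝ) / 2)) * V₀.norm P.g 2 (k + l)) ∧
          (P.χ₀ ≠ 0 →
            (V t).norm P.g 2 k ≤
              ENNReal.ofReal (C₁ * (1 + t) ^ (-(1 / 8 : ℝ) - (k : ℝ) / 4)) * V₀.norm P.g 1 0 +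
              ENNReal.ofReal (C₂ * (1 + t) ^ (-(l : ℝ) / 4)) * V₀.norm P.g 2 (k + l)) := by
  choose c₁ h₁ c₂ h₂ H using fun k l : ℕ => Timoshenko.exists_decay_estimate hP k l
  -- one pair of constants for all admissible orders: the sums of the finitely many constants
  have le_sum : ∀ c : ℕ → ℕ → ℝ, (∀ k l, c k l > 0) → ∀ k l, k + l ≤ s →
      c k l ≤ ∑ i ∈ Finset.range (s + 1), ∑ j ∈ Finset.range (s + 1), c i j := fun c hc k l hkl =>
    (Finset.single_le_sum (f := fun j => c k j) (fun j _ => (hc k j).le)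
      (Finset.mem_range.2 (by omega : l < s + 1))).trans
    (Finset.single_le_sum (f := fun i => ∑ j ∈ Finset.range (s + 1), c i j)
      (fun i _ => Finset.sum_nonneg fun j _ => (hc i j).le)
      (Finset.mem_range.2 (by omega : k < s + 1)))
  refine ⟨_, (h₁ 0 0).trans_le (le_sum c₁ h₁ 0 0 (Nat.zero_le _)), _,
    (h₂ 0 0).trans_le (le_sum c₂ h₂ 0 0 (Nat.zero_le _)), ?_⟩
  intro V₀ V hV₀ hV₁ hV k l hkl t ht
  have hT : 1 ≤ 1 + t := by linarith
  have main := H k l s V₀ V hkl hV₀ hV₁ hV t ht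
  constructor
  · intro _
    refine main.trans ?_
    gcongr
    · exact le_sum c₁ h₁ k l hkl
    · exact le_sum c₂ h₂ k l hkl
  · intro _
    refine main.trans ?_
    have h0 : 0 ≤ ∑ i ∈ Finset.range (s + 1), ∑ j ∈ Finset.range (s + 1), c₂ i j :=
      (h₂ k l).le.trans (le_sum c₂ h₂ k l hkl)
    have hexp : (1 + t) ^ (-(l : ℝ) / 2) ≤ (1 + t) ^ (-(l : ℝ) / 4) := by
      have := l.cast_nonneg (α := ℝ)
      exact Real.rpow_le_rpow_of_exponent_le hT (by linarith)
    refine add_le_add ?_ (mul_le_mul_left (ENNReal.ofReal_le_ofReal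
      (mul_le_mul (le_sum c₂ h₂ k l hkl) hexp (by positivity) h0)) _)
    gcongr
    exact le_sum c₁ h₁ k l hkl
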